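/- Let $d\ge 1$, $\alpha>0$, $0<r<\infty$ and $s_*>0$. For $f$ on $\mathbb R^d$ write $\widehat f(\xi)=\int e^{-ix\cdot\xi}f(x)\,dx$, $e^{it(-\Delta)^{\alpha/2}}f(x)=(2\pi)^{-d}\int e^{i(x\cdot\xi+t|\xi|^\alpha)}\widehat f(\xi)\,d\xi$ and $\|f\|_{H^\sigma}=\|(1+|\cdot|^2)^{\sigma/2}\widehat f\,\|_{L^2(\mathbb R^d)}$. For $0<\gamma\le d$, a nonnegative Borel measure $\mu$ on $\mathbb R^d$ is called $\gamma$-dimensional if there is a finite constant $C_\mu$ with $\mu(B(x,\rho))\le C_\mu\rho^\gamma$ for all $x\in\mathbb R^d$, $\rho>0$; $\langle\mu\rangle_\gamma$ denotes the infimum of such $C_\mu$. A real sequence $\{t_n\}$ belongs to $\ell^{r,\infty}(\mathbb N)$ if $\sup_{\delta>0}\delta^r\,\#\{n:|t_n|\ge\delta\}<\infty$. Put $$\tilde s_*=\frac{r\alpha}{r\min\{\alpha,1\}+2s_*}\,s_* .$$ (i) Let $0<\gamma\le d$ and suppose there is a constant $C$ such that, for every $\gamma$-dimensional measure $\mu$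 and every Schwartz function $f$, $$\Big\|\sup_{0<t<1}\big|e^{it(-\Delta)^{\alpha/2}}f\big|\Big\|_{L^2(B(0,1),d\mu)}\le C\langle\mu\rangle_\gamma^{1/2}\|f\|_{H^{\frac{d-\gamma}2+s_*}} .$$ Then for every $\{t_n\}\in\ell^{r,\infty}(\mathbb N)$ there is a constant $C'>0$ such that, for every $s\ge\min\{s_*,\tilde s_*\}$, every $\gamma$-dimensional $\mu$ and every $f\in H^{\frac{d-\gamma}2+s}(\mathbb R^d)$, $$\Big\|\sup_{n\in\mathbb N}\big|e^{it_n(-\Delta)^{\alpha/2}}f\big|\Big\|_{L^2(B(0,1),d\mu)}\le C'\langle\mu\rangle_\gamma^{1/2}\|f\|_{H^{\frac{d-\gamma}2+s}} .$$ Here each $e^{it_n(-\Delta)^{\alpha/2}}f$ is understood as the limit in $L^2(B(0,1),d\mu)$, as $N\to\infty$, of $(2\pi)^{-d}\int_{|\xi|<N}e^{i(x\cdot\xi+t_n|\xi|^\alpha)}\widehat f(\xi)\,d\xi$, and the existence of these limits is part of the conclusion. (ii) Suppose there is a constant $C$ such that $\big\|\sup_{0<t\le1}|e^{it(-\Delta)^{\alpha/2}}f|\big\|_{L^2(B(0,1))}\le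 C\|f\|_{H^{s_*}}$ for every Schwartz function $f$, with Lebesgue measure on $B(0,1)$. Then for every $\{t_n\}\in\ell^{r,\infty}(\mathbb N)$ there is a constant $C'>0$ such that $\big\|\sup_{n}|e^{it_n(-\Delta)^{\alpha/2}}f|\big\|_{L^2(B(0,1))}\le C'\|f\|_{H^{s}}$ for every $s\ge\min\{s_*,\tilde s_*\}$ and every $f\in H^s(\mathbb R^d)$, with $e^{it_n(-\Delta)^{\alpha/2}}f$ understood as in (i). -/

import Mathlib

open MeasureTheory Filter Topology
open scoped ENNReal NNReal SchwartzMap FourierTransform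

noncomputable section

namespace SeqSchrodinger

/-- `f̂(ξ) = ∫ exp(-i x·ξ) f(x) dx` for `f ∈ L²(ℝᵈ)`, extended from Schwartz functions by Plancherel.
Mathlib's `𝓕` has the phase `-2π i x·η`, hence the dilation `ξ = 2π η`. -/
def fourierHat {d : ℕ} (f : Lp ℂ 2 (volume : Measure (EuclideanSpace ℝ (Fin d)))) :
    EuclideanSpace ℝ (Fin d) → ℂ :=
  fun ξ => (𝓕 f : Lp ℂ 2 (volume : Measure (EuclideanSpace ℝ (Fin d)))) ((2 * Real.pi)⁻¹ • ξ)

/-- On Schwartz functions `fourierHat` is the classical integral. -/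
theorem fourierHat_schwartz {d : ℕ} (f : 𝓢(EuclideanSpace ℝ (Fin d), ℂ)) :
    fourierHat (f.toLp 2 volume) =ᵐ[volume]
      fun ξ => ∫ x, Complex.exp (-(Complex.I * ((inner ℝ x ξ : ℝ) : ℂ))) * f x := by
  have h := SchwartzMap.coeFn_toLp (𝓕 f) 2 (volume : Measure (EuclideanSpace ℝ (Fin d)))
  rw [← SchwartzMap.toLp_fourier_eq] at h
  have hq : Measure.QuasiMeasurePreserving
      (fun ξ : EuclideanSpace ℝ (Fin d) => (2 * Real.pi)⁻¹ • ξ) volume volume := by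
    refine ⟨by fun_prop, ?_⟩
    rw [Measure.map_addHaar_smul _ (by positivity)]
    exact Measure.smul_absolutelyContinuous
  filter_upwards [hq.ae h] with ξ hξ
  unfold fourierHat
  rw [hξ, SchwartzMap.fourier_coe, Real.fourier_eq']
  congr 1
  ext x
  rw [inner_smul_right, smul_eq_mul]
  congr 2
  push_cast
  field_simp

/-- `‖f‖_{H^σ} = ‖(1+|·|²)^{σ/2} f̂‖_{L²} ∈ [0,∞]`. For `σ ≥ 0` the space `H^σ(ℝᵈ)` is the set of
`f ∈ L²(ℝᵈ)` with `sobolevNorm σ f < ∞`. -/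
def sobolevNorm {d : ℕ} (σ : ℝ) (f : Lp ℂ 2 (volume : Measure (EuclideanSpace ℝ (Fin d)))) : ℝ≥0∞ :=
  eLpNorm (fun ξ => (((1 + ‖ξ‖ ^ 2) ^ (σ / 2) : ℝ) : ℂ) * fourierHat f ξ) 2 volume

/-- `(2π)^{-d} ∫_A exp(i(x·ξ + t|ξ|^α)) f̂(ξ) dξ`, the part of `e^{it(-Δ)^{α/2}} f (x)` coming from
frequencies in `A`. -/
def propagatorOn {d : ℕ} (α : ℝ) (A : Set (EuclideanSpace ℝ (Fin d)))
    (f : Lp ℂ 2 (volume : Measure (EuclideanSpace ℝ (Fin d)))) (t : ℝ) (x : EuclideanSpace ℝ (Fin d)) : ℂ :=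
  (((2 * Real.pi) ^ d)⁻¹ : ℝ) *
    ∫ ξ in A, Complex.exp (Complex.I * ((inner ℝ x ξ + t * ‖ξ‖ ^ α : ℝ) : ℂ)) * fourierHat f ξ

/-- `e^{it(-Δ)^{α/2}} f (x)`, given by the Fourier integral over all frequencies. It is used where
this integral converges absolutely, in particular for Schwartz `f`. -/
def propagator {d : ℕ} (α : ℝ) (f : Lp ℂ 2 (volume : Measure (EuclideanSpace ℝ (Fin d)))) (t : ℝ)
    (x : EuclideanSpace ℝ (Fin d)) : ℂ :=
  propagatorOn α Set.univ f t x

/-- `u` is (a version of) `e^{it(-Δ)^{α/2}} f` as an element of `L²(B(0,1), dμ)`: the limit in that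
space of the absolutely convergent integrals over the frequencies `|ξ| < N`, as `N → ∞`.
Such a `u` is unique up to `μ`-null subsets of `B(0,1)`. -/
def IsPropagatorTrace {d : ℕ} (α : ℝ) (μ : Measure (EuclideanSpace ℝ (Fin d)))
    (f : Lp ℂ 2 (volume : Measure (EuclideanSpace ℝ (Fin d)))) (t : ℝ)
    (u : EuclideanSpace ℝ (Fin d) → ℂ) : Prop :=
  MemLp u 2 (μ.restrict (Metric.ball 0 1)) ∧
  Tendsto (fun N : ℕ => eLpNorm (fun x => propagatorOn α (Metric.ball 0 (N : ℝ)) f t x - u x) 2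
    (μ.restrict (Metric.ball 0 1))) atTop (𝓝 0)

/-- `μ(B(x,ρ)) ≤ C ρ^γ` for all balls. -/
def GrowthBound {d : ℕ} (γ : ℝ) (μ : Measure (EuclideanSpace ℝ (Fin d))) (C : ℝ≥0) : Prop :=
  ∀ (x : EuclideanSpace ℝ (Fin d)) (ρ : ℝ), 0 < ρ →
    μ (Metric.ball x ρ) ≤ C * ENNReal.ofReal (ρ ^ γ)

/-- `μ` is `γ`-dimensional. -/
def IsDimensional {d : ℕ} (γ : ℝ) (μ : Measure (EuclideanSpace ℝ (Fin d))) : Prop :=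
  ∃ C : ℝ≥0, GrowthBound γ μ C

/-- `⟨μ⟩_γ`, the infimum of the admissible constants. -/
def growthConst {d : ℕ} (γ : ℝ) (μ : Measure (EuclideanSpace ℝ (Fin d))) : ℝ≥0 :=
  sInf {C : ℝ≥0 | GrowthBound γ μ C}

/-- The real sequence `t` belongs to `ℓ^{r,∞}(ℕ)`. -/
def MemWeakEll (r : ℝ) (t : ℕ → ℝ) : Prop :=
  (⨆ δ : ℝ, ⨆ _ : 0 < δ,
    ENNReal.ofReal (δ ^ r) * (({n : ℕ | δ ≤ |t n|}.encard : ℕ∞) : ℝ≥0∞)) < ∞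

/-- `‖ sup_{τ ∈ T} |e^{iτ(-Δ)^{α/2}} f| ‖_{L²(B(0,1),dμ)} ≤ K ‖f‖_{H^σ}` for all Schwartz `f`. -/
def MaximalEstimate {d : ℕ} (α : ℝ) (T : Set ℝ) (σ : ℝ)
    (μ : Measure (EuclideanSpace ℝ (Fin d))) (K : ℝ≥0) : Prop :=
  ∀ f : 𝓢(EuclideanSpace ℝ (Fin d), ℂ),
    eLpNorm (fun x => ⨆ τ ∈ T, ‖propagator α (f.toLp 2 volume) τ x‖ₑ) 2 (μ.restrict (Metric.ball 0 1))
      ≤ K * sobolevNorm σ (f.toLp 2 volume)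

/-- For every `f ∈ H^σ` (`σ ≥ 0`), all `e^{it_n(-Δ)^{α/2}} f` exist as elements of
`L²(B(0,1), dμ)`, and `‖ sup_n |e^{it_n(-Δ)^{α/2}} f| ‖_{L²(B(0,1),dμ)} ≤ K ‖f‖_{H^σ}`. -/
def SeqMaximalEstimate {d : ℕ} (α : ℝ) (t : ℕ → ℝ) (σ : ℝ)
    (μ : Measure (EuclideanSpace ℝ (Fin d))) (K : ℝ≥0) : Prop :=
  ∀ f : Lp ℂ 2 (volume : Measure (EuclideanSpace ℝ (Fin d))), sobolevNorm σ f < ∞ →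
    ∃ u : ℕ → EuclideanSpace ℝ (Fin d) → ℂ,
      (∀ n, IsPropagatorTrace α μ f (t n) (u n)) ∧
      eLpNorm (fun x => ⨆ n, ‖u n x‖ₑ) 2 (μ.restrict (Metric.ball 0 1)) ≤ K * sobolevNorm σ f

/-- The exponent `s̃_* = rα s_* / (r min{α,1} + 2 s_*)`. -/
def sTilde (α r sStar : ℝ) : ℝ :=
  r * α / (r * min α 1 + 2 * sStar) * sStar

end SeqSchrodinger

end

open MeasureTheory Filter Topology
open scoped ENNReal NNReal SchwartzMap FourierTransform

noncomputable section

namespace SeqSchrodinger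

/-! Write `R = 2^k` for a dyadic frequency, `δ = 2^(-j)` for a dyadic size of the times, `m = min α
1`, `p = sTilde α r s`. Up to the initial value (a fixed time estimate) and the finitely many `n`
with `|t n| ≥ 1`, the problem is to bound, for each pair `(j, k)`, the supremum over the times of
size `δ` of the evolution minus its initial value, for data of frequency about `R`. Measured against
the factor `R^((d-γ)/2)` of a single fixed time, three bounds compete.

Counting: weak `ℓ^r` allows about `2^(rj)` such times, so a square sum over them costs `2^(rj/2)`.
Immobility: if `δ R^α ≤ 1`, the multiplier `exp(it|ξ|^α) - 1` has size `δ R^α = 2^(αk-j)`; this gain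
is the reason for subtracting the initial value. Short times: if `Λ = δ R^α ≥ 1`, the hypothesis is
rescaled to balls of radius `ρ`, where it holds up to time `ρ^α` and costs `(ρR)^s`. During time `δ`
a wave of frequency `R` travels a distance of order `δ R^(α-1)`; if this is at most `ρ`, the balls
decouple and the local bound becomes global. Both conditions on `ρ` hold when `ρR = Λ^(1/m)`, so the
cost is `Λ^(s/m)`.

The counting cost and the short time cost agree with `R^p` on the line `pk = rj/2`, and this
equality is what determines `p`. Away from the line the best bound beats `R^p` by `2^(-ε|pk -
rj/2|)` (`exists_block_decay`), so Schur's test (`schur_lintegral`) sums the blocks with no loss in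
the exponent. The exponent `s` itself comes directly from the hypothesis, applied also to reflected
conjugate data in order to reach negative times.

The localization steps use no smooth cutoffs. A kernel `Q(t, ξ, ζ)` is expanded as an absolutely
convergent sum of products (`SepBound`), a class closed under products, sums and power series.
Expanding the plane wave on a ball of radius `1/R` and averaging over the centres with Plancherel
gives the bounds for measures (`lintegral_iSup_multiplier_le`); expanding the phase increment
against a window of width `cutoff d / ρ` gives the decoupling (`MaximalFamily.short_time`).

Rescaling changes the measure, so the hypothesis is carried by a dilation stable class
(`MaximalFamily`): all measures with growth constant at most `A`, or Lebesgue measure alone with `γ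
= d`. All estimates are proved for data of bounded frequency; `SeqMaximalEstimate.of_bandLimited`
passes to Sobolev data and yields the existence of the limits. -/

/-- The ambient Euclidean space. -/
abbrev Space (d : ℕ) := EuclideanSpace ℝ (Fin d)

/-! ### Oscillatory integrals and band limited data -/

/-- The plane wave `exp(i(x·ξ + t|ξ|^α))`. -/
def phase {d : ℕ} (α t : ℝ) (x ξ : Space d) : ℂ :=
  Complex.exp (Complex.I * ((inner ℝ x ξ + t * ‖ξ‖ ^ α : ℝ) : ℂ))

/-- The oscillatory integral `∫ exp(i(x·ξ + t|ξ|^α)) g(ξ) dξ`. -/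
def osc {d : ℕ} (α : ℝ) (g : Space d → ℂ) (t : ℝ) (x : Space d) : ℂ :=
  ∫ ξ, phase α t x ξ * g ξ

/-- The squared weighted norm `∫ (1+|ξ|²)^σ |g(ξ)|² dξ`. -/
def wEnergy {d : ℕ} (σ : ℝ) (g : Space d → ℂ) : ℝ≥0∞ :=
  ∫⁻ ξ, ENNReal.ofReal ((1 + ‖ξ‖ ^ 2) ^ σ) * ‖g ξ‖ₑ ^ 2

/-- Measurable square integrable functions of bounded support. -/
structure BandLimited {d : ℕ} (g : Space d → ℂ) : Prop where
  measurable : Measurable g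
  energy_lt_top : ∫⁻ ξ, ‖g ξ‖ₑ ^ 2 < ∞
  bounded : ∃ R : ℝ, ∀ ξ, R < ‖ξ‖ → g ξ = 0

variable {d : ℕ}

theorem eLpNorm_two_sq {X F : Type*} [MeasurableSpace X] [TopologicalSpace F] [ContinuousENorm F]
    (f : X → F) (μ : Measure X) :
    eLpNorm f 2 μ ^ 2 = ∫⁻ x, ‖f x‖ₑ ^ 2 ∂μ := by
  have h := eLpNorm_nnreal_pow_eq_lintegral (f := f) (p := 2) (μ := μ) (by norm_num)
  have h2 : ((2 : ℝ≥0) : ℝ) = ((2 : ℕ) : ℝ) := by norm_num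
  simp only [h2, ENNReal.rpow_natCast] at h
  exact h

theorem eLpNorm_two_le_iff {X F : Type*} [MeasurableSpace X] [TopologicalSpace F] [ContinuousENorm F]
    (f : X → F) (μ : Measure X) (c : ℝ≥0∞) :
    eLpNorm f 2 μ ≤ c ↔ ∫⁻ x, ‖f x‖ₑ ^ 2 ∂μ ≤ c ^ 2 := by
  rw [← eLpNorm_two_sq, ENNReal.pow_le_pow_left_iff (by norm_num)]

theorem norm_phase (α t : ℝ) (x ξ : Space d) : ‖phase α t x ξ‖ = 1 := by
  rw [phase, mul_comm, Complex.norm_exp_ofReal_mul_I]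

theorem enorm_phase (α t : ℝ) (x ξ : Space d) : ‖phase α t x ξ‖ₑ = 1 := by
  rw [← ofReal_norm, norm_phase, ENNReal.ofReal_one]

theorem continuous_phase {α : ℝ} (hα : 0 < α) :
    Continuous fun p : (ℝ × Space d) × Space d => phase α p.1.1 p.1.2 p.2 := by
  unfold phase
  have : Continuous fun p : (ℝ × Space d) × Space d => ‖p.2‖ ^ α :=
    (continuous_snd.norm).rpow_const fun _ => Or.inr hα.le
  fun_prop

theorem measurable_phase {α : ℝ} (hα : 0 < α) (t : ℝ) (x : Space d) :
    Measurable (phase α t x) :=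
  ((continuous_phase hα).comp (by fun_prop : Continuous fun ξ : Space d => ((t, x), ξ))).measurable

theorem integrable_phase_mul {α : ℝ} (hα : 0 < α) {g : Space d → ℂ} (hg : Integrable g)
    (t : ℝ) (x : Space d) : Integrable fun ξ => phase α t x ξ * g ξ :=
  hg.bdd_mul (measurable_phase hα t x).aestronglyMeasurable
    (Eventually.of_forall fun ξ => (norm_phase α t x ξ).le)

theorem continuous_osc {α : ℝ} (hα : 0 < α) {g : Space d → ℂ} (hg : Integrable g) :
    Continuous fun p : ℝ × Space d => osc α g p.1 p.2 := by
  refine continuous_of_dominated (bound := fun ξ => ‖g ξ‖) ?_ ?_ hg.norm ?_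
  · intro p
    exact (integrable_phase_mul hα hg p.1 p.2).aestronglyMeasurable
  · intro p
    filter_upwards with ξ
    rw [norm_mul, norm_phase, one_mul]
  · filter_upwards with ξ
    exact ((continuous_phase hα).comp (by fun_prop :
      Continuous fun p : ℝ × Space d => (p, ξ))).mul continuous_const

theorem continuous_osc_right {α : ℝ} (hα : 0 < α) {g : Space d → ℂ} (hg : Integrable g) (t : ℝ) :
    Continuous fun x => osc α g t x := by
  have h : Continuous fun x : Space d => (t, x) := by fun_prop
  have h2 := (continuous_osc hα hg).comp h
  simpa only [Function.comp_def] using h2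

theorem enorm_osc_le (α : ℝ) (g : Space d → ℂ) (t : ℝ) (x : Space d) :
    ‖osc α g t x‖ₑ ≤ ∫⁻ ξ, ‖g ξ‖ₑ := by
  refine (enorm_integral_le_lintegral_enorm _).trans (le_of_eq ?_)
  simp [enorm_mul, enorm_phase]

theorem osc_sub {α : ℝ} (hα : 0 < α) {g h : Space d → ℂ} (hg : Integrable g) (hh : Integrable h)
    (t : ℝ) (x : Space d) : osc α (fun ξ => g ξ - h ξ) t x = osc α g t x - osc α h t x := by
  simp only [osc, mul_sub]
  exact integral_sub (integrable_phase_mul hα hg t x) (integrable_phase_mul hα hh t x)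

/-- The set of times may be uncountable; a supremum of continuous functions is still lower
semicontinuous, which gives measurability without passing to a countable subset. -/
theorem lowerSemicontinuous_iSup_osc {α : ℝ} (hα : 0 < α) {g : Space d → ℂ} (hg : Integrable g)
    (T : Set ℝ) : LowerSemicontinuous fun x => ⨆ τ ∈ T, ‖osc α g τ x‖ₑ :=
  lowerSemicontinuous_biSup fun τ _ => (continuous_osc_right hα hg τ).enorm.lowerSemicontinuous

theorem measurable_iSup_osc {α : ℝ} (hα : 0 < α) {g : Space d → ℂ} (hg : Integrable g)
    (T : Set ℝ) : Measurable fun x => ⨆ τ ∈ T, ‖osc α g τ x‖ₑ :=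
  (lowerSemicontinuous_iSup_osc hα hg T).measurable

theorem BandLimited.memLp {g : Space d → ℂ} (hg : BandLimited g) : MemLp g 2 volume := by
  refine ⟨hg.measurable.aestronglyMeasurable, ?_⟩
  have := hg.energy_lt_top
  rw [← eLpNorm_two_sq] at this
  exact (ENNReal.pow_lt_top_iff.1 this).resolve_right (by norm_num)

theorem BandLimited.integrable {g : Space d → ℂ} (hg : BandLimited g) : Integrable g := by
  obtain ⟨R, hR⟩ := hg.bounded
  have h1 : IntegrableOn g (Metric.closedBall 0 R) := by
    have : IsFiniteMeasure (volume.restrict (Metric.closedBall (0 : Space d) R)) :=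
      ⟨by simpa using measure_closedBall_lt_top⟩
    exact (hg.memLp.restrict _).integrable (by norm_num)
  rwa [integrableOn_iff_integrable_of_support_subset] at h1
  intro ξ hξ
  by_contra h
  exact hξ (hR ξ (by simpa using h))

/-! ### Weighted energies and approximation by test functions -/

theorem continuous_weight (σ : ℝ) : Continuous fun ξ : Space d => (1 + ‖ξ‖ ^ 2) ^ σ :=
  (by fun_prop : Continuous fun ξ : Space d => 1 + ‖ξ‖ ^ 2).rpow_const
    fun ξ => Or.inl (by positivity)

theorem measurable_ofReal_weight (σ : ℝ) :
    Measurable fun ξ : Space d => ENNReal.ofReal ((1 + ‖ξ‖ ^ 2) ^ σ) :=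
  (continuous_weight σ).measurable.ennreal_ofReal

theorem wEnergy_zero (g : Space d → ℂ) : wEnergy 0 g = ∫⁻ ξ, ‖g ξ‖ₑ ^ 2 := by
  simp [wEnergy]

theorem wEnergy_mono {σ τ : ℝ} (h : σ ≤ τ) (g : Space d → ℂ) : wEnergy σ g ≤ wEnergy τ g := by
  unfold wEnergy
  gcongr with ξ
  nlinarith [sq_nonneg ‖ξ‖]

/-- The measure with density `(1+|ξ|²)^σ`. -/
def wMeasure (d : ℕ) (σ : ℝ) : Measure (Space d) :=
  volume.withDensity fun ξ => ENNReal.ofReal ((1 + ‖ξ‖ ^ 2) ^ σ)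

theorem lintegral_wMeasure (σ : ℝ) (F : Space d → ℝ≥0∞) :
    ∫⁻ ξ, F ξ ∂(wMeasure d σ) = ∫⁻ ξ, ENNReal.ofReal ((1 + ‖ξ‖ ^ 2) ^ σ) * F ξ := by
  rw [wMeasure, lintegral_withDensity_eq_lintegral_mul_non_measurable _ (measurable_ofReal_weight σ)]
  · rfl
  · exact Eventually.of_forall fun _ => ENNReal.ofReal_lt_top

theorem wEnergy_eq (σ : ℝ) (g : Space d → ℂ) : wEnergy σ g = eLpNorm g 2 (wMeasure d σ) ^ 2 := by
  rw [eLpNorm_two_sq, lintegral_wMeasure, wEnergy]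

instance (σ : ℝ) : IsLocallyFiniteMeasure (wMeasure d σ) :=
  IsLocallyFiniteMeasure.withDensity_ofReal (continuous_weight σ)

theorem aestronglyMeasurable_wMeasure {g : Space d → ℂ} (hg : AEStronglyMeasurable g volume)
    (σ : ℝ) : AEStronglyMeasurable g (wMeasure d σ) :=
  hg.mono_ac (withDensity_absolutelyContinuous _ _)

theorem BandLimited.wEnergy_lt_top {g : Space d → ℂ} (hg : BandLimited g) (σ : ℝ) :
    wEnergy σ g < ∞ := by
  obtain ⟨R, hR⟩ := hg.bounded
  have hle : wEnergy σ g ≤ ENNReal.ofReal ((1 + R ^ 2) ^ |σ|) * ∫⁻ ξ, ‖g ξ‖ₑ ^ 2 := by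
    rw [← lintegral_const_mul' _ _ ENNReal.ofReal_ne_top]
    refine lintegral_mono fun ξ => ?_
    rcases lt_or_ge R ‖ξ‖ with h | h
    · simp [hR ξ h]
    · gcongr
      calc (1 + ‖ξ‖ ^ 2) ^ σ ≤ (1 + ‖ξ‖ ^ 2) ^ |σ| :=
            Real.rpow_le_rpow_of_exponent_le (by nlinarith [sq_nonneg ‖ξ‖]) (le_abs_self σ)
        _ ≤ (1 + R ^ 2) ^ |σ| := by gcongr
  exact hle.trans_lt (ENNReal.mul_lt_top ENNReal.ofReal_lt_top hg.energy_lt_top)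

/-- The total mass `∫ (1+|ξ|²)^{-M} dξ` is finite for large `M`. -/
theorem lintegral_weight_neg_lt_top {M : ℝ} (hM : (d : ℝ) < 2 * M) :
    ∫⁻ ξ : Space d, ENNReal.ofReal ((1 + ‖ξ‖ ^ 2) ^ (-M)) < ∞ := by
  have h : Integrable fun ξ : Space d => (1 + ‖ξ‖ ^ 2) ^ (-(2 * M) / 2) :=
    integrable_rpow_neg_one_add_norm_sq (by simpa using hM)
  have h2 : -(2 * M) / 2 = -M := by ring
  rw [h2] at h
  exact h.lintegral_lt_top

/-- Cauchy-Schwarz after inserting the weight `(1+|ξ|²)^(-M/2)` and its inverse. For `2M > d` the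
first factor is finite, so weighted `L²` smallness implies `L¹` smallness. -/
theorem lintegral_enorm_le_wEnergy {g : Space d → ℂ} (hg : AEStronglyMeasurable g volume) (M : ℝ) :
    (∫⁻ ξ, ‖g ξ‖ₑ) ^ 2 ≤
      (∫⁻ ξ : Space d, ENNReal.ofReal ((1 + ‖ξ‖ ^ 2) ^ (-M))) * wEnergy M g := by
  have hw := fun s : ℝ => (measurable_ofReal_weight (d := d) s).aemeasurable (μ := volume)
  have h := ENNReal.lintegral_mul_le_Lp_mul_Lq (volume : Measure (Space d))
    (Real.HolderConjugate.two_two)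
    (hw (-M / 2)) ((hw (M / 2)).mul hg.enorm)
  have e1 : ∀ ξ : Space d, ENNReal.ofReal ((1 + ‖ξ‖ ^ 2) ^ (-M / 2)) *
      ENNReal.ofReal ((1 + ‖ξ‖ ^ 2) ^ (M / 2)) = 1 := by
    intro ξ
    rw [← ENNReal.ofReal_mul (by positivity), ← Real.rpow_add (by positivity)]
    simp [neg_div]
  have e2 : ∀ (s : ℝ) (ξ : Space d), ENNReal.ofReal ((1 + ‖ξ‖ ^ 2) ^ (s / 2)) ^ (2 : ℝ) =
      ENNReal.ofReal ((1 + ‖ξ‖ ^ 2) ^ s) := by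
    intro s ξ
    rw [ENNReal.ofReal_rpow_of_nonneg (by positivity) (by norm_num),
      ← Real.rpow_mul (by positivity)]
    norm_num
  simp only [Pi.mul_apply, ← mul_assoc, e1, one_mul, ENNReal.mul_rpow_of_nonneg _ _ zero_le_two,
    e2] at h
  calc (∫⁻ ξ, ‖g ξ‖ₑ) ^ 2 ≤ _ := pow_le_pow_left' h 2
    _ = _ := by
      rw [mul_pow, ← ENNReal.rpow_natCast, ← ENNReal.rpow_natCast, ← ENNReal.rpow_mul,
        ← ENNReal.rpow_mul]
      simp [wEnergy]

/-- Band limited functions are limits of test functions, in `L¹` and in weighted `L²`. -/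
theorem BandLimited.exists_approx {g : Space d → ℂ} (hg : BandLimited g) (σ : ℝ) {ε : ℝ}
    (hε : 0 < ε) : ∃ h : Space d → ℂ, HasCompactSupport h ∧ ContDiff ℝ (⊤ : ℕ∞) h ∧
      ∫⁻ ξ, ‖g ξ - h ξ‖ₑ ≤ ENNReal.ofReal ε ∧
      wEnergy σ (fun ξ => g ξ - h ξ) ≤ ENNReal.ofReal (ε ^ 2) := by
  -- One weight strong enough to dominate both the `L¹` norm and the energy of order `σ`, so that
  -- density in a single `L²` space suffices.
  set M : ℝ := max σ (d + 1) with hM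
  have hMd : (d : ℝ) < 2 * M := by
    have : (d : ℝ) + 1 ≤ M := le_max_right _ _
    have : (0 : ℝ) ≤ d := by positivity
    linarith
  set I := ∫⁻ ξ : Space d, ENNReal.ofReal ((1 + ‖ξ‖ ^ 2) ^ (-M)) with hI
  have hItop : I < ∞ := lintegral_weight_neg_lt_top hMd
  have hmem : MemLp g 2 (wMeasure d M) := by
    refine ⟨aestronglyMeasurable_wMeasure hg.measurable.aestronglyMeasurable M, ?_⟩
    have := hg.wEnergy_lt_top M
    rw [wEnergy_eq] at this
    exact (ENNReal.pow_lt_top_iff.1 this).resolve_right (by norm_num)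
  -- Chosen so that both `η ≤ ε` and `I η² ≤ ε²`; the latter is what Cauchy-Schwarz requires.
  set η : ℝ := ε / (1 + I.toReal) with hη
  have hηpos : 0 < η := by positivity
  have hηle : η ≤ ε := div_le_self hε.le (by linarith [ENNReal.toReal_nonneg (a := I)])
  obtain ⟨h, hc, hs, hle⟩ := hmem.exist_eLpNorm_sub_le (by norm_num) (by norm_num) hηpos
  have hW : wEnergy M (fun ξ => g ξ - h ξ) ≤ ENNReal.ofReal (η ^ 2) := by
    rw [wEnergy_eq, ENNReal.ofReal_pow hηpos.le]
    exact pow_le_pow_left' hle 2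
  refine ⟨h, hc, hs, ?_, ?_⟩
  · rw [← ENNReal.pow_le_pow_left_iff (two_ne_zero), ← ENNReal.ofReal_pow hε.le]
    refine (lintegral_enorm_le_wEnergy
      (hg.measurable.aestronglyMeasurable.sub hs.continuous.aestronglyMeasurable) M).trans ?_
    refine (mul_le_mul_right hW _).trans ?_
    rw [← hI, ← ENNReal.ofReal_toReal hItop.ne, ← ENNReal.ofReal_mul ENNReal.toReal_nonneg]
    refine ENNReal.ofReal_le_ofReal ?_
    rw [hη, div_pow, ← mul_div_assoc, div_le_iff₀ (by positivity)]
    nlinarith [ENNReal.toReal_nonneg (a := I), sq_nonneg ε, sq_nonneg (I.toReal),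
      mul_nonneg (sq_nonneg ε) (ENNReal.toReal_nonneg (a := I)),
      mul_nonneg (sq_nonneg ε) (sq_nonneg I.toReal)]
  · refine (wEnergy_mono (le_max_left _ _) _).trans (hW.trans ?_)
    exact ENNReal.ofReal_le_ofReal (by gcongr)

/-! ### Plancherel, and transfer of maximal estimates from Schwartz to band limited data -/

theorem lintegral_comp_smul_pos (F : Space d → ℝ≥0∞) {r : ℝ} (hr : 0 < r) :
    ∫⁻ x, F (r • x) = ENNReal.ofReal ((r ^ d)⁻¹) * ∫⁻ x, F x := by
  have h := lintegral_map_equiv (μ := (volume : Measure (Space d))) F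
    (MeasurableEquiv.smul (Units.mk0 r hr.ne'))
  have e : ⇑(MeasurableEquiv.smul (Units.mk0 r hr.ne') : Space d ≃ᵐ Space d) = fun x => r • x := rfl
  rw [e] at h
  rw [← h, Measure.map_addHaar_smul _ hr.ne', lintegral_smul_measure, finrank_euclideanSpace_fin,
    abs_of_pos (by positivity), smul_eq_mul]

theorem osc_zero_eq_fourier (α : ℝ) (h : Space d → ℂ) (k : Space d) :
    osc α h 0 k = 𝓕 h (-((2 * Real.pi)⁻¹ • k)) := by
  rw [osc, Real.fourier_eq']
  congr 1
  ext ξ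
  rw [phase, smul_eq_mul, inner_neg_right, inner_smul_right, real_inner_comm]
  congr 2
  push_cast
  field_simp
  ring

theorem lintegral_osc_zero_of_test (α : ℝ) {h : Space d → ℂ} (hc : HasCompactSupport h)
    (hs : ContDiff ℝ (⊤ : ℕ∞) h) :
    ∫⁻ k, ‖osc α h 0 k‖ₑ ^ 2 = ENNReal.ofReal ((2 * Real.pi) ^ d) * ∫⁻ ξ, ‖h ξ‖ₑ ^ 2 := by
  set f := hc.toSchwartzMap hs with hf
  have hcoe : (f : Space d → ℂ) = h := rfl
  have h1 : eLpNorm (𝓕 f : 𝓢(Space d, ℂ)) 2 volume = eLpNorm f 2 volume := by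
    have := SchwartzMap.norm_fourier_toL2_eq f
    rw [SchwartzMap.norm_toLp, SchwartzMap.norm_toLp] at this
    exact (ENNReal.toReal_eq_toReal_iff' (SchwartzMap.memLp _ 2 _).2.ne
      (SchwartzMap.memLp _ 2 _).2.ne).1 this
  have h2 : ∫⁻ η, ‖𝓕 h η‖ₑ ^ 2 = ∫⁻ ξ, ‖h ξ‖ₑ ^ 2 := by
    rw [← eLpNorm_two_sq, ← eLpNorm_two_sq, ← hcoe, ← h1, SchwartzMap.fourier_coe]
  simp only [osc_zero_eq_fourier]
  rw [lintegral_comp_smul_pos (fun k => ‖𝓕 h (-k)‖ₑ ^ 2) (r := (2 * Real.pi)⁻¹) (by positivity),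
    lintegral_neg_eq_self (fun k => ‖𝓕 h k‖ₑ ^ 2), h2, inv_pow, inv_inv]

theorem test_integrable {h : Space d → ℂ} (hc : HasCompactSupport h)
    (hs : ContDiff ℝ (⊤ : ℕ∞) h) : Integrable h :=
  hs.continuous.integrable_of_hasCompactSupport hc

theorem enorm_osc_sub_le {α : ℝ} (hα : 0 < α) {g h : Space d → ℂ} (hg : Integrable g)
    (hh : Integrable h) {ε : ℝ} (hε : ∫⁻ ξ, ‖g ξ - h ξ‖ₑ ≤ ENNReal.ofReal ε) (t : ℝ) (x : Space d) :
    ‖osc α g t x - osc α h t x‖ₑ ≤ ENNReal.ofReal ε := by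
  rw [← osc_sub hα hg hh]
  exact (enorm_osc_le _ _ _ _).trans hε

/-- Plancherel's inequality for band limited functions. -/
theorem lintegral_osc_zero_le {α : ℝ} (hα : 0 < α) {g : Space d → ℂ} (hg : BandLimited g) :
    ∫⁻ k, ‖osc α g 0 k‖ₑ ^ 2 ≤ ENNReal.ofReal ((2 * Real.pi) ^ d) * ∫⁻ ξ, ‖g ξ‖ₑ ^ 2 := by
  have hpos : ∀ n : ℕ, (0 : ℝ) < 1 / ((n : ℝ) + 1) := fun n => by positivity
  choose h hc hs h1 h2 using fun n : ℕ => hg.exists_approx 0 (hpos n)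
  have hlim : Tendsto (fun n : ℕ => ENNReal.ofReal (1 / ((n : ℝ) + 1))) atTop (𝓝 0) := by
    rw [← ENNReal.ofReal_zero]
    exact ENNReal.tendsto_ofReal tendsto_one_div_add_atTop_nhds_zero_nat
  have hptw : ∀ k, Tendsto (fun n => ‖osc α (h n) 0 k‖ₑ ^ 2) atTop (𝓝 (‖osc α g 0 k‖ₑ ^ 2)) := by
    intro k
    have : Tendsto (fun n => osc α (h n) 0 k) atTop (𝓝 (osc α g 0 k)) := by
      rw [tendsto_iff_edist_tendsto_0]
      refine tendsto_of_tendsto_of_tendsto_of_le_of_le tendsto_const_nhds hlim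
        (fun _ => zero_le) fun n => ?_
      rw [edist_comm, edist_eq_enorm_sub]
      exact enorm_osc_sub_le hα hg.integrable (test_integrable (hc n) (hs n)) (h1 n) 0 k
    exact ENNReal.Tendsto.pow this.enorm
  have hmeas : ∀ n, Measurable fun k => ‖osc α (h n) 0 k‖ₑ ^ 2 := fun n =>
    ((continuous_osc_right hα (test_integrable (hc n) (hs n)) 0).enorm.measurable).pow_const 2
  set a := eLpNorm g 2 volume
  have hbd : ∀ n, ∫⁻ ξ, ‖h n ξ‖ₑ ^ 2 ≤ (a + ENNReal.ofReal (1 / ((n : ℝ) + 1))) ^ 2 := by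
    intro n
    rw [← eLpNorm_two_le_iff]
    have hsub : eLpNorm (fun ξ => h n ξ - g ξ) 2 volume ≤ ENNReal.ofReal (1 / ((n : ℝ) + 1)) := by
      rw [eLpNorm_two_le_iff, ← ENNReal.ofReal_pow (hpos n).le]
      have := h2 n
      rw [wEnergy_zero] at this
      refine (le_of_eq ?_).trans this
      simp only [← edist_eq_enorm_sub, edist_comm]
    have hdec : h n = g + fun ξ => h n ξ - g ξ := by ext; simp
    calc eLpNorm (h n) 2 volume = eLpNorm (g + fun ξ => h n ξ - g ξ) 2 volume := by rw [← hdec]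
      _ ≤ _ := eLpNorm_add_le hg.measurable.aestronglyMeasurable
          ((hs n).continuous.aestronglyMeasurable.sub hg.measurable.aestronglyMeasurable)
          (by norm_num)
      _ ≤ _ := by gcongr
  have hlim2 : Tendsto (fun n : ℕ => ENNReal.ofReal ((2 * Real.pi) ^ d) *
      (a + ENNReal.ofReal (1 / ((n : ℝ) + 1))) ^ 2) atTop
      (𝓝 (ENNReal.ofReal ((2 * Real.pi) ^ d) * (a + 0) ^ 2)) :=
    ENNReal.Tendsto.const_mul (ENNReal.Tendsto.pow (tendsto_const_nhds.add hlim))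
      (Or.inr ENNReal.ofReal_ne_top)
  -- `L¹` approximation makes the transforms converge at every point, so Fatou's lemma gives the
  -- inequality, which is all that is used later.
  calc ∫⁻ k, ‖osc α g 0 k‖ₑ ^ 2
      = ∫⁻ k, liminf (fun n => ‖osc α (h n) 0 k‖ₑ ^ 2) atTop := by
        congr 1; ext k; exact (hptw k).liminf_eq.symm
    _ ≤ liminf (fun n => ∫⁻ k, ‖osc α (h n) 0 k‖ₑ ^ 2) atTop := lintegral_liminf_le hmeas
    _ ≤ liminf (fun n : ℕ => ENNReal.ofReal ((2 * Real.pi) ^ d) *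
      (a + ENNReal.ofReal (1 / ((n : ℝ) + 1))) ^ 2) atTop := by
        refine liminf_le_liminf (Eventually.of_forall fun n => ?_)
        rw [lintegral_osc_zero_of_test α (hc n) (hs n)]
        gcongr
        exact hbd n
    _ = _ := by rw [hlim2.liminf_eq, add_zero, eLpNorm_two_sq]

/-- Undo the dilation by `2π`, then invert `𝓕` in the Schwartz class. Through this the hypothesis on
Schwartz functions becomes a statement about arbitrary test functions on the Fourier side. -/
theorem fourierHat_congr_test {h : Space d → ℂ} (hc : HasCompactSupport h)
    (hs : ContDiff ℝ (⊤ : ℕ∞) h) : ∃ f : 𝓢(Space d, ℂ), fourierHat (f.toLp 2 volume) =ᵐ[volume] h := by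
  have hpi : (2 * Real.pi) ≠ 0 := by positivity
  have hc' : HasCompactSupport fun η => h ((2 * Real.pi) • η) := hc.comp_smul hpi
  have hs' : ContDiff ℝ (⊤ : ℕ∞) fun η => h ((2 * Real.pi) • η) := hs.comp (contDiff_const_smul _)
  set G := hc'.toSchwartzMap hs' with hG
  refine ⟨𝓕⁻ G, ?_⟩
  have h1 := SchwartzMap.coeFn_toLp G 2 (volume : Measure (Space d))
  have hq : Measure.QuasiMeasurePreserving
      (fun ξ : Space d => (2 * Real.pi)⁻¹ • ξ) volume volume := by
    refine ⟨by fun_prop, ?_⟩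
    rw [Measure.map_addHaar_smul _ (by positivity)]
    exact Measure.smul_absolutelyContinuous
  filter_upwards [hq.ae h1] with ξ hξ
  unfold fourierHat
  rw [SchwartzMap.toLp_fourier_eq, FourierTransform.fourier_fourierInv_eq, hξ]
  change h ((2 * Real.pi) • ((2 * Real.pi)⁻¹ • ξ)) = h ξ
  rw [smul_inv_smul₀ hpi]

theorem propagatorOn_eq (α : ℝ) {A : Set (Space d)} (hA : MeasurableSet A)
    (f : Lp ℂ 2 (volume : Measure (Space d))) (t : ℝ) (x : Space d) :
    propagatorOn α A f t x = (((2 * Real.pi) ^ d)⁻¹ : ℝ) * osc α (A.indicator (fourierHat f)) t x := by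
  rw [propagatorOn, osc, ← integral_indicator hA]
  congr 2
  ext ξ
  by_cases h : ξ ∈ A <;> simp [h, phase]

theorem sobolevNorm_sq (σ : ℝ) (f : Lp ℂ 2 (volume : Measure (Space d))) :
    sobolevNorm σ f ^ 2 = wEnergy σ (fourierHat f) := by
  rw [sobolevNorm, eLpNorm_two_sq, wEnergy]
  congr 1
  ext ξ
  rw [enorm_mul, mul_pow]
  congr 1
  rw [← ofReal_norm, Complex.norm_real, ← ENNReal.ofReal_pow (norm_nonneg _), Real.norm_eq_abs,
    sq_abs, ← Real.rpow_natCast, ← Real.rpow_mul (by positivity)]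
  norm_num

theorem wEnergy_congr_ae {σ : ℝ} {g h : Space d → ℂ} (H : g =ᵐ[volume] h) :
    wEnergy σ g = wEnergy σ h := by
  refine lintegral_congr_ae ?_
  filter_upwards [H] with ξ hξ
  rw [hξ]

theorem osc_congr_ae {α : ℝ} {g h : Space d → ℂ} (H : g =ᵐ[volume] h) (t : ℝ) (x : Space d) :
    osc α g t x = osc α h t x := by
  refine integral_congr_ae ?_
  filter_upwards [H] with ξ hξ
  rw [hξ]

/-- A maximal estimate for Schwartz functions holds for test functions on the Fourier side. -/
theorem MaximalEstimate.test {α : ℝ} {T : Set ℝ} {σ : ℝ} {μ : Measure (Space d)} {K : ℝ≥0}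
    (H : MaximalEstimate α T σ μ K) {h : Space d → ℂ} (hc : HasCompactSupport h)
    (hs : ContDiff ℝ (⊤ : ℕ∞) h) :
    eLpNorm (fun x => ⨆ τ ∈ T, ‖osc α h τ x‖ₑ) 2 (μ.restrict (Metric.ball 0 1)) ≤
      ENNReal.ofReal ((2 * Real.pi) ^ d) * K * eLpNorm h 2 (wMeasure d σ) := by
  obtain ⟨f, hf⟩ := fourierHat_congr_test hc hs
  have h1 := H f
  have h2 : sobolevNorm σ (f.toLp 2 volume) = eLpNorm h 2 (wMeasure d σ) := by
    refine (ENNReal.pow_right_strictMono (n := 2) (by norm_num)).injective ?_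
    rw [sobolevNorm_sq, wEnergy_congr_ae hf, wEnergy_eq]
  have hpos : 0 < (2 * Real.pi) ^ d := by positivity
  have h3 : ∀ τ x, ‖osc α h τ x‖ₑ =
      ENNReal.ofReal ((2 * Real.pi) ^ d) * ‖propagator α (f.toLp 2 volume) τ x‖ₑ := by
    intro τ x
    rw [propagator, propagatorOn_eq α MeasurableSet.univ, Set.indicator_univ, osc_congr_ae hf,
      enorm_mul, ← mul_assoc, ← ofReal_norm (((((2 * Real.pi) ^ d)⁻¹ : ℝ)) : ℂ),
      Complex.norm_real, ← ENNReal.ofReal_mul hpos.le, Real.norm_of_nonneg (by positivity),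
      mul_inv_cancel₀ hpos.ne', ENNReal.ofReal_one, one_mul]
  rw [h2] at h1
  simp only [h3, ← ENNReal.mul_iSup]
  rw [mul_assoc]
  refine (eLpNorm_le_mul_eLpNorm_of_ae_le_mul' (c := Real.toNNReal ((2 * Real.pi) ^ d))
    (g := fun x => ⨆ τ ∈ T, ‖propagator α (f.toLp 2 volume) τ x‖ₑ)
    (Eventually.of_forall fun x => le_of_eq ?_) 2).trans (mul_le_mul_right h1 _)
  rfl

/-- A maximal estimate for Schwartz functions extends to band limited functions. -/
theorem MaximalEstimate.bandLimited {α : ℝ} (hα : 0 < α) {T : Set ℝ} {σ : ℝ}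
    {μ : Measure (Space d)} {K : ℝ≥0} (H : MaximalEstimate α T σ μ K)
    (hμ : μ (Metric.ball 0 1) < ∞) {g : Space d → ℂ} (hg : BandLimited g) :
    ∫⁻ x in Metric.ball 0 1, (⨆ τ ∈ T, ‖osc α g τ x‖ₑ) ^ 2 ∂μ ≤
      (ENNReal.ofReal ((2 * Real.pi) ^ d) * K) ^ 2 * wEnergy σ g := by
  have hpos : ∀ n : ℕ, (0 : ℝ) < 1 / ((n : ℝ) + 1) := fun n => by positivity
  choose h hc hs h1 h2 using fun n : ℕ => hg.exists_approx σ (hpos n)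
  have hlim : Tendsto (fun n : ℕ => ENNReal.ofReal (1 / ((n : ℝ) + 1))) atTop (𝓝 0) := by
    rw [← ENNReal.ofReal_zero]
    exact ENNReal.tendsto_ofReal tendsto_one_div_add_atTop_nhds_zero_nat
  set a := eLpNorm g 2 (wMeasure d σ) with ha
  set L := ENNReal.ofReal ((2 * Real.pi) ^ d) * K with hL
  have hLtop : L ≠ ∞ := ENNReal.mul_ne_top ENNReal.ofReal_ne_top ENNReal.coe_ne_top
  set ν := μ.restrict (Metric.ball (0 : Space d) 1) with hν
  -- The `L²(ν)` norm of the constant 1: a uniform error `e` in the oscillatory integrals costs `e *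
  -- m`.
  set m : ℝ≥0∞ := ν Set.univ ^ (1 / (2 : ℝ)) with hm
  have hm2 : m ^ 2 = ν Set.univ := by
    rw [hm, ← ENNReal.rpow_natCast, ← ENNReal.rpow_mul]
    norm_num
  have hmtop : m ≠ ∞ := by
    refine ENNReal.rpow_ne_top_of_nonneg (by positivity) ?_
    rw [hν, Measure.restrict_apply_univ]
    exact hμ.ne
  set S : (Space d → ℂ) → Space d → ℝ≥0∞ := fun g x => ⨆ τ ∈ T, ‖osc α g τ x‖ₑ with hS
  have key : ∀ n : ℕ, eLpNorm (S g) 2 ν ≤ L * (a + ENNReal.ofReal (1 / ((n : ℝ) + 1))) +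
      ENNReal.ofReal (1 / ((n : ℝ) + 1)) * m := by
    intro n
    set e := ENNReal.ofReal (1 / ((n : ℝ) + 1)) with he
    have hhi := test_integrable (hc n) (hs n)
    have hle : ∀ x, S g x ≤ (S (h n) + fun _ => e : Space d → ℝ≥0∞) x := by
      intro x
      refine iSup₂_le fun τ hτ => ?_
      have e1 : ‖osc α g τ x‖ₑ ≤ ‖osc α (h n) τ x‖ₑ + e := by
        have := enorm_osc_sub_le hα hg.integrable hhi (h1 n) τ x
        calc ‖osc α g τ x‖ₑ = ‖osc α (h n) τ x + (osc α g τ x - osc α (h n) τ x)‖ₑ := by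
              congr 1; ring
          _ ≤ _ := (enorm_add_le _ _).trans (by gcongr)
      refine e1.trans ?_
      simp only [Pi.add_apply]
      gcongr
      exact le_iSup₂ (f := fun τ _ => ‖osc α (h n) τ x‖ₑ) τ hτ
    have hsub : eLpNorm (h n) 2 (wMeasure d σ) ≤ a + e := by
      have hdec : h n = g + fun ξ => h n ξ - g ξ := by ext; simp
      have hmg := aestronglyMeasurable_wMeasure hg.measurable.aestronglyMeasurable σ
      have hmh := aestronglyMeasurable_wMeasure (hs n).continuous.aestronglyMeasurable σ
      calc eLpNorm (h n) 2 (wMeasure d σ) = eLpNorm (g + fun ξ => h n ξ - g ξ) 2 (wMeasure d σ) := by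
            rw [← hdec]
        _ ≤ _ := eLpNorm_add_le hmg (hmh.sub hmg) (by norm_num)
        _ ≤ _ := by
          gcongr
          rw [eLpNorm_two_le_iff, he, ← ENNReal.ofReal_pow (hpos n).le]
          refine (le_of_eq ?_).trans (h2 n)
          rw [wEnergy_eq, eLpNorm_two_sq]
          simp only [← edist_eq_enorm_sub, edist_comm]
    calc eLpNorm (S g) 2 ν ≤ eLpNorm (S (h n) + fun _ => e : Space d → ℝ≥0∞) 2 ν :=
          eLpNorm_mono_enorm fun x => by simpa using hle x
      _ ≤ eLpNorm (S (h n)) 2 ν + eLpNorm (fun _ : Space d => e) 2 ν :=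
          eLpNorm_add_le (measurable_iSup_osc hα hhi T).aestronglyMeasurable
            aestronglyMeasurable_const (by norm_num)
      _ ≤ L * (a + e) + e * m := by
        gcongr
        · exact (H.test (hc n) (hs n)).trans (by gcongr)
        · rw [eLpNorm_two_le_iff, mul_pow, hm2, lintegral_const, enorm_eq_self]
  have hlim2 : Tendsto (fun n : ℕ => L * (a + ENNReal.ofReal (1 / ((n : ℝ) + 1))) +
      ENNReal.ofReal (1 / ((n : ℝ) + 1)) * m) atTop (𝓝 (L * (a + 0) + 0 * m)) :=
    (ENNReal.Tendsto.const_mul (tendsto_const_nhds.add hlim) (Or.inr hLtop)).add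
      (ENNReal.Tendsto.mul_const hlim (Or.inr hmtop))
  have hfin := ge_of_tendsto' hlim2 key
  rw [add_zero, zero_mul, add_zero, eLpNorm_two_le_iff, mul_pow, ha, ← wEnergy_eq] at hfin
  simpa using hfin

/-! ### Separated expansions and their calculus -/

/-- Weighted Cauchy-Schwarz inequality for series in `[0, ∞]`. -/
theorem tsum_mul_sq_le {ι : Type*} (b x : ι → ℝ≥0∞) :
    (∑' i, b i * x i) ^ 2 ≤ (∑' i, b i) * ∑' i, b i * x i ^ 2 := by
  let _ : MeasurableSpace ι := ⊤
  have h := ENNReal.lintegral_mul_le_Lp_mul_Lq (Measure.count : Measure ι)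
    (Real.HolderConjugate.two_two) (f := fun i => b i ^ (1 / 2 : ℝ))
    (g := fun i => b i ^ (1 / 2 : ℝ) * x i) (measurable_from_top.aemeasurable)
    (measurable_from_top.aemeasurable)
  have e : ∀ i, b i ^ (1 / 2 : ℝ) * b i ^ (1 / 2 : ℝ) = b i := by
    intro i
    rw [← ENNReal.rpow_add_of_nonneg _ _ (by norm_num) (by norm_num)]
    norm_num
  have e2 : ∀ i, (b i ^ (1 / 2 : ℝ)) ^ (2 : ℝ) = b i := by
    intro i
    rw [← ENNReal.rpow_mul]
    norm_num
  simp only [Pi.mul_apply, ← mul_assoc, e, ENNReal.mul_rpow_of_nonneg _ _ zero_le_two, e2,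
    lintegral_count, ENNReal.rpow_two] at h
  calc (∑' i, b i * x i) ^ 2 ≤ _ := pow_le_pow_left' h 2
    _ = _ := by
      rw [mul_pow, ← ENNReal.rpow_natCast, ← ENNReal.rpow_natCast, ← ENNReal.rpow_mul,
        ← ENNReal.rpow_mul]
      simp

/-- `Q(t,ξ,ζ)` is, for `t ∈ T`, `ξ ∈ X`, `ζ ∈ Z`, a sum of products `c_j(t) a_j(ξ) b_j(ζ)` with
`|a_j|, |b_j| ≤ 1` and `∑ sup |c_j| ≤ M`. -/
def SepBound {τ χ ζ : Type*} [MeasurableSpace χ] [MeasurableSpace ζ] (T : Set τ) (X : Set χ)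
    (Z : Set ζ) (Q : τ → χ → ζ → ℂ) (M : ℝ≥0) : Prop :=
  ∃ (ι : Type) (_ : Countable ι) (m : ι → ℝ≥0) (c : ι → τ → ℂ) (a : ι → χ → ℂ) (b : ι → ζ → ℂ),
    (∀ j, Measurable (a j)) ∧ (∀ j, Measurable (b j)) ∧
    (∀ j, ∀ t ∈ T, ‖c j t‖ ≤ m j) ∧ (∀ j, ∀ x ∈ X, ‖a j x‖ ≤ 1) ∧ (∀ j, ∀ z ∈ Z, ‖b j z‖ ≤ 1) ∧
    ∑' j, (m j : ℝ≥0∞) ≤ M ∧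
    ∀ t ∈ T, ∀ x ∈ X, ∀ z ∈ Z, HasSum (fun j => c j t * a j x * b j z) (Q t x z)

namespace SepBound

theorem norm_term_le {τ χ ζ : Type*} {T : Set τ} {X : Set χ} {Z : Set ζ} {ι : Type} {m : ι → ℝ≥0} {c : ι → τ → ℂ} {a : ι → χ → ℂ} {b : ι → ζ → ℂ}
    (hc1 : ∀ j, ∀ t ∈ T, ‖c j t‖ ≤ m j) (ha1 : ∀ j, ∀ x ∈ X, ‖a j x‖ ≤ 1)
    (hb1 : ∀ j, ∀ z ∈ Z, ‖b j z‖ ≤ 1) {t : τ} (ht : t ∈ T) {x : χ} (hx : x ∈ X) {z : ζ}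
    (hz : z ∈ Z) (j : ι) : ‖c j t * a j x * b j z‖ ≤ m j := by
  rw [norm_mul, norm_mul]
  calc ‖c j t‖ * ‖a j x‖ * ‖b j z‖ ≤ m j * 1 * 1 := by
        gcongr
        exacts [hc1 j t ht, ha1 j x hx, hb1 j z hz]
    _ = m j := by ring

theorem summable_of_tsum_le {ι : Type} {m : ι → ℝ≥0} {M : ℝ≥0}
    (hm : ∑' j, (m j : ℝ≥0∞) ≤ M) :
    Summable fun j => (m j : ℝ) :=
  NNReal.summable_coe.2 (ENNReal.tsum_coe_ne_top_iff_summable.1 (hm.trans_lt ENNReal.coe_lt_top).ne)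

variable {τ χ ζ : Type*} [MeasurableSpace χ] [MeasurableSpace ζ] {T : Set τ} {X : Set χ}
    {Z : Set ζ} {Q Q' : τ → χ → ζ → ℂ} {M M' : ℝ≥0}

theorem mono (h : SepBound T X Z Q M) (hM : M ≤ M') : SepBound T X Z Q M' := by
  obtain ⟨ι, hι, m, c, a, b, ha, hb, hc1, ha1, hb1, hm, hs⟩ := h
  exact ⟨ι, hι, m, c, a, b, ha, hb, hc1, ha1, hb1, hm.trans (by exact_mod_cast hM), hs⟩

theorem congr (h : SepBound T X Z Q M)
    (hQ : ∀ t ∈ T, ∀ x ∈ X, ∀ z ∈ Z, Q t x z = Q' t x z) : SepBound T X Z Q' M := by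
  obtain ⟨ι, hι, m, c, a, b, ha, hb, hc1, ha1, hb1, hm, hs⟩ := h
  exact ⟨ι, hι, m, c, a, b, ha, hb, hc1, ha1, hb1, hm,
    fun t ht x hx z hz => hQ t ht x hx z hz ▸ hs t ht x hx z hz⟩

/-- One product is one term: the factors in `x` and `z` are normalized to sup norm at most 1 and
their sizes are moved into `c`. The divisions are the reason for `0 < A` and `0 < B`. -/
theorem single {c : τ → ℂ} {a : χ → ℂ} {b : ζ → ℂ} (ha : Measurable a) (hb : Measurable b)
    {C A B : ℝ≥0} (hA : 0 < A) (hB : 0 < B) (hc1 : ∀ t ∈ T, ‖c t‖ ≤ C) (ha1 : ∀ x ∈ X, ‖a x‖ ≤ A)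
    (hb1 : ∀ z ∈ Z, ‖b z‖ ≤ B) : SepBound T X Z (fun t x z => c t * a x * b z) (C * A * B) := by
  refine ⟨Unit, inferInstance, fun _ => C * A * B, fun _ t => c t * (A : ℝ) * (B : ℝ),
    fun _ x => a x / (A : ℝ), fun _ z => b z / (B : ℝ), fun _ => ha.div_const _,
    fun _ => hb.div_const _, ?_, ?_, ?_, by simp, ?_⟩
  · intro _ t ht
    simp only [norm_mul, Complex.norm_real, NNReal.coe_mul, Real.norm_of_nonneg (NNReal.coe_nonneg _)]
    gcongr
    exact hc1 t ht
  · intro _ x hx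
    rw [norm_div, Complex.norm_real, Real.norm_of_nonneg A.coe_nonneg]
    exact div_le_one_of_le₀ (ha1 x hx) A.coe_nonneg
  · intro _ x hx
    rw [norm_div, Complex.norm_real, Real.norm_of_nonneg B.coe_nonneg]
    exact div_le_one_of_le₀ (hb1 x hx) B.coe_nonneg
  · intro t _ x _ z _
    have h1 : ((A : ℝ) : ℂ) ≠ 0 := by exact_mod_cast hA.ne'
    have h2 : ((B : ℝ) : ℂ) ≠ 0 := by exact_mod_cast hB.ne'
    have : c t * a x * b z = c t * (A : ℝ) * (B : ℝ) * (a x / (A : ℝ)) * (b z / (B : ℝ)) := by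
      field_simp
    beta_reduce
    rw [this]
    exact hasSum_unique _

theorem const (z : ℂ) : SepBound T X Z (fun _ _ _ => z) ‖z‖₊ := by
  have := single (T := T) (X := X) (Z := Z) (c := fun _ => z) (a := fun _ => 1) (b := fun _ => 1)
    measurable_const measurable_const (C := ‖z‖₊) (A := 1) (B := 1) one_pos one_pos (by simp)
    (by simp) (by simp)
  simpa using this

theorem norm_le (h : SepBound T X Z Q M) {t : τ} (ht : t ∈ T) {x : χ} (hx : x ∈ X) {z : ζ}
    (hz : z ∈ Z) : ‖Q t x z‖ ≤ M := by
  obtain ⟨ι, hι, m, c, a, b, ha, hb, hc1, ha1, hb1, hm, hs⟩ := h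
  have hsum := summable_of_tsum_le hm
  have h1 := (hs t ht x hx z hz).tsum_eq
  rw [← h1]
  refine (tsum_of_norm_bounded hsum.hasSum fun j => norm_term_le hc1 ha1 hb1 ht hx hz j).trans ?_
  rw [← NNReal.coe_tsum]
  have h2 := ENNReal.coe_tsum (NNReal.summable_coe.1 hsum)
  rw [← h2] at hm
  exact_mod_cast hm

/-- The terms of a product are the products of terms, indexed by pairs, so `M` behaves like a Banach
algebra norm. -/
theorem mul (h : SepBound T X Z Q M) (h' : SepBound T X Z Q' M') :
    SepBound T X Z (fun t x z => Q t x z * Q' t x z) (M * M') := by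
  obtain ⟨ι, hι, m, c, a, b, ha, hb, hc1, ha1, hb1, hm, hs⟩ := h
  obtain ⟨κ, hκ, m', c', a', b', ha', hb', hc1', ha1', hb1', hm', hs'⟩ := h'
  refine ⟨ι × κ, inferInstance, fun p => m p.1 * m' p.2, fun p t => c p.1 t * c' p.2 t,
    fun p x => a p.1 x * a' p.2 x, fun p z => b p.1 z * b' p.2 z, fun p => (ha _).mul (ha' _),
    fun p => (hb _).mul (hb' _), ?_, ?_, ?_, ?_, ?_⟩
  · intro p t ht
    rw [norm_mul, NNReal.coe_mul]
    gcongr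
    exacts [hc1 _ t ht, hc1' _ t ht]
  · intro p x hx
    rw [norm_mul]
    exact mul_le_one₀ (ha1 _ x hx) (norm_nonneg _) (ha1' _ x hx)
  · intro p x hx
    rw [norm_mul]
    exact mul_le_one₀ (hb1 _ x hx) (norm_nonneg _) (hb1' _ x hx)
  · rw [ENNReal.tsum_prod']
    simp only [ENNReal.coe_mul, ENNReal.tsum_mul_left, ENNReal.tsum_mul_right]
    gcongr
  · intro t ht x hx z hz
    have s1 : Summable fun j => ‖c j t * a j x * b j z‖ :=
      Summable.of_nonneg_of_le (fun _ => norm_nonneg _)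
        (fun j => norm_term_le hc1 ha1 hb1 ht hx hz j) (summable_of_tsum_le hm)
    have s2 : Summable fun j => ‖c' j t * a' j x * b' j z‖ :=
      Summable.of_nonneg_of_le (fun _ => norm_nonneg _)
        (fun j => norm_term_le hc1' ha1' hb1' ht hx hz j) (summable_of_tsum_le hm')
    have s3 : Summable fun p : ι × κ => (c p.1 t * a p.1 x * b p.1 z) *
        (c' p.2 t * a' p.2 x * b' p.2 z) := 
      summable_mul_of_summable_norm (f := fun j => c j t * a j x * b j z)
        (g := fun j => c' j t * a' j x * b' j z) s1 s2
    have h1 := hs t ht x hx z hz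
    have h2 := hs' t ht x hx z hz
    have s4 := HasSum.mul (f := fun j => c j t * a j x * b j z)
      (g := fun j => c' j t * a' j x * b' j z) h1 h2 s3
    refine s4.congr_fun ?_ |> id
    intro p
    ring

theorem hasSum {Qn : ℕ → τ → χ → ζ → ℂ} {Mn : ℕ → ℝ≥0} (h : ∀ n, SepBound T X Z (Qn n) (Mn n))
    (hM : ∑' n, (Mn n : ℝ≥0∞) ≤ M)
    (hQ : ∀ t ∈ T, ∀ x ∈ X, ∀ z ∈ Z, HasSum (fun n => Qn n t x z) (Q t x z)) :
    SepBound T X Z Q M := by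
  choose ι hι m c a b ha hb hc1 ha1 hb1 hm hs using h
  have hMs : ∑' p : (Σ n, ι n), (m p.1 p.2 : ℝ≥0∞) ≤ M := by
    rw [ENNReal.tsum_sigma']
    exact (ENNReal.tsum_le_tsum hm).trans hM
  refine ⟨Σ n, ι n, inferInstance, fun p => m p.1 p.2, fun p => c p.1 p.2, fun p => a p.1 p.2,
    fun p => b p.1 p.2, fun p => ha p.1 p.2, fun p => hb p.1 p.2, fun p => hc1 p.1 p.2,
    fun p => ha1 p.1 p.2, fun p => hb1 p.1 p.2, hMs, ?_⟩
  intro t ht x hx z hz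
  refine HasSum.sigma_of_hasSum (f := fun p : (Σ n, ι n) => c p.1 p.2 t * a p.1 p.2 x * b p.1 p.2 z)
    (hQ t ht x hx z hz) (fun n => hs n t ht x hx z hz) ?_
  exact Summable.of_norm_bounded (g := fun p : (Σ n, ι n) => (m p.1 p.2 : ℝ))
    (summable_of_tsum_le (m := fun p : (Σ n, ι n) => m p.1 p.2) hMs)
    fun p => norm_term_le (hc1 p.1) (ha1 p.1) (hb1 p.1) ht hx hz p.2

theorem add (h : SepBound T X Z Q M) (h' : SepBound T X Z Q' M') :
    SepBound T X Z (fun t x z => Q t x z + Q' t x z) (M + M') := by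
  have h0 : SepBound T X Z (fun _ _ _ => (0 : ℂ)) 0 := by simpa using const (0 : ℂ)
  -- A sum of two is an infinite sum padded with zeros.
  refine hasSum (Qn := fun n => if n = 0 then Q else if n = 1 then Q' else fun _ _ _ => 0)
    (Mn := fun n => if n = 0 then M else if n = 1 then M' else 0) ?_ ?_ ?_
  · intro n
    split_ifs
    exacts [h, h', h0]
  · rw [tsum_eq_sum (s := Finset.range 2)]
    · simp [Finset.sum_range_succ]
    · intro n hn
      have : n ≠ 0 ∧ n ≠ 1 := by simp at hn; omega
      simp [this]
  · intro t _ x _ z _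
    have : HasSum (fun n : ℕ => (if n = 0 then Q else if n = 1 then Q' else fun _ _ _ => 0) t x z)
        (∑ n ∈ Finset.range 2, (if n = 0 then Q else if n = 1 then Q' else fun _ _ _ => 0) t x z) := by
      refine hasSum_sum_of_ne_finset_zero fun n hn => ?_
      have : n ≠ 0 ∧ n ≠ 1 := by simp at hn; omega
      simp [this]
    simpa [Finset.sum_range_succ] using this

theorem sum {κ : Type*} (s : Finset κ) {Qn : κ → τ → χ → ζ → ℂ} {Mn : κ → ℝ≥0}
    (h : ∀ i, SepBound T X Z (Qn i) (Mn i)) :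
    SepBound T X Z (fun t x z => ∑ i ∈ s, Qn i t x z) (∑ i ∈ s, Mn i) := by
  classical
  induction s using Finset.induction_on with
  | empty => simpa using const (0 : ℂ)
  | insert i s hi ih =>
    simp only [Finset.sum_insert hi]
    exact (h i).add ih

theorem pow (h : SepBound T X Z Q M) (n : ℕ) :
    SepBound T X Z (fun t x z => Q t x z ^ n) (M ^ n) := by
  induction n with
  | zero => simpa using const (1 : ℂ)
  | succ n ih => simpa only [pow_succ] using ih.mul h

/-- Functional calculus in a Banach algebra: the new bound is the majorant series `∑ |p n| M^n`. -/
theorem powerSeries (h : SepBound T X Z Q M) {p : ℕ → ℂ} {f : ℂ → ℂ}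
    (hp : ∑' n, ((‖p n‖₊ * M ^ n : ℝ≥0) : ℝ≥0∞) ≤ M')
    (hf : ∀ z : ℂ, ‖z‖ ≤ M → HasSum (fun n => p n * z ^ n) (f z)) :
    SepBound T X Z (fun t x z => f (Q t x z)) M' :=
  hasSum (fun n => (const (p n)).mul (h.pow n)) hp
    fun _ ht _ hx _ hz => hf _ (h.norm_le ht hx hz)

/-- Removing the constant term keeps the bound comparable to `M` for small `M`; both the gain at
very short times and the phase increment depend on this smallness. -/
theorem exp_sub_one (h : SepBound T X Z Q M) :
    SepBound T X Z (fun t x z => Complex.exp (Q t x z) - 1) (Real.toNNReal (Real.exp M - 1)) := by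
  have hz : ∀ z : ℂ, HasSum (fun n : ℕ => (if n = 0 then 0 else (n.factorial : ℂ)⁻¹) * z ^ n)
      (Complex.exp z - 1) := by
    intro z
    have h1 : HasSum (fun n : ℕ => (n.factorial : ℂ)⁻¹ * z ^ n) (Complex.exp z) := by
      rw [Complex.exp_eq_exp_ℂ]
      simpa using NormedSpace.exp_series_hasSum_exp' (𝕂 := ℂ) z
    have h2 := h1.sub (hasSum_ite_eq (0 : ℕ) (1 : ℂ))
    refine h2.congr_fun ?_ |> id
    intro n
    by_cases hn : n = 0 <;> simp [hn]
  refine h.powerSeries (p := fun n => if n = 0 then 0 else (n.factorial : ℂ)⁻¹)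
    (f := fun z => Complex.exp z - 1) ?_ fun z _ => hz z
  refine le_of_eq (ENNReal.tsum_coe_eq ?_)
  rw [← NNReal.hasSum_coe, Real.coe_toNNReal _ (sub_nonneg.2 (Real.one_le_exp M.coe_nonneg)),
    ← Complex.hasSum_ofReal]
  have h1 := hz (M : ℝ)
  push_cast
  refine h1.congr_fun ?_ |> id
  intro n
  by_cases hn : n = 0 <;> simp [hn]

theorem exp (h : SepBound T X Z Q M) :
    SepBound T X Z (fun t x z => Complex.exp (Q t x z)) (Real.toNNReal (Real.exp M)) := by
  have h1 := h.exp_sub_one.add (const (1 : ℂ))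
  simp only [sub_add_cancel] at h1
  refine h1.mono (le_of_eq ?_)
  have : (1 : ℝ) ≤ Real.exp M := Real.one_le_exp M.coe_nonneg
  ext
  simp [Real.coe_toNNReal _ (sub_nonneg.2 this), Real.coe_toNNReal _ (Real.exp_pos _).le]

/-- The Taylor coefficients have modulus at most 1, and `∑_{n ≥ 1} M^n ≤ 2M` for `M ≤ 1/2`. Combined
with the exponential this gives fractional powers of `1 + Q`. -/
theorem log_one_add (h : SepBound T X Z Q M) (hM : M ≤ 1 / 2) :
    SepBound T X Z (fun t x z => Complex.log (1 + Q t x z)) (2 * M) := by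
  -- Division by zero makes the coefficient at `n = 0` vanish, as it should.
  refine h.powerSeries (p := fun n => (-1) ^ (n + 1) / n) (f := fun z => Complex.log (1 + z)) ?_ ?_
  · have hle : ∀ n : ℕ, ((‖(-1 : ℂ) ^ (n + 1 + 1) / ((n + 1 : ℕ) : ℂ)‖₊ * M ^ (n + 1) : ℝ≥0) : ℝ≥0∞) ≤
        M * (2⁻¹ : ℝ≥0∞) ^ n := by
      intro n
      have h1 : ‖(-1 : ℂ) ^ (n + 1 + 1) / ((n + 1 : ℕ) : ℂ)‖₊ ≤ 1 := by
        rw [← NNReal.coe_le_coe, coe_nnnorm, norm_div, norm_pow, norm_neg, norm_one, one_pow,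
          Complex.norm_natCast]
        exact div_le_one_of_le₀ (by push_cast; linarith [(Nat.cast_nonneg n : (0 : ℝ) ≤ n)])
          (by positivity)
      have h2 : M ^ n ≤ (2⁻¹ : ℝ≥0) ^ n := by
        gcongr
        simpa using hM
      have h3 : ‖(-1 : ℂ) ^ (n + 1 + 1) / ((n + 1 : ℕ) : ℂ)‖₊ * M ^ (n + 1) ≤ M * (2⁻¹ : ℝ≥0) ^ n := by
        rw [pow_succ' M]
        calc _ ≤ 1 * (M * (2⁻¹ : ℝ≥0) ^ n) := by gcongr
          _ = _ := one_mul _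
      have h4 : ((M * (2⁻¹ : ℝ≥0) ^ n : ℝ≥0) : ℝ≥0∞) = M * (2⁻¹ : ℝ≥0∞) ^ n := by
        push_cast
        rfl
      rw [← h4]
      exact_mod_cast h3
    rw [tsum_eq_zero_add' ENNReal.summable]
    calc _ ≤ 0 + ∑' n : ℕ, M * (2⁻¹ : ℝ≥0∞) ^ n := by
          gcongr with n
          · simp
          · exact hle n
      _ = _ := by
        rw [ENNReal.tsum_mul_left, ENNReal.tsum_geometric, ENNReal.one_sub_inv_two, inv_inv, zero_add,
          ENNReal.coe_mul, ENNReal.coe_ofNat, mul_comm]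
  · intro z hz
    have hM' : (M : ℝ) ≤ 1 / 2 := by exact_mod_cast hM
    have := Complex.hasSum_taylorSeries_log (z := z) (by linarith)
    refine this.congr_fun ?_ |> id
    intro n
    ring

end SepBound

/-! ### Fixed time and very short time bounds for measures of controlled growth -/

theorem GrowthBound.isLocallyFinite {γ : ℝ} {μ : Measure (Space d)} {A : ℝ≥0}
    (h : GrowthBound γ μ A) : IsLocallyFiniteMeasure μ :=
  ⟨fun x => ⟨Metric.ball x 1, Metric.ball_mem_nhds x one_pos,
    (h x 1 one_pos).trans_lt (ENNReal.mul_lt_top ENNReal.coe_lt_top ENNReal.ofReal_lt_top)⟩⟩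

/-- Averaging over all balls of a given radius. -/
theorem lintegral_lintegral_ball (μ : Measure (Space d)) [SFinite μ] {F : Space d → ℝ≥0∞}
    (hF : Measurable F) (r : ℝ) :
    ∫⁻ k, ∫⁻ x in Metric.ball k r, F x ∂μ = volume (Metric.ball (0 : Space d) r) * ∫⁻ x, F x ∂μ := by
  have hm : MeasurableSet {p : Space d × Space d | dist p.2 p.1 < r} :=
    measurableSet_lt (by fun_prop) measurable_const
  have h1 : ∀ k : Space d, ∫⁻ x in Metric.ball k r, F x ∂μ =
      ∫⁻ x, {p : Space d × Space d | dist p.2 p.1 < r}.indicator (fun p => F p.2) (k, x) ∂μ := by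
    intro k
    rw [← lintegral_indicator measurableSet_ball]
    rfl
  simp only [h1]
  have hmeas : Measurable (Function.uncurry fun k x : Space d =>
      {p : Space d × Space d | dist p.2 p.1 < r}.indicator (fun p => F p.2) (k, x)) :=
    (hF.comp measurable_snd).indicator hm
  rw [lintegral_lintegral_swap hmeas.aemeasurable]
  have h2 : ∀ x : Space d,
      ∫⁻ k, {p : Space d × Space d | dist p.2 p.1 < r}.indicator (fun p => F p.2) (k, x) =
        volume (Metric.ball (0 : Space d) r) * F x := by
    intro x
    have : ∀ k, {p : Space d × Space d | dist p.2 p.1 < r}.indicator (fun p => F p.2) (k, x) =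
        (Metric.ball x r).indicator (fun _ => F x) k := by
      intro k
      by_cases hk : dist x k < r
      · rw [Set.indicator_of_mem (by exact hk), Set.indicator_of_mem (by rwa [Metric.mem_ball'])]
      · rw [Set.indicator_of_notMem (by exact hk),
          Set.indicator_of_notMem (by rwa [Metric.mem_ball'])]
    simp only [this]
    rw [lintegral_indicator_const measurableSet_ball, mul_comm,
      Measure.addHaar_ball_center]
  simp only [h2]
  rw [lintegral_const_mul _ hF]

/-- Termwise estimate of the integral of a dominated series. -/
theorem enorm_integral_le_tsum {Y : Type*} [MeasurableSpace Y] {ν : Measure Y} {ι : Type*}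
    [Countable ι] {f : ι → Y → ℂ} {F : Y → ℂ} {G : Y → ℝ} {m : ι → ℝ} (hG : Integrable G ν)
    (hm : Summable m) (hf : ∀ j, AEStronglyMeasurable (f j) ν) (hle : ∀ j y, ‖f j y‖ ≤ m j * G y)
    (hF : ∀ y, HasSum (fun j => f j y) (F y)) :
    ‖∫ y, F y ∂ν‖ₑ ≤ ∑' j, ‖∫ y, f j y ∂ν‖ₑ := by
  have hint : ∀ j, Integrable (f j) ν := fun j =>
    (hG.const_mul (m j)).mono' (hf j) (Eventually.of_forall fun y => hle j y)
  have hsum : Summable fun j => ∫ y, ‖f j y‖ ∂ν := by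
    refine Summable.of_nonneg_of_le (fun j => integral_nonneg fun _ => norm_nonneg _) (fun j => ?_)
      (hm.mul_right (∫ y, G y ∂ν))
    rw [← integral_const_mul]
    exact integral_mono (hint j).norm (hG.const_mul _) (hle j)
  have h := hasSum_integral_of_summable_integral_norm hint hsum
  have e : ∀ y, ∑' j, f j y = F y := fun y => (hF y).tsum_eq
  simp only [e] at h
  rw [← h.tsum_eq]
  have hs : Summable fun j => ‖∫ y, f j y ∂ν‖ :=
    Summable.of_nonneg_of_le (fun _ => norm_nonneg _) (fun j => norm_integral_le_integral_norm _) hsum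
  rw [← ofReal_norm]
  refine (ENNReal.ofReal_le_ofReal (norm_tsum_le_tsum_norm hs)).trans (le_of_eq ?_)
  rw [ENNReal.ofReal_tsum_of_nonneg (fun _ => norm_nonneg _) hs]
  simp only [ofReal_norm]

theorem BandLimited.mul {g a : Space d → ℂ} (hg : BandLimited g) (ha : Measurable a) {c : ℝ≥0}
    (hle : ∀ ξ, g ξ ≠ 0 → ‖a ξ‖ ≤ c) : BandLimited (fun ξ => a ξ * g ξ) ∧
      ∫⁻ ξ, ‖a ξ * g ξ‖ₑ ^ 2 ≤ (c : ℝ≥0∞) ^ 2 * ∫⁻ ξ, ‖g ξ‖ₑ ^ 2 := by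
  have h : ∫⁻ ξ, ‖a ξ * g ξ‖ₑ ^ 2 ≤ (c : ℝ≥0∞) ^ 2 * ∫⁻ ξ, ‖g ξ‖ₑ ^ 2 := by
    rw [← lintegral_const_mul' _ _ (by finiteness)]
    refine lintegral_mono fun ξ => ?_
    rw [enorm_mul, mul_pow]
    by_cases h0 : g ξ = 0
    · simp [h0]
    · gcongr
      have := hle ξ h0
      rw [enorm_eq_nnnorm]
      exact_mod_cast this
  refine ⟨⟨ha.mul hg.measurable, h.trans_lt (ENNReal.mul_lt_top (by finiteness) hg.energy_lt_top),
    ?_⟩, h⟩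
  obtain ⟨R, hR⟩ := hg.bounded
  exact ⟨R, fun ξ hξ => by simp [hR ξ hξ]⟩

/-- The first variable is a bare parameter, with no measurability attached, so expansions with
different parameters can be brought to a common one and then multiplied. -/
theorem SepBound.comap {τ τ' χ ζ : Type*} [MeasurableSpace χ] [MeasurableSpace ζ] {T : Set τ}
    {X : Set χ} {Z : Set ζ} {Q : τ → χ → ζ → ℂ} {M : ℝ≥0} (h : SepBound T X Z Q M) {T' : Set τ'}
    (f : τ' → τ) (hf : ∀ t ∈ T', f t ∈ T) : SepBound T' X Z (fun t => Q (f t)) M := by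
  obtain ⟨ι, hι, m, c, a, b, ha, hb, hc1, ha1, hb1, hm, hs⟩ := h
  exact ⟨ι, hι, m, fun j t => c j (f t), a, b, ha, hb, fun j t ht => hc1 j _ (hf t ht), ha1, hb1, hm,
    fun t ht => hs _ (hf t ht)⟩

theorem euclidean_abs_coord_le (x : Space d) (i : Fin d) : ‖x i‖ ≤ ‖x‖ :=
  PiLp.norm_apply_le x i

/-- The plane wave is separated for positions and frequencies in dual balls. -/
theorem sepBound_exp_inner {R : ℝ} (hR : 0 < R) :
    SepBound (Metric.ball (0 : Space d) (1 / R)) (Metric.closedBall (0 : Space d) R)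
      (Set.univ : Set Unit) (fun y ξ _ => Complex.exp (Complex.I * ((inner ℝ y ξ : ℝ) : ℂ)))
      (Real.toNNReal (Real.exp d)) := by
  have h1 : ∀ i : Fin d, SepBound (Metric.ball (0 : Space d) (1 / R))
      (Metric.closedBall (0 : Space d) R) (Set.univ : Set Unit)
      (fun y ξ _ => (Complex.I * (y i : ℝ)) * (ξ i : ℝ) * (1 : ℂ)) 1 := by
    intro i
    have := SepBound.single (T := Metric.ball (0 : Space d) (1 / R))
      (X := Metric.closedBall (0 : Space d) R) (Z := (Set.univ : Set Unit))
      (c := fun y : Space d => Complex.I * (y i : ℝ)) (a := fun ξ : Space d => ((ξ i : ℝ) : ℂ))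
      (b := fun _ => 1) (by fun_prop) measurable_const (C := Real.toNNReal (1 / R))
      (A := Real.toNNReal R) (B := 1) (Real.toNNReal_pos.2 hR) one_pos ?_ ?_ (by simp)
    · refine this.mono (le_of_eq ?_)
      rw [mul_one, ← Real.toNNReal_mul (by positivity), one_div_mul_cancel hR.ne', Real.toNNReal_one]
    · intro y hy
      rw [norm_mul, Complex.norm_I, one_mul, Complex.norm_real, Real.coe_toNNReal _ (by positivity)]
      exact (euclidean_abs_coord_le y i).trans (by simpa using (mem_ball_zero_iff.1 hy).le)
    · intro ξ hξ
      rw [Complex.norm_real, Real.coe_toNNReal _ hR.le]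
      exact (euclidean_abs_coord_le ξ i).trans (by simpa using hξ)
  -- Each of the `d` products `y i * ξ i` has bound `(1/R) * R = 1`, whence the constant `exp d`.
  have h2 := (SepBound.sum Finset.univ h1).exp
  refine (h2.congr ?_).mono (le_of_eq ?_)
  · intro y _ ξ _ _ _
    rw [PiLp.inner_apply, Complex.ofReal_sum, Finset.mul_sum]
    congr 1
    refine Finset.sum_congr rfl fun i _ => ?_
    simp only [RCLike.inner_apply, conj_trivial, Complex.ofReal_mul]
    ring
  · simp

/-- Separated multipliers and `L²` bounds with respect to a measure of controlled growth. -/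
theorem lintegral_iSup_multiplier_le : ∃ C : ℝ≥0, ∀ {α γ : ℝ} {μ : Measure (Space d)} {A : ℝ≥0},
    0 < α → GrowthBound γ μ A → ∀ {I : Set ℝ} {R : ℝ} {q : ℝ → Space d → ℂ} {N : ℝ≥0}, 0 < R →
    (∀ t ∈ I, Measurable (q t)) →
    SepBound I (Metric.closedBall (0 : Space d) R) (Set.univ : Set Unit) (fun t ξ _ => q t ξ) N →
    ∀ {g : Space d → ℂ}, BandLimited g → (∀ ξ, R < ‖ξ‖ → g ξ = 0) →
    ∫⁻ x, (⨆ t ∈ I, ‖osc α (fun ξ => q t ξ * g ξ) 0 x‖ₑ) ^ 2 ∂μ ≤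
      C * A * ENNReal.ofReal (R ^ ((d : ℝ) - γ)) * (N : ℝ≥0∞) ^ 2 * ∫⁻ ξ, ‖g ξ‖ₑ ^ 2 := by
  set V := volume (Metric.ball (0 : Space d) 1) with hV
  have hVpos : V ≠ 0 := (Metric.measure_ball_pos _ _ one_pos).ne'
  have hVtop : V ≠ ∞ := measure_ball_lt_top.ne
  set c₀ := Real.toNNReal (Real.exp d) with hc₀
  refine ⟨(V⁻¹ * ENNReal.ofReal ((2 * Real.pi) ^ d) * (c₀ : ℝ≥0∞) ^ 2).toNNReal, ?_⟩
  intro α γ μ A hα hμ I R q N hR hqm hq g hg hsupp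
  rw [ENNReal.coe_toNNReal (by
    refine ENNReal.mul_ne_top (ENNReal.mul_ne_top (ENNReal.inv_ne_top.2 hVpos) (by finiteness))
      (by finiteness))]
  have := hμ.isLocallyFinite
  have hnz : ∀ ξ, g ξ ≠ 0 → ξ ∈ Metric.closedBall (0 : Space d) R := fun ξ h => by
    rw [mem_closedBall_zero_iff]
    by_contra h'
    exact h (hsupp ξ (not_le.1 h'))
  set S : Space d → ℝ≥0∞ := fun x => ⨆ t ∈ I, ‖osc α (fun ξ => q t ξ * g ξ) 0 x‖ₑ with hS
  have hSm : Measurable S := by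
    refine (lowerSemicontinuous_biSup fun t ht => ?_).measurable
    have hb := (hg.mul (hqm t ht) (c := N) fun ξ h => hq.norm_le ht (hnz ξ h)
      (Set.mem_univ ())).1
    exact (continuous_osc_right hα hb.integrable 0).enorm.lowerSemicontinuous
  -- Time and the displacement `x - k` from the centre form one parameter; the supremum over both
  -- then falls on the coefficients alone.
  have hprod := ((sepBound_exp_inner hR (d := d)).comap (T' := I ×ˢ Metric.ball (0 : Space d) (1 / R))
    Prod.snd (fun p hp => hp.2)).mul (hq.comap (T' := I ×ˢ Metric.ball (0 : Space d) (1 / R))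
    Prod.fst (fun p hp => hp.1))
  obtain ⟨ι, hι, m, c, a, b, ha, hb, hc1, ha1, hb1, hm, hs⟩ := hprod
  set a' : ι → Space d → ℂ := fun j ξ => a j ξ * b j () with ha'
  have ha'm : ∀ j, Measurable (a' j) := fun j => (ha j).mul_const _
  have ha'1 : ∀ j ξ, g ξ ≠ 0 → ‖a' j ξ‖ ≤ (1 : ℝ≥0) := by
    intro j ξ h
    rw [norm_mul]
    exact mul_le_one₀ (ha1 j ξ (hnz ξ h)) (norm_nonneg _) (hb1 j () (Set.mem_univ _))
  have hbl := fun j => hg.mul (ha'm j) (ha'1 j)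
  set P : ι → Space d → ℝ≥0∞ := fun j k => ‖osc α (fun ξ => a' j ξ * g ξ) 0 k‖ₑ with hP
  -- A form of the uncertainty principle: at frequencies up to `R`, values on a ball of radius `1/R`
  -- are controlled by countably many transforms at its centre.
  have hptw : ∀ k, ∀ x ∈ Metric.ball k (1 / R), S x ≤ ∑' j, m j * P j k := by
    intro k x hx
    refine iSup₂_le fun t ht => ?_
    have hmem : (t, x - k) ∈ I ×ˢ Metric.ball (0 : Space d) (1 / R) :=
      ⟨ht, by rwa [mem_ball_zero_iff, ← dist_eq_norm]⟩
    have e1 : ∀ ξ, HasSum (fun j => c j (t, x - k) * (phase α 0 k ξ * (a' j ξ * g ξ)))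
        (phase α 0 x ξ * (q t ξ * g ξ)) := by
      intro ξ
      by_cases h0 : g ξ = 0
      · simp [h0]
      · have h1 := (hs _ hmem ξ (hnz ξ h0) () (Set.mem_univ _)).mul_left (phase α 0 k ξ * g ξ)
        have h2 : phase α 0 k ξ * g ξ * (Complex.exp (Complex.I * ((inner ℝ (x - k) ξ : ℝ) : ℂ)) *
            q t ξ) = phase α 0 x ξ * (q t ξ * g ξ) := by
          have : phase α 0 x ξ = phase α 0 k ξ *
              Complex.exp (Complex.I * ((inner ℝ (x - k) ξ : ℝ) : ℂ)) := by
            rw [phase, phase, ← Complex.exp_add, inner_sub_left]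
            congr 1
            push_cast
            ring
          rw [this]
          ring
        rw [← h2]
        refine h1.congr_fun ?_ |> id
        intro j
        simp only [ha']
        ring
    have e2 := enorm_integral_le_tsum (ν := (volume : Measure (Space d)))
      (f := fun j ξ => c j (t, x - k) * (phase α 0 k ξ * (a' j ξ * g ξ)))
      (m := fun j => (m j : ℝ)) (G := fun ξ => ‖g ξ‖) hg.integrable.norm
      (SepBound.summable_of_tsum_le hm)
      (fun j => ((integrable_phase_mul hα (hbl j).1.integrable 0 k).const_mul _).aestronglyMeasurable)
      (fun j ξ => by
        rw [norm_mul, norm_mul, norm_mul, norm_phase, one_mul]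
        by_cases h0 : g ξ = 0
        · simp [h0]
        · calc _ ≤ (m j : ℝ) * (1 * ‖g ξ‖) := by
                gcongr
                exacts [hc1 j _ hmem, ha'1 j ξ h0]
            _ = _ := by ring) e1
    refine e2.trans (ENNReal.tsum_le_tsum fun j => ?_)
    rw [integral_const_mul, enorm_mul]
    gcongr
    · rw [enorm_eq_nnnorm]
      exact_mod_cast hc1 j _ hmem
    · exact le_rfl
  have hsq : ∀ k, ∀ x ∈ Metric.ball k (1 / R), S x ^ 2 ≤
      (c₀ * N : ℝ≥0) * ∑' j, m j * P j k ^ 2 := by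
    intro k x hx
    refine (pow_le_pow_left' (hptw k x hx) 2).trans ((tsum_mul_sq_le _ _).trans ?_)
    gcongr
  have hPm : ∀ j, Measurable (P j) := fun j =>
    (continuous_osc_right hα (hbl j).1.integrable 0).enorm.measurable
  have hPint : ∀ j, ∫⁻ k, P j k ^ 2 ≤ ENNReal.ofReal ((2 * Real.pi) ^ d) * ∫⁻ ξ, ‖g ξ‖ₑ ^ 2 := by
    intro j
    refine (lintegral_osc_zero_le hα (hbl j).1).trans (mul_le_mul_right ((hbl j).2.trans ?_) _)
    rw [ENNReal.coe_one, one_pow, one_mul]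
  set E := ∫⁻ ξ, ‖g ξ‖ₑ ^ 2
  -- Average over all centres `k`. Each ball has `μ`-mass at most `A R^(-γ)`, Plancherel evaluates
  -- the integral in `k`, and division by the volume, of order `R^(-d)`, leaves `R^(d-γ)`.
  have hmain : volume (Metric.ball (0 : Space d) (1 / R)) * ∫⁻ x, S x ^ 2 ∂μ ≤
      A * ENNReal.ofReal ((1 / R) ^ γ) * ((c₀ * N : ℝ≥0) ^ 2 *
        (ENNReal.ofReal ((2 * Real.pi) ^ d) * E)) := by
    rw [← lintegral_lintegral_ball μ (hSm.pow_const 2)]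
    calc ∫⁻ k, ∫⁻ x in Metric.ball k (1 / R), S x ^ 2 ∂μ
        ≤ ∫⁻ k, A * ENNReal.ofReal ((1 / R) ^ γ) *
            ((c₀ * N : ℝ≥0) * ∑' j, m j * P j k ^ 2) := by
          refine lintegral_mono fun k => ?_
          refine (setLIntegral_mono' measurableSet_ball (hsq k)).trans ?_
          rw [setLIntegral_const, mul_comm]
          gcongr
          exact hμ k (1 / R) (by positivity)
      _ = A * ENNReal.ofReal ((1 / R) ^ γ) * ((c₀ * N : ℝ≥0) * ∑' j, m j * ∫⁻ k, P j k ^ 2) := by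
          rw [lintegral_const_mul' _ _ (by finiteness), lintegral_const_mul' _ _ (by finiteness),
            lintegral_tsum fun j => (((hPm j).pow_const 2).const_mul _).aemeasurable]
          simp only [lintegral_const_mul' _ _ ENNReal.coe_ne_top]
      _ ≤ A * ENNReal.ofReal ((1 / R) ^ γ) * ((c₀ * N : ℝ≥0) *
            ∑' j, m j * (ENNReal.ofReal ((2 * Real.pi) ^ d) * E)) := by
          gcongr with j
          exact hPint j
      _ ≤ A * ENNReal.ofReal ((1 / R) ^ γ) * ((c₀ * N : ℝ≥0) * ((c₀ * N : ℝ≥0) *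
            (ENNReal.ofReal ((2 * Real.pi) ^ d) * E))) := by
          rw [ENNReal.tsum_mul_right]
          gcongr
      _ = _ := by ring
  have hvol : volume (Metric.ball (0 : Space d) (1 / R)) = ENNReal.ofReal ((1 / R) ^ d) * V := by
    rw [hV, Measure.addHaar_ball_of_pos _ _ (by positivity), finrank_euclideanSpace_fin]
  rw [hvol] at hmain
  have hRd : ENNReal.ofReal ((1 / R) ^ d) ≠ 0 := by
    rw [Ne, ENNReal.ofReal_eq_zero, not_le]; positivity
  have hpow : ENNReal.ofReal (R ^ ((d : ℝ) - γ)) =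
      (ENNReal.ofReal ((1 / R) ^ d))⁻¹ * ENNReal.ofReal ((1 / R) ^ γ) := by
    rw [← ENNReal.ofReal_inv_of_pos (by positivity), ← ENNReal.ofReal_mul (by positivity)]
    congr 1
    rw [Real.rpow_sub hR, Real.rpow_natCast, one_div, inv_pow, inv_inv, Real.inv_rpow hR.le]
    rfl
  have hcancel : ∫⁻ x, S x ^ 2 ∂μ = (ENNReal.ofReal ((1 / R) ^ d) * V)⁻¹ *
      (ENNReal.ofReal ((1 / R) ^ d) * V * ∫⁻ x, S x ^ 2 ∂μ) := by
    rw [← mul_assoc, ENNReal.inv_mul_cancel (mul_ne_zero hRd hVpos) (by finiteness), one_mul]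
  rw [hcancel]
  refine (mul_le_mul_right hmain _).trans (le_of_eq ?_)
  rw [hpow, ENNReal.mul_inv (Or.inl hRd) (Or.inr hVpos)]
  push_cast
  ring

theorem phase_zero_mul_phase (α t : ℝ) (x y ξ : Space d) :
    phase α 0 x ξ * phase α t y ξ = phase α t (x + y) ξ := by
  rw [phase, phase, phase, ← Complex.exp_add, inner_add_left]
  congr 1
  push_cast
  ring

theorem osc_phase_mul (α : ℝ) (g : Space d → ℂ) (t : ℝ) (x y : Space d) :
    osc α (fun ξ => phase α t y ξ * g ξ) 0 x = osc α g t (x + y) := by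
  simp only [osc, ← mul_assoc, phase_zero_mul_phase]

/-- Fixed time estimate with respect to a measure of controlled growth. -/
theorem lintegral_osc_le : ∃ C : ℝ≥0, ∀ {α γ : ℝ} {μ : Measure (Space d)} {A : ℝ≥0},
    0 < α → GrowthBound γ μ A → ∀ {R : ℝ}, 0 < R → ∀ {g : Space d → ℂ}, BandLimited g →
    (∀ ξ, R < ‖ξ‖ → g ξ = 0) → ∀ t : ℝ,
    ∫⁻ x, ‖osc α g t x‖ₑ ^ 2 ∂μ ≤
      C * A * ENNReal.ofReal (R ^ ((d : ℝ) - γ)) * ∫⁻ ξ, ‖g ξ‖ₑ ^ 2 := by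
  obtain ⟨C, hC⟩ := lintegral_iSup_multiplier_le (d := d)
  refine ⟨C, ?_⟩
  intro α γ μ A hα hμ R hR g hg hsupp t
  -- For one fixed time the evolution is itself a unimodular multiplier, a single term over a one
  -- point parameter set.
  have hq : SepBound ({0} : Set ℝ) (Metric.closedBall (0 : Space d) R) (Set.univ : Set Unit)
      (fun _ ξ _ => phase α t 0 ξ) 1 := by
    have := SepBound.single (T := ({0} : Set ℝ)) (X := Metric.closedBall (0 : Space d) R)
      (Z := (Set.univ : Set Unit)) (c := fun _ => 1) (b := fun _ => 1)
      (measurable_phase hα t 0) measurable_const (C := 1) (A := 1) (B := 1) one_pos one_pos (by simp)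
      (fun ξ _ => (norm_phase α t 0 ξ).le) (by simp)
    simpa using this
  have h := hC hα hμ hR (fun _ _ => measurable_phase hα t 0) hq hg hsupp
  simpa [osc_phase_mul] using h

/-- Maximal estimate over times that are too short for the evolution to be seen. -/
theorem lintegral_iSup_osc_sub_le : ∃ C : ℝ≥0, ∀ {α γ : ℝ} {μ : Measure (Space d)} {A : ℝ≥0},
    0 < α → GrowthBound γ μ A → ∀ {R : ℝ}, 0 < R → ∀ {δ : ℝ}, 0 < δ → δ * R ^ α ≤ 1 →
    ∀ {g : Space d → ℂ}, BandLimited g → (∀ ξ, R < ‖ξ‖ → g ξ = 0) →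
    ∫⁻ x, (⨆ t ∈ Set.Icc (-δ) δ, ‖osc α g t x - osc α g 0 x‖ₑ) ^ 2 ∂μ ≤
      C * A * ENNReal.ofReal (R ^ ((d : ℝ) - γ) * (δ * R ^ α) ^ 2) * ∫⁻ ξ, ‖g ξ‖ₑ ^ 2 := by
  obtain ⟨C, hC⟩ := lintegral_iSup_multiplier_le (d := d)
  -- The 4 is the square of the 2 in `exp u - 1 ≤ 2u`, applied with `u = δ R^α ≤ 1`.
  refine ⟨C * 4, ?_⟩
  intro α γ μ A hα hμ R hR δ hδ hδR g hg hsupp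
  have hRα : 0 < R ^ α := Real.rpow_pos_of_pos hR α
  have hq0 := SepBound.single (T := Set.Icc (-δ) δ) (X := Metric.closedBall (0 : Space d) R)
      (Z := (Set.univ : Set Unit)) (c := fun t : ℝ => Complex.I * t)
      (a := fun ξ : Space d => ((‖ξ‖ ^ α : ℝ) : ℂ)) (b := fun _ => 1)
      (Complex.measurable_ofReal.comp (measurable_norm.pow_const α)) measurable_const
      (C := Real.toNNReal δ) (A := Real.toNNReal (R ^ α))
      (B := 1) (Real.toNNReal_pos.2 hRα) one_pos (fun t ht => by
        rw [norm_mul, Complex.norm_I, one_mul, Complex.norm_real, Real.coe_toNNReal _ hδ.le]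
        exact abs_le.2 ht)
      (fun ξ hξ => by
        rw [Complex.norm_real, Real.coe_toNNReal _ hRα.le, Real.norm_of_nonneg (by positivity)]
        exact Real.rpow_le_rpow (norm_nonneg _) (by simpa using hξ) hα.le) (by simp)
  rw [mul_one, ← Real.toNNReal_mul hδ.le] at hq0
  have hpos : 0 ≤ δ * R ^ α := by positivity
  have hexp : Real.exp (δ * R ^ α) - 1 ≤ 2 * (δ * R ^ α) := by
    have := Real.abs_exp_sub_one_le (x := δ * R ^ α) (by rwa [abs_of_nonneg hpos])
    rw [abs_of_nonneg hpos] at this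
    exact (le_abs_self _).trans this
  have hq : SepBound (Set.Icc (-δ) δ) (Metric.closedBall (0 : Space d) R) (Set.univ : Set Unit)
      (fun t ξ _ => phase α t 0 ξ - 1) (Real.toNNReal (2 * (δ * R ^ α))) := by
    refine (hq0.exp_sub_one.congr ?_).mono ?_
    · intro t _ ξ _ _ _
      rw [phase, inner_zero_left]
      congr 2
      push_cast
      ring
    · rw [Real.coe_toNNReal _ hpos]
      exact Real.toNNReal_le_toNNReal hexp
  have h := hC hα hμ hR (fun t _ => (measurable_phase hα t 0).sub_const 1) hq hg hsupp
  have e : ∀ t x, osc α (fun ξ => (phase α t 0 ξ - 1) * g ξ) 0 x = osc α g t x - osc α g 0 x := by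
    intro t x
    have h1 := osc_phase_mul α g t x 0
    rw [add_zero] at h1
    rw [← h1, ← osc_sub hα (integrable_phase_mul hα hg.integrable t 0) hg.integrable]
    congr 1
    ext ξ
    ring
  simp only [e] at h
  refine h.trans (le_of_eq ?_)
  have e2 : ((Real.toNNReal (2 * (δ * R ^ α)) : ℝ≥0) : ℝ≥0∞) ^ 2 =
      4 * ENNReal.ofReal ((δ * R ^ α) ^ 2) := by
    change ENNReal.ofReal (2 * (δ * R ^ α)) ^ 2 = _
    rw [← ENNReal.ofReal_pow (by positivity), mul_pow, ENNReal.ofReal_mul (by positivity)]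
    norm_num
  rw [e2, ENNReal.ofReal_mul (by positivity)]
  push_cast
  ring

/-! ### Dilation and the maximal estimate on small balls -/

/-- A class of measures, stable under normalized dilations, with a uniform maximal estimate. -/
structure MaximalFamily (α γ σ : ℝ) (A K : ℝ≥0) (𝓜 : Set (Measure (Space d))) : Prop where
  growth : ∀ μ ∈ 𝓜, GrowthBound γ μ A
  dilate : ∀ μ ∈ 𝓜, ∀ (x₀ : Space d) (ρ : ℝ), 0 < ρ →
    ENNReal.ofReal (ρ ^ (-γ)) • μ.map (fun x => ρ⁻¹ • (x - x₀)) ∈ 𝓜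
  maximal : ∀ μ ∈ 𝓜, MaximalEstimate α (Set.Ioo 0 1) σ μ K

/-- The substitution `ξ ↦ ρ⁻¹ ξ` turns `(τ, y)` into `(ρ^α τ, ρ y)` by homogeneity of `|ξ|^α`; the
modulation by `phase α 0 x₀` supplies the translation by `x₀`. -/
theorem osc_dilate {α : ℝ} (g : Space d → ℂ) {ρ : ℝ} (hρ : 0 < ρ)
    (x₀ y : Space d) (τ : ℝ) :
    osc α (fun ξ => ((ρ ^ d)⁻¹ : ℝ) * (phase α 0 x₀ (ρ⁻¹ • ξ) * g (ρ⁻¹ • ξ))) τ y =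
      osc α g (ρ ^ α * τ) (x₀ + ρ • y) := by
  have h := Measure.integral_comp_smul (volume : Measure (Space d))
    (fun ξ => phase α (ρ ^ α * τ) (ρ • y) ξ * (phase α 0 x₀ ξ * g ξ)) ρ⁻¹
  have e : ∀ ξ : Space d, phase α (ρ ^ α * τ) (ρ • y) (ρ⁻¹ • ξ) = phase α τ y ξ := by
    intro ξ
    rw [phase, phase, norm_smul, inner_smul_left, inner_smul_right, Real.norm_of_nonneg (by positivity),
      Real.mul_rpow (by positivity) (by positivity), Real.inv_rpow hρ.le]
    have : ρ ^ α ≠ 0 := (Real.rpow_pos_of_pos hρ α).ne'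
    congr 3
    simp only [conj_trivial]
    field_simp
  simp only [e] at h
  have e3 : ∀ ξ, phase α (ρ ^ α * τ) (ρ • y) ξ * (phase α 0 x₀ ξ * g ξ) =
      phase α (ρ ^ α * τ) (x₀ + ρ • y) ξ * g ξ := by
    intro ξ
    rw [← phase_zero_mul_phase]
    ring
  simp only [e3] at h
  rw [osc, osc]
  have e4 : ∀ ξ, phase α τ y ξ * (((ρ ^ d)⁻¹ : ℝ) * (phase α 0 x₀ (ρ⁻¹ • ξ) * g (ρ⁻¹ • ξ))) =
      ((ρ ^ d)⁻¹ : ℝ) * (phase α τ y ξ * (phase α 0 x₀ (ρ⁻¹ • ξ) * g (ρ⁻¹ • ξ))) := by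
    intro ξ
    ring
  simp only [e4]
  rw [integral_const_mul, h, finrank_euclideanSpace_fin, abs_of_pos (by positivity), inv_pow, inv_inv,
    Complex.real_smul, ← mul_assoc, ← Complex.ofReal_mul, inv_mul_cancel₀ (by positivity),
    Complex.ofReal_one, one_mul]

theorem BandLimited.dilate {α : ℝ} (hα : 0 < α) {g : Space d → ℂ} (hg : BandLimited g) {ρ : ℝ}
    (hρ : 0 < ρ) (x₀ : Space d) :
    BandLimited fun ξ => ((ρ ^ d)⁻¹ : ℝ) * (phase α 0 x₀ (ρ⁻¹ • ξ) * g (ρ⁻¹ • ξ)) := by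
  have hsm : Measurable fun ξ : Space d => ρ⁻¹ • ξ := measurable_const_smul _
  refine ⟨measurable_const.mul
    (((measurable_phase hα 0 x₀).comp hsm).mul (hg.measurable.comp hsm)), ?_, ?_⟩
  · simp only [enorm_mul, enorm_phase, one_mul, mul_pow]
    rw [lintegral_const_mul' _ _ (by finiteness),
      lintegral_comp_smul_pos (fun ξ => ‖g ξ‖ₑ ^ 2) (inv_pos.2 hρ)]
    exact ENNReal.mul_lt_top (by finiteness) (ENNReal.mul_lt_top (by finiteness) hg.energy_lt_top)
  · obtain ⟨R, hR⟩ := hg.bounded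
    refine ⟨ρ * R, fun ξ hξ => ?_⟩
    rw [hR (ρ⁻¹ • ξ), mul_zero, mul_zero]
    rw [norm_smul, Real.norm_of_nonneg (by positivity), inv_mul_eq_div, lt_div_iff₀ hρ, mul_comm]
    exact hξ

/-- The maximal estimate on small balls, by dilation. -/
theorem MaximalFamily.local_estimate {α γ σ : ℝ} {A K : ℝ≥0} {𝓜 : Set (Measure (Space d))}
    (h𝓜 : MaximalFamily α γ σ A K 𝓜) (hα : 0 < α) {μ : Measure (Space d)} (hμ : μ ∈ 𝓜)
    (x₀ : Space d) {ρ : ℝ} (hρ : 0 < ρ) {g : Space d → ℂ} (hg : BandLimited g) :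
    ∫⁻ x in Metric.ball x₀ ρ, (⨆ t ∈ Set.Ioo 0 (ρ ^ α), ‖osc α g t x‖ₑ) ^ 2 ∂μ ≤
      (ENNReal.ofReal ((2 * Real.pi) ^ d) * K) ^ 2 * (ENNReal.ofReal (ρ ^ (γ - d)) *
        ∫⁻ ξ, ENNReal.ofReal ((1 + ‖ρ • ξ‖ ^ 2) ^ σ) * ‖g ξ‖ₑ ^ 2) := by
  set ν := ENNReal.ofReal (ρ ^ (-γ)) • μ.map (fun x => ρ⁻¹ • (x - x₀)) with hν
  have hνm : ν ∈ 𝓜 := h𝓜.dilate μ hμ x₀ ρ hρ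
  set g' : Space d → ℂ := fun ξ => ((ρ ^ d)⁻¹ : ℝ) * (phase α 0 x₀ (ρ⁻¹ • ξ) * g (ρ⁻¹ • ξ)) with hg'
  have hfin : ν (Metric.ball 0 1) < ∞ := (h𝓜.growth ν hνm 0 1 one_pos).trans_lt (by finiteness)
  have hbl : BandLimited g' := hg.dilate hα hρ x₀
  have h1 := (h𝓜.maximal ν hνm).bandLimited hα hfin hbl
  have hmap : Measurable fun x : Space d => ρ⁻¹ • (x - x₀) := by fun_prop
  have hFm := (measurable_iSup_osc hα hbl.integrable (Set.Ioo 0 1)).pow_const 2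
  rw [hν, Measure.restrict_smul, lintegral_smul_measure,
    setLIntegral_map measurableSet_ball hFm hmap] at h1
  have hpre : (fun x : Space d => ρ⁻¹ • (x - x₀)) ⁻¹' Metric.ball 0 1 = Metric.ball x₀ ρ := by
    ext x
    rw [Set.mem_preimage, mem_ball_zero_iff, norm_smul, Real.norm_of_nonneg (by positivity),
      inv_mul_lt_one₀ hρ, mem_ball_iff_norm]
  rw [hpre] at h1
  have hρα : 0 < ρ ^ α := Real.rpow_pos_of_pos hρ α
  have hsup : ∀ x, ⨆ t ∈ Set.Ioo 0 (ρ ^ α), ‖osc α g t x‖ₑ ≤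
      ⨆ τ ∈ Set.Ioo (0 : ℝ) 1, ‖osc α g' τ (ρ⁻¹ • (x - x₀))‖ₑ := by
    intro x
    refine iSup₂_le fun t ht => ?_
    have hmem : t / ρ ^ α ∈ Set.Ioo (0 : ℝ) 1 :=
      ⟨div_pos ht.1 hρα, (div_lt_one hρα).2 ht.2⟩
    refine le_trans (le_of_eq ?_) (le_iSup₂ (f := fun τ _ => ‖osc α g' τ (ρ⁻¹ • (x - x₀))‖ₑ) _ hmem)
    simp only [hg']
    rw [osc_dilate g hρ, smul_inv_smul₀ hρ.ne', mul_div_cancel₀ _ hρα.ne', add_sub_cancel]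
  have hE : wEnergy σ g' = ENNReal.ofReal ((ρ ^ d)⁻¹) *
      ∫⁻ ξ, ENNReal.ofReal ((1 + ‖ρ • ξ‖ ^ 2) ^ σ) * ‖g ξ‖ₑ ^ 2 := by
    have h2 := lintegral_comp_smul_pos
      (fun ξ : Space d => ENNReal.ofReal ((1 + ‖ρ • ξ‖ ^ 2) ^ σ) * ‖g ξ‖ₑ ^ 2) (inv_pos.2 hρ)
    simp only [smul_inv_smul₀ hρ.ne'] at h2
    have e5 : ∀ ξ : Space d, ENNReal.ofReal ((1 + ‖ξ‖ ^ 2) ^ σ) * ‖g' ξ‖ₑ ^ 2 =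
        ENNReal.ofReal ((ρ ^ d)⁻¹) ^ 2 *
          (ENNReal.ofReal ((1 + ‖ξ‖ ^ 2) ^ σ) * ‖g (ρ⁻¹ • ξ)‖ₑ ^ 2) := by
      intro ξ
      simp only [hg', enorm_mul, enorm_phase, one_mul, mul_pow]
      rw [← ofReal_norm (((ρ ^ d)⁻¹ : ℝ) : ℂ), Complex.norm_real,
        Real.norm_of_nonneg (by positivity)]
      ring
    rw [wEnergy]
    simp only [e5]
    rw [lintegral_const_mul' _ _ (by finiteness), h2, inv_pow, inv_inv, ← mul_assoc]
    congr 1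
    rw [← ENNReal.ofReal_pow (by positivity), ← ENNReal.ofReal_mul (by positivity)]
    congr 1
    field_simp
  rw [hE] at h1
  have hργ : ENNReal.ofReal (ρ ^ γ) * ENNReal.ofReal (ρ ^ (-γ)) = 1 := by
    rw [← ENNReal.ofReal_mul (by positivity), ← Real.rpow_add hρ]
    simp
  calc ∫⁻ x in Metric.ball x₀ ρ, (⨆ t ∈ Set.Ioo 0 (ρ ^ α), ‖osc α g t x‖ₑ) ^ 2 ∂μ
      ≤ ∫⁻ x in Metric.ball x₀ ρ,
          (⨆ τ ∈ Set.Ioo (0 : ℝ) 1, ‖osc α g' τ (ρ⁻¹ • (x - x₀))‖ₑ) ^ 2 ∂μ :=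
        lintegral_mono fun x => pow_le_pow_left' (hsup x) 2
    _ = ENNReal.ofReal (ρ ^ γ) * (ENNReal.ofReal (ρ ^ (-γ)) * ∫⁻ x in Metric.ball x₀ ρ,
          (⨆ τ ∈ Set.Ioo (0 : ℝ) 1, ‖osc α g' τ (ρ⁻¹ • (x - x₀))‖ₑ) ^ 2 ∂μ) := by
        rw [← mul_assoc, hργ, one_mul]
    _ ≤ _ := mul_le_mul_right h1 _
    _ = _ := by
        rw [Real.rpow_sub hρ, Real.rpow_natCast, div_eq_mul_inv, ENNReal.ofReal_mul (by positivity)]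
        ring

/-- The maximal estimate on small balls for functions of frequency at most `2R`. -/
theorem MaximalFamily.local_estimate_band {α γ s : ℝ} {A K : ℝ≥0} {𝓜 : Set (Measure (Space d))}
    (h𝓜 : MaximalFamily α γ (((d : ℝ) - γ) / 2 + s) A K 𝓜) (hα : 0 < α) (hγ : γ ≤ d) (hs : 0 < s)
    {μ : Measure (Space d)} (hμ : μ ∈ 𝓜) (x₀ : Space d) {ρ R : ℝ} (hρ : 0 < ρ) (hR : 0 < R)
    (hρR : 1 ≤ ρ * R) {g : Space d → ℂ} (hg : BandLimited g) (hsupp : ∀ ξ, 2 * R < ‖ξ‖ → g ξ = 0) :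
    ∫⁻ x in Metric.ball x₀ ρ, (⨆ t ∈ Set.Ioo 0 (ρ ^ α), ‖osc α g t x‖ₑ) ^ 2 ∂μ ≤
      (ENNReal.ofReal ((2 * Real.pi) ^ d) * K) ^ 2 *
        ENNReal.ofReal (5 ^ (((d : ℝ) - γ) / 2 + s)) *
        (ENNReal.ofReal (R ^ ((d : ℝ) - γ) * (ρ * R) ^ (2 * s)) * ∫⁻ ξ, ‖g ξ‖ₑ ^ 2) := by
  set σ := ((d : ℝ) - γ) / 2 + s with hσ
  have hσ0 : 0 ≤ σ := by linarith
  refine (h𝓜.local_estimate hα hμ x₀ hρ hg).trans ?_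
  rw [mul_assoc]
  refine mul_le_mul_right ?_ _
  have h1 : ∫⁻ ξ, ENNReal.ofReal ((1 + ‖ρ • ξ‖ ^ 2) ^ σ) * ‖g ξ‖ₑ ^ 2 ≤
      ENNReal.ofReal (5 ^ σ * (ρ * R) ^ (2 * σ)) * ∫⁻ ξ, ‖g ξ‖ₑ ^ 2 := by
    rw [← lintegral_const_mul' _ _ (by finiteness)]
    refine lintegral_mono fun ξ => ?_
    rcases lt_or_ge (2 * R) ‖ξ‖ with h | h
    · simp [hsupp ξ h]
    · refine mul_le_mul_left (ENNReal.ofReal_le_ofReal ?_) _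
      -- The hypothesis `1 ≤ ρ * R` absorbs the 1, and `‖ξ‖ ≤ 2 * R` contributes the remaining 4.
      have h2 : 1 + ‖ρ • ξ‖ ^ 2 ≤ 5 * (ρ * R) ^ 2 := by
        rw [norm_smul, Real.norm_of_nonneg hρ.le]
        have h3 : ρ * ‖ξ‖ ≤ 2 * (ρ * R) := by nlinarith
        have h4 : 0 ≤ ρ * ‖ξ‖ := by positivity
        nlinarith
      calc (1 + ‖ρ • ξ‖ ^ 2) ^ σ ≤ (5 * (ρ * R) ^ 2) ^ σ :=
            Real.rpow_le_rpow (by positivity) h2 hσ0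
        _ = _ := by
          rw [Real.mul_rpow (by norm_num) (by positivity), ← Real.rpow_natCast,
            ← Real.rpow_mul (by positivity)]
          norm_num
  refine (mul_le_mul_right h1 _).trans (le_of_eq ?_)
  rw [← mul_assoc, ← mul_assoc, ← ENNReal.ofReal_mul (by positivity),
    ← ENNReal.ofReal_mul (by positivity)]
  congr 2
  -- The power `ρ^(d-γ)` cancels the factor `ρ^(γ-d)` produced by rescaling, so beyond the fixed
  -- time factor `R^(d-γ)` only `(ρR)^(2s)` is lost.
  have e : (ρ * R) ^ (2 * σ) = ρ ^ ((d : ℝ) - γ) * R ^ ((d : ℝ) - γ) * (ρ * R) ^ (2 * s) := by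
    rw [← Real.mul_rpow hρ.le hR.le, ← Real.rpow_add (by positivity)]
    congr 1
    rw [hσ]
    ring
  have e2 : ρ ^ (γ - d) * ρ ^ ((d : ℝ) - γ) = 1 := by
    rw [← Real.rpow_add hρ]
    simp
  rw [e]
  calc _ = (ρ ^ (γ - d) * ρ ^ ((d : ℝ) - γ)) * (5 ^ σ * (R ^ ((d : ℝ) - γ) * (ρ * R) ^ (2 * s))) := by
        ring
    _ = _ := by rw [e2, one_mul]

/-! ### Separation of the phase increment -/

/-- The radius, relative to the inverse spatial scale, of the frequency cutoff used for spatial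
localization. -/
def cutoff (d : ℕ) : ℝ := 1 / (32 * ((d : ℝ) + 1))

theorem cutoff_pos (d : ℕ) : 0 < cutoff d := by
  unfold cutoff
  positivity

theorem cutoff_le (d : ℕ) : cutoff d ≤ 1 / 32 := by
  unfold cutoff
  gcongr
  linarith [(Nat.cast_nonneg d : (0 : ℝ) ≤ d)]

theorem cutoff_mul (d : ℕ) : cutoff d * (32 * ((d : ℝ) + 1)) = 1 := by
  unfold cutoff
  exact one_div_mul_cancel (by positivity)

/-- Squaring makes the increment a finite sum of products: `-2 ξ·ζ/|ξ|² + |ζ|²/|ξ|²`. Its terms have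
total size at most `8 d c/(ρR) + 16 c²/(ρR)²` with `c = cutoff d`, and `c` is small enough for each
part to be at most `1/(4ρR)`. -/
theorem sepBound_relative_increment {R ρ : ℝ} (hR : 0 < R) (hρ : 0 < ρ) (hρR : 1 ≤ ρ * R)
    (T : Set ℝ) :
    SepBound T {ξ : Space d | R / 4 ≤ ‖ξ‖ ∧ ‖ξ‖ ≤ 2 * R}
      (Metric.closedBall (0 : Space d) (cutoff d / ρ))
      (fun _ ξ ζ => (((‖ξ - ζ‖ / ‖ξ‖) ^ 2 - 1 : ℝ) : ℂ)) (Real.toNNReal (1 / (2 * (ρ * R)))) := by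
  set X := {ξ : Space d | R / 4 ≤ ‖ξ‖ ∧ ‖ξ‖ ≤ 2 * R}
  set Z := Metric.closedBall (0 : Space d) (cutoff d / ρ)
  have hc := cutoff_pos d
  have hr : 0 < cutoff d / ρ := by positivity
  have hpos : ∀ ξ ∈ X, 0 < ‖ξ‖ := fun ξ hξ => lt_of_lt_of_le (by positivity) hξ.1
  have hinv : ∀ ξ ∈ X, ‖ξ‖⁻¹ ≤ 4 / R := fun ξ hξ => by
    rw [inv_le_comm₀ (hpos ξ hξ) (by positivity), inv_div]
    exact hξ.1
  have h1 : ∀ i : Fin d, SepBound T X Z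
      (fun _ ξ ζ => (1 : ℂ) * ((-2 * ξ i / ‖ξ‖ ^ 2 : ℝ) : ℂ) * ((ζ i : ℝ) : ℂ))
      (1 * Real.toNNReal (8 / R) * Real.toNNReal (cutoff d / ρ)) := by
    intro i
    refine SepBound.single (c := fun _ : ℝ => (1 : ℂ))
      (a := fun ξ : Space d => ((-2 * ξ i / ‖ξ‖ ^ 2 : ℝ) : ℂ))
      (b := fun ζ : Space d => ((ζ i : ℝ) : ℂ)) (by fun_prop) (by fun_prop)
      (Real.toNNReal_pos.2 (by positivity)) (Real.toNNReal_pos.2 hr) (by simp) ?_ ?_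
    · intro ξ hξ
      rw [Complex.norm_real, Real.coe_toNNReal _ (by positivity), norm_div, norm_mul]
      have e : ‖(-2 : ℝ)‖ * ‖ξ i‖ / ‖‖ξ‖ ^ 2‖ ≤ 2 * ‖ξ‖ / ‖ξ‖ ^ 2 := by
        rw [norm_pow, norm_norm]
        gcongr
        · simp
        · exact euclidean_abs_coord_le ξ i
      refine e.trans ?_
      have e2 : 2 * ‖ξ‖ / ‖ξ‖ ^ 2 = 2 * ‖ξ‖⁻¹ := by
        have := (hpos ξ hξ).ne'
        field_simp
      rw [e2]
      calc 2 * ‖ξ‖⁻¹ ≤ 2 * (4 / R) := by gcongr; exact hinv ξ hξ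
        _ = 8 / R := by ring
    · intro ζ hζ
      rw [Complex.norm_real, Real.coe_toNNReal _ hr.le]
      exact (euclidean_abs_coord_le ζ i).trans (by simpa [Z] using hζ)
  have h2 : SepBound T X Z
      (fun _ ξ ζ => (1 : ℂ) * (((‖ξ‖ ^ 2)⁻¹ : ℝ) : ℂ) * ((‖ζ‖ ^ 2 : ℝ) : ℂ))
      (1 * Real.toNNReal ((4 / R) ^ 2) * Real.toNNReal ((cutoff d / ρ) ^ 2)) := by
    refine SepBound.single (c := fun _ : ℝ => (1 : ℂ))
      (a := fun ξ : Space d => (((‖ξ‖ ^ 2)⁻¹ : ℝ) : ℂ))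
      (b := fun ζ : Space d => ((‖ζ‖ ^ 2 : ℝ) : ℂ)) (by fun_prop) (by fun_prop)
      (Real.toNNReal_pos.2 (by positivity)) (Real.toNNReal_pos.2 (by positivity)) (by simp) ?_ ?_
    · intro ξ hξ
      rw [Complex.norm_real, Real.coe_toNNReal _ (by positivity), norm_inv, norm_pow, norm_norm,
        ← inv_pow]
      exact pow_le_pow_left₀ (by positivity) (hinv ξ hξ) 2
    · intro ζ hζ
      rw [Complex.norm_real, Real.coe_toNNReal _ (by positivity), norm_pow, norm_norm]
      exact pow_le_pow_left₀ (norm_nonneg _) (by simpa [Z] using hζ) 2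
  refine ((SepBound.sum Finset.univ h1).add h2 |>.congr ?_).mono ?_
  · intro _ _ ξ hξ ζ _
    have h0 := (hpos ξ hξ).ne'
    have hin : inner ℝ ξ ζ = ∑ i, ξ i * ζ i := by
      rw [PiLp.inner_apply]
      refine Finset.sum_congr rfl fun i _ => ?_
      simp [mul_comm]
    have e : ∑ i, (1 : ℂ) * ((-2 * ξ i / ‖ξ‖ ^ 2 : ℝ) : ℂ) * ((ζ i : ℝ) : ℂ) =
        ((-2 * inner ℝ ξ ζ / ‖ξ‖ ^ 2 : ℝ) : ℂ) := by
      rw [hin, Finset.mul_sum, Finset.sum_div, Complex.ofReal_sum]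
      refine Finset.sum_congr rfl fun i _ => ?_
      push_cast
      ring
    rw [e, one_mul, ← Complex.ofReal_mul, ← Complex.ofReal_add]
    congr 1
    rw [div_pow, norm_sub_sq_real]
    field_simp
    ring
  · rw [← NNReal.coe_le_coe, Real.coe_toNNReal _ (by positivity)]
    push_cast
    rw [Finset.sum_const, Finset.card_univ, Fintype.card_fin, nsmul_eq_mul,
      Real.coe_toNNReal _ (by positivity), Real.coe_toNNReal _ (by positivity),
      Real.coe_toNNReal _ (by positivity), Real.coe_toNNReal _ (by positivity)]
    set u := 1 / (ρ * R) with hu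
    have hu0 : 0 < u := by positivity
    have hu1 : u ≤ 1 := (div_le_one (by positivity)).2 hρR
    have e1 : (d : ℝ) * (1 * (8 / R) * (cutoff d / ρ)) + 1 * (4 / R) ^ 2 * (cutoff d / ρ) ^ 2 =
        (8 * (d * cutoff d)) * u + 16 * cutoff d ^ 2 * u ^ 2 := by
      rw [hu]
      field_simp
      norm_num
    have e2 : 1 / (2 * (ρ * R)) = u / 2 := by
      rw [hu]
      field_simp
    rw [e1, e2]
    have h3 := cutoff_mul d
    have h4 := cutoff_le d
    have h5 : 8 * (d * cutoff d) ≤ 1 / 4 := by nlinarith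
    have h6 : 16 * cutoff d ^ 2 ≤ 1 / 4 := by nlinarith
    nlinarith [mul_le_mul_of_nonneg_right h5 hu0.le,
      mul_le_mul h6 (by nlinarith : u ^ 2 ≤ u) (by positivity) (by norm_num)]

/-- For short times the change of the phase under a small change of frequency is separated. -/
theorem sepBound_phase_increment {α : ℝ} (hα : 0 < α) : ∃ N : ℝ≥0, ∀ {R ρ δ : ℝ}, 0 < R → 0 < ρ →
    0 < δ → 1 ≤ ρ * R → δ * R ^ (α - 1) ≤ ρ →
    SepBound (Set.Ioo 0 δ) {ξ : Space d | R / 4 ≤ ‖ξ‖ ∧ ‖ξ‖ ≤ 2 * R}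
      (Metric.closedBall (0 : Space d) (cutoff d / ρ))
      (fun t ξ ζ => Complex.exp (Complex.I * ((t * (‖ξ - ζ‖ ^ α - ‖ξ‖ ^ α) : ℝ) : ℂ))) N := by
  -- In the exponent, `t|ξ|^α` has size at most `2^α ρR` and the relative change of `|ξ|^α` at most
  -- `(α/2) exp(α/2)/(ρR)`; the factors `ρR` cancel.
  refine ⟨Real.toNNReal (Real.exp (2 ^ α * (α / 2 * Real.exp (α / 2)))), ?_⟩
  intro R ρ δ hR hρ hδ hρR hδR
  set X := {ξ : Space d | R / 4 ≤ ‖ξ‖ ∧ ‖ξ‖ ≤ 2 * R} with hX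
  set Z := Metric.closedBall (0 : Space d) (cutoff d / ρ) with hZ
  set u := 1 / (ρ * R) with hu
  have hu0 : 0 < u := by positivity
  have hu1 : u ≤ 1 := (div_le_one (by positivity)).2 hρR
  have hue : 1 / (2 * (ρ * R)) = u / 2 := by
    rw [hu]
    field_simp
  have hw := sepBound_relative_increment (d := d) hR hρ hρR (Set.Ioo 0 δ)
  rw [hue] at hw
  have hlog := hw.log_one_add (by
    rw [← NNReal.coe_le_coe, Real.coe_toNNReal _ (by positivity)]
    push_cast
    linarith)
  -- With `w` the relative increment of the squared norm, `|ξ-ζ|^α/|ξ|^α - 1 = exp((α/2) log(1+w)) -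
  -- 1`.
  have hexp := ((SepBound.const ((α / 2 : ℝ) : ℂ)).mul hlog).exp_sub_one
  have h2R : 0 < (2 * R) ^ α := Real.rpow_pos_of_pos (by positivity) α
  have ht := SepBound.single (T := Set.Ioo 0 δ) (X := X) (Z := Z) (c := fun t : ℝ => Complex.I * t)
      (a := fun ξ : Space d => ((‖ξ‖ ^ α : ℝ) : ℂ)) (b := fun _ => 1)
      (Complex.measurable_ofReal.comp (measurable_norm.pow_const α)) measurable_const
      (C := Real.toNNReal δ) (A := Real.toNNReal ((2 * R) ^ α))
      (B := 1) (Real.toNNReal_pos.2 h2R) one_pos (fun t ht => by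
        rw [norm_mul, Complex.norm_I, one_mul, Complex.norm_real, Real.coe_toNNReal _ hδ.le,
          Real.norm_of_nonneg ht.1.le]
        exact ht.2.le)
      (fun ξ hξ => by
        rw [Complex.norm_real, Real.coe_toNNReal _ h2R.le, Real.norm_of_nonneg (by positivity)]
        exact Real.rpow_le_rpow (norm_nonneg _) hξ.2 hα.le) (by simp)
  refine ((ht.mul hexp).exp.congr ?_).mono ?_
  · intro t _ ξ hξ ζ hζ
    have hξ0 : 0 < ‖ξ‖ := lt_of_lt_of_le (by positivity) hξ.1
    -- The window is shorter than `ξ`, so `ξ - ζ ≠ 0` and the logarithm is that of a positive real.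
    have hζ' : ‖ζ‖ < R / 4 := by
      have h1 : ‖ζ‖ ≤ cutoff d / ρ := by simpa [hZ] using hζ
      refine h1.trans_lt ?_
      rw [div_lt_iff₀ hρ]
      have := cutoff_le d
      nlinarith
    have hd : 0 < ‖ξ - ζ‖ := by
      have := norm_sub_norm_le ξ ζ
      linarith [hξ.1]
    have hq : 0 < ‖ξ - ζ‖ / ‖ξ‖ := by positivity
    have e1 : (1 : ℂ) + (((‖ξ - ζ‖ / ‖ξ‖) ^ 2 - 1 : ℝ) : ℂ) = (((‖ξ - ζ‖ / ‖ξ‖) ^ 2 : ℝ) : ℂ) := by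
      push_cast
      ring
    have e2 : Complex.exp (((α / 2 : ℝ) : ℂ) *
        Complex.log (1 + (((‖ξ - ζ‖ / ‖ξ‖) ^ 2 - 1 : ℝ) : ℂ))) =
        ((‖ξ - ζ‖ ^ α / ‖ξ‖ ^ α : ℝ) : ℂ) := by
      rw [e1, ← Complex.ofReal_log (by positivity), ← Complex.ofReal_mul, ← Complex.ofReal_exp]
      congr 1
      rw [Real.log_pow, ← Real.div_rpow (norm_nonneg _) (norm_nonneg _), Real.rpow_def_of_pos hq]
      congr 1
      push_cast
      ring
    rw [e2]
    congr 1
    have h3 : ‖ξ‖ ^ α ≠ 0 := (Real.rpow_pos_of_pos hξ0 α).ne'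
    have e3 : t * (‖ξ - ζ‖ ^ α - ‖ξ‖ ^ α) = t * ‖ξ‖ ^ α * (‖ξ - ζ‖ ^ α / ‖ξ‖ ^ α - 1) := by
      field_simp
    rw [e3]
    push_cast
    ring
  · have hn : ‖((α / 2 : ℝ) : ℂ)‖₊ = Real.toNNReal (α / 2) := by
      ext
      rw [coe_nnnorm, Complex.norm_real, Real.coe_toNNReal _ (by positivity),
        Real.norm_of_nonneg (by positivity)]
    refine Real.toNNReal_le_toNNReal (Real.exp_le_exp.2 ?_)
    have hv : ((‖((α / 2 : ℝ) : ℂ)‖₊ * (2 * Real.toNNReal (u / 2)) : ℝ≥0) : ℝ) = α / 2 * u := by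
      rw [hn]
      push_cast
      rw [Real.coe_toNNReal _ (by positivity), Real.coe_toNNReal _ (by positivity)]
      ring
    rw [hv]
    set v := α / 2 * u with hv'
    have hv0 : 0 ≤ v := by positivity
    have hvle : v ≤ α / 2 := mul_le_of_le_one_right (by positivity) hu1
    have hexp1 : Real.exp v - 1 ≤ v * Real.exp (α / 2) := by
      have h1 := Real.add_one_le_exp (-v)
      have h2 : Real.exp v * Real.exp (-v) = 1 := by
        rw [← Real.exp_add, add_neg_cancel, Real.exp_zero]
      have h3 : Real.exp v ≤ Real.exp (α / 2) := Real.exp_le_exp.2 hvle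
      nlinarith [Real.exp_pos v, mul_le_mul_of_nonneg_left h3 hv0]
    push_cast
    rw [Real.coe_toNNReal _ hδ.le, Real.coe_toNNReal _ h2R.le,
      Real.coe_toNNReal _ (sub_nonneg.2 (Real.one_le_exp hv0)), mul_one]
    have hδ2 : δ * (2 * R) ^ α ≤ 2 ^ α * (ρ * R) := by
      rw [Real.mul_rpow (by norm_num) hR.le]
      have : R ^ α = R ^ (α - 1) * R := by
        rw [Real.rpow_sub_one hR.ne']
        field_simp
      rw [this]
      calc δ * (2 ^ α * (R ^ (α - 1) * R)) = 2 ^ α * (δ * R ^ (α - 1) * R) := by ring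
        _ ≤ 2 ^ α * (ρ * R) := by gcongr
    calc δ * (2 * R) ^ α * (Real.exp v - 1) ≤ (2 ^ α * (ρ * R)) * (v * Real.exp (α / 2)) := by
          refine mul_le_mul hδ2 hexp1 (sub_nonneg.2 (Real.one_le_exp hv0)) (by positivity)
      _ = 2 ^ α * (α / 2 * Real.exp (α / 2)) := by
          rw [hv', hu]
          field_simp

/-! ### Windowed transforms and finite speed of propagation -/

/-- The windowed Fourier transform `∫ exp(-ik·ζ) β(ζ) g(ξ-ζ) dζ`. -/
def windowed (α : ℝ) (β g : Space d → ℂ) (k ξ : Space d) : ℂ :=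
  osc α (fun ζ => β ζ * g (ξ - ζ)) 0 (-k)

theorem BandLimited.reflect_translate {g : Space d → ℂ} (hg : BandLimited g) (ξ : Space d) :
    BandLimited fun ζ => g (ξ - ζ) := by
  refine ⟨hg.measurable.comp (measurable_const.sub measurable_id), ?_, ?_⟩
  · rw [lintegral_sub_left_eq_self (fun ζ => ‖g ζ‖ₑ ^ 2)]
    exact hg.energy_lt_top
  · obtain ⟨R, hR⟩ := hg.bounded
    refine ⟨‖ξ‖ + R, fun ζ hζ => hR _ ?_⟩
    have := norm_sub_norm_le ζ ξ
    rw [norm_sub_rev] at this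
    linarith

section Windowed

variable {α : ℝ} {β g : Space d → ℂ}

theorem measurable_windowed (hα : 0 < α) (hβ : Measurable β) (hg : Measurable g) :
    Measurable fun p : Space d × Space d => windowed α β g p.1 p.2 := by
  unfold windowed osc
  refine (StronglyMeasurable.integral_prod_right' (f := fun q : (Space d × Space d) × Space d =>
    phase α 0 (-q.1.1) q.2 * (β q.2 * g (q.1.2 - q.2))) ?_).measurable
  refine Measurable.stronglyMeasurable ?_
  have h1 : Measurable fun q : (Space d × Space d) × Space d => phase α 0 (-q.1.1) q.2 := by
    have h2 : Measurable fun q : (Space d × Space d) × Space d => (((0 : ℝ), -q.1.1), q.2) := by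
      fun_prop
    have h3 := (continuous_phase (d := d) hα).measurable.comp h2
    simpa only [Function.comp_def] using h3
  exact h1.mul ((hβ.comp measurable_snd).mul
    (hg.comp (by fun_prop : Measurable fun q : (Space d × Space d) × Space d => q.1.2 - q.2)))

theorem windowed_eq_zero {ξ : Space d} (h : ∀ ζ, β ζ ≠ 0 → g (ξ - ζ) = 0) (k : Space d) :
    windowed α β g k ξ = 0 := by
  rw [windowed, osc]
  refine integral_eq_zero_of_ae (Eventually.of_forall fun ζ => ?_)
  by_cases h0 : β ζ = 0
  · simp [h0]
  · simp [h ζ h0]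

theorem bandLimited_windowed (hα : 0 < α) (hβ : Measurable β) (hβ1 : ∀ ζ, ‖β ζ‖ ≤ 1) {r : ℝ}
    (hβr : ∀ ζ, r < ‖ζ‖ → β ζ = 0) (hg : BandLimited g) (k : Space d) :
    BandLimited (windowed α β g k) := by
  obtain ⟨R, hR⟩ := hg.bounded
  have hm : Measurable fun ξ => windowed α β g k ξ := by
    have h2 : Measurable fun ξ : Space d => (k, ξ) := measurable_prodMk_left
    have h3 := (measurable_windowed hα hβ hg.measurable).comp h2
    simpa only [Function.comp_def] using h3
  have hzero : ∀ ξ, r + R < ‖ξ‖ → windowed α β g k ξ = 0 := by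
    intro ξ hξ
    refine windowed_eq_zero (fun ζ hζ => hR _ ?_) k
    have h1 : ‖ζ‖ ≤ r := by
      by_contra h
      exact hζ (hβr ζ (not_le.1 h))
    have := norm_sub_norm_le ξ ζ
    linarith
  have hbd : ∀ ξ, ‖windowed α β g k ξ‖ₑ ≤ ∫⁻ ζ, ‖g ζ‖ₑ := by
    intro ξ
    refine (enorm_osc_le _ _ _ _).trans ?_
    rw [← lintegral_sub_left_eq_self (fun ζ => ‖g ζ‖ₑ) ξ]
    refine lintegral_mono fun ζ => ?_
    rw [enorm_mul]
    refine mul_le_of_le_one_left' ?_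
    rw [← ofReal_norm]
    exact ENNReal.ofReal_le_one.2 (hβ1 ζ)
  refine ⟨hm, ?_, r + R, hzero⟩
  have hL : ∫⁻ ζ, ‖g ζ‖ₑ < ∞ := hg.integrable.2
  calc ∫⁻ ξ, ‖windowed α β g k ξ‖ₑ ^ 2
      ≤ ∫⁻ ξ, (Metric.closedBall (0 : Space d) (r + R)).indicator
          (fun _ => (∫⁻ ζ, ‖g ζ‖ₑ) ^ 2) ξ := by
        refine lintegral_mono fun ξ => ?_
        by_cases h : ξ ∈ Metric.closedBall (0 : Space d) (r + R)
        · rw [Set.indicator_of_mem h]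
          exact pow_le_pow_left' (hbd ξ) 2
        · rw [hzero ξ (by simpa using h)]
          simp
    _ = (∫⁻ ζ, ‖g ζ‖ₑ) ^ 2 * volume (Metric.closedBall (0 : Space d) (r + R)) :=
        lintegral_indicator_const measurableSet_closedBall _
    _ < ∞ := ENNReal.mul_lt_top (ENNReal.pow_lt_top hL) measure_closedBall_lt_top

/-- The energy of the windowed transform is controlled by Plancherel. -/
theorem lintegral_windowed_le (hα : 0 < α) (hβ : Measurable β) (hβ1 : ∀ ζ, ‖β ζ‖ ≤ 1) {r : ℝ}
    (hβr : ∀ ζ, r < ‖ζ‖ → β ζ = 0) (hg : BandLimited g) :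
    ∫⁻ k, ∫⁻ ξ, ‖windowed α β g k ξ‖ₑ ^ 2 ≤ ENNReal.ofReal ((2 * Real.pi) ^ d) *
      (volume (Metric.closedBall (0 : Space d) r) * ∫⁻ ξ, ‖g ξ‖ₑ ^ 2) := by
  have hm := measurable_windowed hα hβ hg.measurable
  have hm2 : Measurable (Function.uncurry fun k ξ => ‖windowed α β g k ξ‖ₑ ^ 2) :=
    hm.enorm.pow_const 2
  rw [lintegral_lintegral_swap hm2.aemeasurable]
  have hβ1' : ∀ ζ, ‖β ζ‖ ≤ ((1 : ℝ≥0) : ℝ) := by simpa using hβ1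
  -- For fixed `ξ` the map in `k` is a Fourier transform in `ζ`, so Plancherel comes first; the
  -- integral over `ξ` is then a translation.
  have h1 : ∀ ξ, ∫⁻ k, ‖windowed α β g k ξ‖ₑ ^ 2 ≤ ENNReal.ofReal ((2 * Real.pi) ^ d) *
      ∫⁻ ζ, (Metric.closedBall (0 : Space d) r).indicator (fun _ => (1 : ℝ≥0∞)) ζ *
        ‖g (ξ - ζ)‖ₑ ^ 2 := by
    intro ξ
    have hb := ((hg.reflect_translate ξ).mul hβ (c := 1) (fun ζ _ => hβ1' ζ)).1
    have h2 := lintegral_osc_zero_le hα hb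
    rw [← lintegral_neg_eq_self] at h2
    refine h2.trans (mul_le_mul_right (lintegral_mono fun ζ => ?_) _)
    by_cases h : ζ ∈ Metric.closedBall (0 : Space d) r
    · rw [Set.indicator_of_mem h, one_mul, enorm_mul]
      refine pow_le_pow_left' (mul_le_of_le_one_left' ?_) 2
      rw [← ofReal_norm]
      exact ENNReal.ofReal_le_one.2 (hβ1 ζ)
    · rw [hβr ζ (by simpa using h)]
      simp
  refine (lintegral_mono h1).trans (le_of_eq ?_)
  rw [lintegral_const_mul' _ _ (by finiteness)]
  congr 1
  have hm3 : Measurable (Function.uncurry fun ξ ζ : Space d =>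
      (Metric.closedBall (0 : Space d) r).indicator (fun _ => (1 : ℝ≥0∞)) ζ *
        ‖g (ξ - ζ)‖ₑ ^ 2) := by
    refine ((measurable_const.indicator measurableSet_closedBall).comp measurable_snd).mul ?_
    exact (hg.measurable.comp (by fun_prop : Measurable fun p : Space d × Space d =>
      p.1 - p.2)).enorm.pow_const 2
  rw [lintegral_lintegral_swap hm3.aemeasurable]
  have h3 : ∀ ζ : Space d, ∫⁻ ξ, (Metric.closedBall (0 : Space d) r).indicator
      (fun _ => (1 : ℝ≥0∞)) ζ * ‖g (ξ - ζ)‖ₑ ^ 2 =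
      (Metric.closedBall (0 : Space d) r).indicator (fun _ => (1 : ℝ≥0∞)) ζ *
        ∫⁻ ξ, ‖g ξ‖ₑ ^ 2 := by
    intro ζ
    rw [lintegral_const_mul' _ _ (by
      by_cases h : ζ ∈ Metric.closedBall (0 : Space d) r <;> simp [h]),
      lintegral_sub_right_eq_self (fun ξ => ‖g ξ‖ₑ ^ 2)]
  simp only [h3]
  rw [lintegral_mul_const' _ _ hg.energy_lt_top.ne,
    lintegral_indicator_const measurableSet_closedBall, one_mul]

/-- Expansion of the evolution near a point into evolutions of windowed data. -/
theorem enorm_osc_le_tsum_windowed (hα : 0 < α) {r t : ℝ} {X : Set (Space d)} {ι : Type}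
    [Countable ι] {m : ι → ℝ≥0} {M : ℝ≥0} {c : ι → ℂ} {a b : ι → Space d → ℂ}
    (ha : ∀ j, Measurable (a j)) (hb : ∀ j, Measurable (b j)) (hc1 : ∀ j, ‖c j‖ ≤ m j)
    (ha1 : ∀ j, ∀ ξ ∈ X, ‖a j ξ‖ ≤ 1)
    (hb1 : ∀ j, ∀ ζ ∈ Metric.closedBall (0 : Space d) r, ‖b j ζ‖ ≤ 1)
    (hm : ∑' j, (m j : ℝ≥0∞) ≤ M)
    (hs : ∀ ξ ∈ X, ∀ ζ ∈ Metric.closedBall (0 : Space d) r, HasSum (fun j => c j * a j ξ * b j ζ)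
      (Complex.exp (Complex.I * ((t * (‖ξ - ζ‖ ^ α - ‖ξ‖ ^ α) : ℝ) : ℂ))))
    (hg : BandLimited g)
    (hgX : ∀ ξ ∉ X, ∀ ζ ∈ Metric.closedBall (0 : Space d) r, g (ξ - ζ) = 0) (k x : Space d) :
    ‖osc α ((Metric.closedBall (0 : Space d) r).indicator fun _ => 1) 0 (x - k)‖ₑ *
      ‖osc α g t x‖ₑ ≤ ∑' j, m j * ‖osc α (fun ξ => a j ξ *
        windowed α ((Metric.closedBall (0 : Space d) r).indicator (b j)) g k ξ) t x‖ₑ := by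
  set Z := Metric.closedBall (0 : Space d) r with hZ
  have hZm : MeasurableSet Z := measurableSet_closedBall
  have hone : Integrable (Z.indicator fun _ : Space d => (1 : ℂ)) :=
    (integrable_indicator_iff hZm).2 (integrableOn_const measure_closedBall_lt_top.ne)
  have honeR : Integrable (Z.indicator fun _ : Space d => (1 : ℝ)) :=
    (integrable_indicator_iff hZm).2 (integrableOn_const measure_closedBall_lt_top.ne)
  set f : Space d → ℂ := fun ζ => phase α 0 (x - k) ζ * Z.indicator (fun _ => 1) ζ with hf
  set h : Space d → ℂ := fun ξ => phase α t x ξ * g ξ with hh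
  have hfi : Integrable f := integrable_phase_mul hα hone 0 (x - k)
  have hhi : Integrable h := integrable_phase_mul hα hg.integrable t x
  have hFi : Integrable (fun p : Space d × Space d => f p.2 * h (p.1 - p.2))
      (volume.prod volume) := by
    simpa using hfi.convolution_integrand (ContinuousLinearMap.mul ℝ ℂ) hhi
  have hGi : Integrable (fun p : Space d × Space d => Z.indicator (fun _ => (1 : ℝ)) p.2 *
      ‖g (p.1 - p.2)‖) (volume.prod volume) := by
    simpa using honeR.convolution_integrand (ContinuousLinearMap.mul ℝ ℝ) hg.integrable.norm
  -- A product of two integrals over frequency is the integral of a convolution. The first factor,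
  -- transform of the ball `Z` at `x - k`, localizes near `k`.
  have hFval : ∫ p : Space d × Space d, f p.2 * h (p.1 - p.2) ∂(volume.prod volume) =
      osc α (Z.indicator fun _ => 1) 0 (x - k) * osc α g t x := by
    rw [integral_prod_symm _ hFi]
    simp only [integral_const_mul]
    have : ∀ ζ : Space d, ∫ ξ, h (ξ - ζ) = ∫ ξ, h ξ := fun ζ => integral_sub_right_eq_self h ζ
    simp only [this, integral_mul_const]
    rfl
  set Fj : ι → Space d × Space d → ℂ := fun j p => c j * (phase α t x p.1 * (a j p.1 *
    (phase α 0 (-k) p.2 * (Z.indicator (b j) p.2 * g (p.1 - p.2))))) with hFj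
  have hFjm : ∀ j, Measurable (Fj j) := by
    intro j
    refine measurable_const.mul (((measurable_phase hα t x).comp measurable_fst).mul
      (((ha j).comp measurable_fst).mul (((measurable_phase hα 0 (-k)).comp measurable_snd).mul
      ((((hb j).indicator hZm).comp measurable_snd).mul (hg.measurable.comp ?_)))))
    fun_prop
  have hFjle : ∀ j p, ‖Fj j p‖ ≤ m j * (Z.indicator (fun _ => (1 : ℝ)) p.2 * ‖g (p.1 - p.2)‖) := by
    intro j p
    simp only [hFj, norm_mul, norm_phase, one_mul]
    by_cases hz : p.2 ∈ Z
    · simp only [Set.indicator_of_mem hz, one_mul]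
      by_cases hx : p.1 ∈ X
      · calc ‖c j‖ * (‖a j p.1‖ * (‖b j p.2‖ * ‖g (p.1 - p.2)‖))
            ≤ m j * (1 * (1 * ‖g (p.1 - p.2)‖)) := by
              gcongr
              exacts [hc1 j, ha1 j _ hx, hb1 j _ hz]
          _ = _ := by ring
      · simp [hgX _ hx _ hz]
    · simp [hz]
  have hFjval : ∀ j, ∫ p, Fj j p ∂(volume.prod volume) =
      c j * osc α (fun ξ => a j ξ * windowed α (Z.indicator (b j)) g k ξ) t x := by
    intro j
    have hi : Integrable (Fj j) (volume.prod volume) :=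
      (hGi.const_mul (m j : ℝ)).mono' (hFjm j).aestronglyMeasurable
        (Eventually.of_forall (hFjle j))
    rw [integral_prod _ hi]
    simp only [hFj, integral_const_mul]
    rfl
  have hsum : ∀ p : Space d × Space d, HasSum (fun j => Fj j p) (f p.2 * h (p.1 - p.2)) := by
    intro p
    by_cases hz : p.2 ∈ Z
    · by_cases hx : p.1 ∈ X
      · have h1 := (hs _ hx _ hz).mul_left
          (phase α t x p.1 * (phase α 0 (-k) p.2 * g (p.1 - p.2)))
        have e : f p.2 * h (p.1 - p.2) = phase α t x p.1 * (phase α 0 (-k) p.2 * g (p.1 - p.2)) *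
            Complex.exp (Complex.I * ((t * (‖p.1 - p.2‖ ^ α - ‖p.1‖ ^ α) : ℝ) : ℂ)) := by
          -- The terms `x·ζ` cancel. What is left is the evolution phase in `ξ`, the window phase
          -- `-k·ζ`, and the increment of `t|ξ|^α`, the only factor that mixes the variables.
          have e2 : phase α 0 (x - k) p.2 * phase α t x (p.1 - p.2) =
              phase α t x p.1 * phase α 0 (-k) p.2 *
            Complex.exp (Complex.I * ((t * (‖p.1 - p.2‖ ^ α - ‖p.1‖ ^ α) : ℝ) : ℂ)) := by
            simp only [phase, ← Complex.exp_add, inner_sub_left, inner_sub_right, inner_neg_left]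
            congr 1
            push_cast
            ring
          simp only [hf, hh, Set.indicator_of_mem hz, mul_one]
          linear_combination g (p.1 - p.2) * e2
        rw [e]
        refine h1.congr_fun ?_ |> id
        intro j
        simp only [hFj, Set.indicator_of_mem hz]
        ring
      · simp [hFj, hh, hgX _ hx _ hz]
    · simp [hFj, hf, hz]
  have key := enorm_integral_le_tsum hGi (SepBound.summable_of_tsum_le hm)
    (fun j => (hFjm j).aestronglyMeasurable) hFjle hsum
  rw [hFval, enorm_mul] at key
  refine key.trans (ENNReal.tsum_le_tsum fun j => ?_)
  rw [hFjval, enorm_mul]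
  gcongr
  rw [enorm_eq_nnnorm]
  exact_mod_cast hc1 j

end Windowed

/-- The transform of a small ball is bounded below on the dual ball. -/
theorem le_enorm_osc_indicator_closedBall {α : ℝ} (hα : 0 < α) {ρ r : ℝ} (hr : r * ρ ≤ 1)
    {y : Space d} (hy : ‖y‖ ≤ ρ) :
    volume (Metric.closedBall (0 : Space d) r) / 2 ≤
      ‖osc α ((Metric.closedBall (0 : Space d) r).indicator fun _ => 1) 0 y‖ₑ := by
  set Z := Metric.closedBall (0 : Space d) r with hZ
  have hZm : MeasurableSet Z := measurableSet_closedBall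
  have hfin : volume Z ≠ ∞ := measure_closedBall_lt_top.ne
  have hone : Integrable (Z.indicator fun _ : Space d => (1 : ℂ)) :=
    (integrable_indicator_iff hZm).2 (integrableOn_const hfin)
  have hint := integrable_phase_mul hα hone 0 y
  have h1 : (volume Z).toReal / 2 ≤ (osc α (Z.indicator fun _ => 1) 0 y).re := by
    have h2 : (osc α (Z.indicator fun _ => 1) 0 y).re =
        ∫ ζ, (phase α 0 y ζ * Z.indicator (fun _ => 1) ζ).re := by
      rw [osc]
      exact (integral_re hint).symm
    have h3 : (volume Z).toReal / 2 = ∫ ζ, Z.indicator (fun _ => (1 / 2 : ℝ)) ζ := by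
      rw [integral_indicator hZm, setIntegral_const, smul_eq_mul, Measure.real]
      ring
    rw [h2, h3]
    refine integral_mono ((integrable_indicator_iff hZm).2 (integrableOn_const hfin)) hint.re ?_
    intro ζ
    by_cases hζ : ζ ∈ Z
    · simp only [Set.indicator_of_mem hζ, mul_one]
      rw [phase, mul_comm, Complex.exp_ofReal_mul_I_re]
      -- Hence `cos(y·ζ) ≥ 1 - 1/2` on the whole ball, and the real part cannot cancel.
      have h4 : |inner ℝ y ζ| ≤ 1 := by
        refine (abs_real_inner_le_norm y ζ).trans ?_
        have h5 : ‖ζ‖ ≤ r := by simpa [hZ] using hζ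
        calc ‖y‖ * ‖ζ‖ ≤ ρ * r := by
              have := (norm_nonneg y).trans hy
              gcongr
          _ ≤ 1 := by linarith
      have h6 := Real.one_sub_sq_div_two_le_cos (x := inner ℝ y ζ + 0 * ‖ζ‖ ^ α)
      rw [zero_mul, add_zero] at h6 ⊢
      have h7 : (inner ℝ y ζ) ^ 2 ≤ 1 := by
        rw [← sq_abs]
        exact pow_le_one₀ (abs_nonneg _) h4
      linarith
    · simp [hζ]
  have h8 : volume Z / 2 = ENNReal.ofReal ((volume Z).toReal / 2) := by
    rw [ENNReal.ofReal_div_of_pos (by norm_num), ENNReal.ofReal_toReal hfin, ENNReal.ofReal_ofNat]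
  rw [h8, ← ofReal_norm]
  exact ENNReal.ofReal_le_ofReal (h1.trans ((le_abs_self _).trans (Complex.abs_re_le_norm _)))

/-- Over short times the maximal estimate on a ball becomes global, because the propagation has
finite speed at the given frequency. -/
theorem MaximalFamily.short_time {α : ℝ} (hα : 0 < α) : ∃ C : ℝ≥0, ∀ {γ s : ℝ} {A K : ℝ≥0}
    {𝓜 : Set (Measure (Space d))}, MaximalFamily α γ (((d : ℝ) - γ) / 2 + s) A K 𝓜 → γ ≤ d → 0 < s →
    ∀ {μ : Measure (Space d)}, μ ∈ 𝓜 → ∀ {R ρ δ : ℝ}, 0 < R → 0 < ρ → 0 < δ → 1 ≤ ρ * R →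
    δ ≤ ρ ^ α → δ * R ^ (α - 1) ≤ ρ → ∀ {g : Space d → ℂ}, BandLimited g →
    (∀ ξ, ‖ξ‖ < R / 2 → g ξ = 0) → (∀ ξ, R < ‖ξ‖ → g ξ = 0) →
    ∫⁻ x, (⨆ t ∈ Set.Ioo 0 δ, ‖osc α g t x‖ₑ) ^ 2 ∂μ ≤
      C * ((ENNReal.ofReal ((2 * Real.pi) ^ d) * K) ^ 2 *
        ENNReal.ofReal (5 ^ (((d : ℝ) - γ) / 2 + s)) *
        (ENNReal.ofReal (R ^ ((d : ℝ) - γ) * (ρ * R) ^ (2 * s)) * ∫⁻ ξ, ‖g ξ‖ₑ ^ 2)) := by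
  obtain ⟨N, hN⟩ := sepBound_phase_increment (d := d) hα
  set V := volume (Metric.ball (0 : Space d) 1) with hV
  have hVpos : V ≠ 0 := (Metric.measure_ball_pos _ _ one_pos).ne'
  have hVtop : V ≠ ∞ := measure_ball_lt_top.ne
  have hc := cutoff_pos d
  -- The volume of the spatial ball of radius `ρ` times that of the frequency window of radius
  -- `cutoff d / ρ`; it does not depend on `ρ`.
  set W := ENNReal.ofReal (cutoff d ^ d) * V ^ 2 with hW
  have hW0 : W ≠ 0 := by
    refine mul_ne_zero ?_ (pow_ne_zero 2 hVpos)
    rw [Ne, ENNReal.ofReal_eq_zero, not_le]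
    positivity
  have hWtop : W ≠ ∞ := by finiteness
  refine ⟨(4 * W⁻¹ * (N : ℝ≥0∞) ^ 2 * ENNReal.ofReal ((2 * Real.pi) ^ d)).toNNReal, ?_⟩
  intro γ s A K 𝓜 h𝓜 hγ hs μ hμ R ρ δ hR hρ hδ hρR hδ1 hδ2 g hg hlow hhigh
  rw [ENNReal.coe_toNNReal (by
    have := ENNReal.inv_ne_top.2 hW0
    finiteness)]
  have := (h𝓜.growth μ hμ).isLocallyFinite
  obtain ⟨ι, hι, m, c, a, b, ha, hb, hc1, ha1, hb1, hm, hsum⟩ := hN hR hρ hδ hρR hδ2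
  set r := cutoff d / ρ with hr
  set Z := Metric.closedBall (0 : Space d) r with hZ
  have hZm : MeasurableSet Z := measurableSet_closedBall
  set X := {ξ : Space d | R / 4 ≤ ‖ξ‖ ∧ ‖ξ‖ ≤ 2 * R} with hX
  set E := ∫⁻ ξ, ‖g ξ‖ₑ ^ 2 with hE
  set B₀ := (ENNReal.ofReal ((2 * Real.pi) ^ d) * K) ^ 2 *
        ENNReal.ofReal (5 ^ (((d : ℝ) - γ) / 2 + s)) with hB₀
  set B := B₀ * ENNReal.ofReal (R ^ ((d : ℝ) - γ) * (ρ * R) ^ (2 * s)) with hB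
  have hBtop : B ≠ ∞ := by finiteness
  have hr0 : 0 ≤ r := by positivity
  have hrR : r ≤ R / 32 := by
    rw [hr, div_le_iff₀ hρ]
    have := cutoff_le d
    nlinarith
  -- Shifting the annulus `R/2 ≤ |ξ| ≤ R` by at most `R/32` stays inside the wider annulus `X`.
  have hgX : ∀ ξ ∉ X, ∀ ζ ∈ Z, g (ξ - ζ) = 0 := by
    intro ξ hξ ζ hζ
    have hζ' : ‖ζ‖ ≤ r := by simpa [hZ] using hζ
    by_cases h1 : R / 4 ≤ ‖ξ‖
    · have h2 : 2 * R < ‖ξ‖ := by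
        by_contra h
        exact hξ ⟨h1, not_lt.1 h⟩
      refine hhigh _ ?_
      have := norm_sub_norm_le ξ ζ
      linarith
    · refine hlow _ ?_
      have := norm_sub_le ξ ζ
      linarith
  set β : ι → Space d → ℂ := fun j => Z.indicator (b j) with hβ
  have hβm : ∀ j, Measurable (β j) := fun j => (hb j).indicator hZm
  have hβ1 : ∀ j ζ, ‖β j ζ‖ ≤ 1 := by
    intro j ζ
    by_cases h : ζ ∈ Z
    · simpa [hβ, h] using hb1 j ζ h
    · simp [hβ, h]
  have hβr : ∀ j ζ, r < ‖ζ‖ → β j ζ = 0 := by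
    intro j ζ h
    exact Set.indicator_of_notMem (by simpa [hZ] using h) _
  set G : ι → Space d → Space d → ℂ := fun j k => windowed α (β j) g k with hG
  have hGbl : ∀ j k, BandLimited (G j k) := fun j k =>
    bandLimited_windowed hα (hβm j) (hβ1 j) (hβr j) hg k
  have hGX : ∀ j k ξ, G j k ξ ≠ 0 → ξ ∈ X := by
    intro j k ξ h
    by_contra hξ
    refine h (windowed_eq_zero (fun ζ hζ => hgX ξ hξ ζ ?_) k)
    by_contra h'
    exact hζ (Set.indicator_of_notMem h' _)
  have hprod := fun j k => (hGbl j k).mul (ha j) (c := 1) fun ξ h => by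
    simpa using ha1 j ξ (hGX j k ξ h)
  set I := Set.Ioo (0 : ℝ) δ with hI
  set S : Space d → ℝ≥0∞ := fun x => ⨆ t ∈ I, ‖osc α g t x‖ₑ with hS
  have hSm : Measurable S := measurable_iSup_osc hα hg.integrable _
  set P : ι → Space d → Space d → ℝ≥0∞ :=
    fun j k x => ⨆ t ∈ I, ‖osc α (fun ξ => a j ξ * G j k ξ) t x‖ₑ with hP
  have hPm : ∀ j k, Measurable (P j k) := fun j k => measurable_iSup_osc hα (hprod j k).1.integrable _
  -- The rescaled hypothesis on the ball around `k`, applied to the windowed datum; `δ ≤ ρ^α` keeps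
  -- the times in its range.
  have hPint : ∀ j k, ∫⁻ x in Metric.ball k ρ, P j k x ^ 2 ∂μ ≤ B * ∫⁻ ξ, ‖G j k ξ‖ₑ ^ 2 := by
    intro j k
    have h1 := h𝓜.local_estimate_band hα hγ hs hμ k hρ hR hρR (hprod j k).1 (by
      intro ξ hξ
      have : G j k ξ = 0 := by
        by_contra h
        exact absurd (hGX j k ξ h).2 (not_le.2 hξ)
      simp [this])
    calc ∫⁻ x in Metric.ball k ρ, P j k x ^ 2 ∂μ ≤ _ := lintegral_mono fun x =>
          pow_le_pow_left' (biSup_mono fun t ht => ⟨ht.1, ht.2.trans_le hδ1⟩) 2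
      _ ≤ _ := h1
      _ ≤ _ := by
        rw [← mul_assoc]
        refine mul_le_mul_right ((hprod j k).2.trans ?_) _
        rw [ENNReal.coe_one, one_pow, one_mul]
  set v := volume Z with hv
  have hptw : ∀ k, ∀ x ∈ Metric.ball k ρ, v / 2 * S x ≤ ∑' j, m j * P j k x := by
    intro k x hx
    rw [hS]
    simp only [ENNReal.mul_iSup]
    refine iSup₂_le fun t ht => ?_
    have h1 := enorm_osc_le_tsum_windowed hα (c := fun j => c j t) ha hb (fun j => hc1 j t ht) ha1 hb1
      hm (fun ξ hξ ζ hζ => hsum t ht ξ hξ ζ hζ) hg hgX k x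
    have h2 := le_enorm_osc_indicator_closedBall hα (ρ := ρ) (r := r) (y := x - k) (by
      rw [hr, div_mul_cancel₀ _ hρ.ne']
      linarith [cutoff_le d]) (mem_ball_iff_norm.1 hx).le
    refine (mul_le_mul_left h2 _).trans (h1.trans (ENNReal.tsum_le_tsum fun j => ?_))
    gcongr
    exact le_iSup₂ (f := fun t _ => ‖osc α (fun ξ => a j ξ * G j k ξ) t x‖ₑ) t ht
  have hball : ∀ k, ∫⁻ x in Metric.ball k ρ, (v / 2 * S x) ^ 2 ∂μ ≤
      N * ∑' j, m j * (B * ∫⁻ ξ, ‖G j k ξ‖ₑ ^ 2) := by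
    intro k
    calc ∫⁻ x in Metric.ball k ρ, (v / 2 * S x) ^ 2 ∂μ
        ≤ ∫⁻ x in Metric.ball k ρ, N * ∑' j, m j * P j k x ^ 2 ∂μ := by
          refine setLIntegral_mono' measurableSet_ball fun x hx => ?_
          refine (pow_le_pow_left' (hptw k x hx) 2).trans ((tsum_mul_sq_le _ _).trans ?_)
          gcongr
      _ = N * ∑' j, m j * ∫⁻ x in Metric.ball k ρ, P j k x ^ 2 ∂μ := by
          rw [lintegral_const_mul' _ _ ENNReal.coe_ne_top,
            lintegral_tsum fun j => (((hPm j k).pow_const 2).const_mul _).aemeasurable]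
          simp only [lintegral_const_mul' _ _ ENNReal.coe_ne_top]
      _ ≤ _ := by
          gcongr with j
          exact hPint j k
  have hGm : ∀ j, Measurable fun k => ∫⁻ ξ, ‖G j k ξ‖ₑ ^ 2 := fun j =>
    ((measurable_windowed hα (hβm j) hg.measurable).enorm.pow_const 2).lintegral_prod_right'
  -- Integrate over the centres `k`: the local energies add up to `(2π)^d v E`, where `v` is the
  -- volume of the window, so no power of `ρ` is lost in going from balls to the whole space.
  have hmain : volume (Metric.ball (0 : Space d) ρ) * ((v / 2) ^ 2 * ∫⁻ x, S x ^ 2 ∂μ) ≤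
      N * (N * (B * (ENNReal.ofReal ((2 * Real.pi) ^ d) * (v * E)))) := by
    have hvtop : v ≠ ∞ := measure_closedBall_lt_top.ne
    have e1 : (v / 2) ^ 2 * ∫⁻ x, S x ^ 2 ∂μ = ∫⁻ x, (v / 2 * S x) ^ 2 ∂μ := by
      rw [← lintegral_const_mul' _ _ (ENNReal.pow_ne_top (ENNReal.div_ne_top hvtop two_ne_zero))]
      simp only [mul_pow]
    rw [e1, ← lintegral_lintegral_ball μ ((hSm.const_mul _).pow_const 2)]
    calc ∫⁻ k, ∫⁻ x in Metric.ball k ρ, (v / 2 * S x) ^ 2 ∂μ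
        ≤ ∫⁻ k, N * ∑' j, m j * (B * ∫⁻ ξ, ‖G j k ξ‖ₑ ^ 2) := lintegral_mono hball
      _ = N * ∑' j, m j * (B * ∫⁻ k, ∫⁻ ξ, ‖G j k ξ‖ₑ ^ 2) := by
          rw [lintegral_const_mul' _ _ ENNReal.coe_ne_top,
            lintegral_tsum fun j => (((hGm j).const_mul B).const_mul _).aemeasurable]
          simp only [lintegral_const_mul' _ _ ENNReal.coe_ne_top, lintegral_const_mul' _ _ hBtop]
      _ ≤ N * ∑' j, m j * (B * (ENNReal.ofReal ((2 * Real.pi) ^ d) * (v * E))) := by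
          gcongr with j
          exact lintegral_windowed_le hα (hβm j) (hβ1 j) (hβr j) hg
      _ ≤ _ := by
          rw [ENNReal.tsum_mul_right]
          gcongr
  have hWeq : volume (Metric.ball (0 : Space d) ρ) * v = W := by
    rw [hv, hZ, Measure.addHaar_ball_of_pos _ _ hρ, Measure.addHaar_closedBall _ _ hr0,
      finrank_euclideanSpace_fin, ← hV, hW]
    calc _ = ENNReal.ofReal (ρ ^ d) * ENNReal.ofReal (r ^ d) * V ^ 2 := by ring
      _ = _ := by
        rw [← ENNReal.ofReal_mul (by positivity), ← mul_pow, hr, mul_div_cancel₀ _ hρ.ne']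
  have hv0 : v ≠ 0 := by
    intro h
    rw [h, mul_zero] at hWeq
    exact hW0 hWeq.symm
  have hvtop : v ≠ ∞ := measure_closedBall_lt_top.ne
  have h4 : (4 : ℝ≥0∞) * (2⁻¹) ^ 2 = 1 := by
    rw [← ENNReal.inv_pow]
    norm_num
    exact ENNReal.mul_inv_cancel (by norm_num) (by norm_num)
  have hcancel : ∫⁻ x, S x ^ 2 ∂μ = 4 * W⁻¹ * v⁻¹ *
      (volume (Metric.ball (0 : Space d) ρ) * ((v / 2) ^ 2 * ∫⁻ x, S x ^ 2 ∂μ)) := by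
    calc ∫⁻ x, S x ^ 2 ∂μ = (4 * (2⁻¹) ^ 2) * (W⁻¹ * W) * (v⁻¹ * v) * ∫⁻ x, S x ^ 2 ∂μ := by
          rw [h4, ENNReal.inv_mul_cancel hW0 hWtop, ENNReal.inv_mul_cancel hv0 hvtop]
          simp
      _ = _ := by
          rw [← hWeq, div_eq_mul_inv]
          ring
  rw [hcancel]
  refine (mul_le_mul_right hmain _).trans (le_of_eq ?_)
  calc _ = 4 * W⁻¹ * (N : ℝ≥0∞) ^ 2 * ENNReal.ofReal ((2 * Real.pi) ^ d) * (B * E) * (v⁻¹ * v) := by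
        ring
    _ = _ := by
      rw [ENNReal.inv_mul_cancel hv0 hvtop, hB]
      ring

/-! ### Suprema, Schur's test and geometric sums -/

theorem iSup_sq_le {ι : Sort*} {f : ι → ℝ≥0∞} {c : ℝ≥0∞} (h : ∀ i, f i ^ 2 ≤ c) :
    (⨆ i, f i) ^ 2 ≤ c := by
  rcases isEmpty_or_nonempty ι with hι | hι
  · simp
  · rw [ENNReal.iSup_pow]
    exact iSup_le h

theorem biSup_sq_le {ι : Type*} {s : Set ι} {f : ι → ℝ≥0∞} {c : ℝ≥0∞}
    (h : ∀ i ∈ s, f i ^ 2 ≤ c) : (⨆ i ∈ s, f i) ^ 2 ≤ c :=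
  iSup_sq_le fun i => iSup_sq_le fun hi => h i hi

theorem add_sq_le_two (a b : ℝ≥0∞) : (a + b) ^ 2 ≤ 2 * a ^ 2 + 2 * b ^ 2 := by
  rcases eq_or_ne a ∞ with rfl | ha
  · simp
  rcases eq_or_ne b ∞ with rfl | hb
  · simp
  lift a to ℝ≥0 using ha
  lift b to ℝ≥0 using hb
  have : (a + b) ^ 2 ≤ 2 * a ^ 2 + 2 * b ^ 2 := by
    rw [← NNReal.coe_le_coe]
    push_cast
    nlinarith [sq_nonneg ((a : ℝ) - b)]
  exact_mod_cast this

/-- Schur's test for sums of functions with weighted `L²` bounds. -/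
theorem schur_lintegral {Y J : Type*} [MeasurableSpace Y] {ν : Measure Y} [Countable J]
    {b : J → ℕ → ℝ≥0∞} {F : J → Y → ℝ≥0∞} {f : J → ℕ → Y → ℝ≥0∞} {e : ℕ → ℝ≥0∞} {S S' : ℝ≥0∞}
    (hb0 : ∀ j k, b j k ≠ 0) (hbtop : ∀ j k, b j k ≠ ∞) (hS : ∀ j, ∑' k, b j k ≤ S)
    (hS' : ∀ k, ∑' j, b j k ≤ S') (hfm : ∀ j k, Measurable (f j k))
    (hF : ∀ j y, F j y ≤ ∑' k, f j k y) (hf : ∀ j k, ∫⁻ y, f j k y ^ 2 ∂ν ≤ b j k ^ 2 * e k) :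
    ∑' j, ∫⁻ y, F j y ^ 2 ∂ν ≤ S * S' * ∑' k, e k := by
  have h1 : ∀ j, ∫⁻ y, F j y ^ 2 ∂ν ≤ S * ∑' k, b j k * e k := by
    intro j
    calc ∫⁻ y, F j y ^ 2 ∂ν ≤ ∫⁻ y, S * ∑' k, b j k * ((b j k)⁻¹ * f j k y) ^ 2 ∂ν := by
          refine lintegral_mono fun y => ?_
          have e1 : ∑' k, f j k y = ∑' k, b j k * ((b j k)⁻¹ * f j k y) := by
            refine tsum_congr fun k => ?_
            rw [← mul_assoc, ENNReal.mul_inv_cancel (hb0 j k) (hbtop j k), one_mul]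
          refine (pow_le_pow_left' (hF j y) 2).trans ?_
          rw [e1]
          refine (tsum_mul_sq_le _ _).trans ?_
          gcongr
          exact hS j
      _ ≤ S * ∫⁻ y, ∑' k, b j k * ((b j k)⁻¹ * f j k y) ^ 2 ∂ν := by
          rw [lintegral_const_mul _ (Measurable.tsum fun k =>
            (((hfm j k).const_mul _).pow_const 2).const_mul _)]
      _ = S * ∑' k, b j k * ((b j k)⁻¹ ^ 2 * ∫⁻ y, f j k y ^ 2 ∂ν) := by
          rw [lintegral_tsum fun k => ((((hfm j k).const_mul _).pow_const 2).const_mul _).aemeasurable]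
          congr 1
          refine tsum_congr fun k => ?_
          simp only [mul_pow]
          rw [lintegral_const_mul' _ _ (hbtop j k), lintegral_const_mul' _ _
            (ENNReal.pow_ne_top (ENNReal.inv_ne_top.2 (hb0 j k)))]
      _ ≤ S * ∑' k, b j k * e k := by
          gcongr with k
          refine (mul_le_mul_right (hf j k) _).trans (le_of_eq ?_)
          rw [← mul_assoc, ← mul_pow, ENNReal.inv_mul_cancel (hb0 j k) (hbtop j k), one_pow, one_mul]
  calc ∑' j, ∫⁻ y, F j y ^ 2 ∂ν ≤ ∑' j, S * ∑' k, b j k * e k := ENNReal.tsum_le_tsum h1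
    _ = S * ∑' k, (∑' j, b j k) * e k := by
        rw [ENNReal.tsum_mul_left, ENNReal.tsum_comm]
        simp only [ENNReal.tsum_mul_right]
    _ ≤ S * ∑' k, S' * e k := by
        gcongr with k
        exact hS' k
    _ = _ := by rw [ENNReal.tsum_mul_left, mul_assoc]

/-- Exponentially decaying sums along an arithmetic progression are bounded uniformly. -/
theorem exists_tsum_two_rpow_le {p ε : ℝ} (hp : 0 < p) (hε : 0 < ε) : ∃ S : ℝ≥0, ∀ y : ℝ,
    ∑' k : ℕ, ENNReal.ofReal (2 ^ (-(ε * |p * k - y|))) ≤ S := by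
  -- Recentring the progression at `⌊y/p⌋` moves it by at most one step `p`; the factor `2^(εp)`
  -- pays for this.
  set f : ℤ → ℝ := fun i => 2 ^ (ε * p) * 2 ^ (-(ε * p * |(i : ℝ)|)) with hf
  have hsum : Summable f := by
    have h1 : Summable fun n : ℕ => (2 : ℝ) ^ (ε * p) * ((2 : ℝ) ^ (-(ε * p))) ^ n := by
      refine (summable_geometric_of_lt_one (by positivity) ?_).mul_left _
      exact Real.rpow_lt_one_of_one_lt_of_neg (by norm_num) (by nlinarith [mul_pos hε hp])
    refine Summable.of_nat_of_neg ?_ ?_ <;>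
    · refine h1.congr fun n => ?_
      simp only [hf]
      rw [← Real.rpow_natCast, ← Real.rpow_mul (by norm_num)]
      simp
  refine ⟨(∑' i, ENNReal.ofReal (f i)).toNNReal, fun y => ?_⟩
  rw [ENNReal.coe_toNNReal hsum.tsum_ofReal_ne_top]
  set K := ⌊y / p⌋ with hK
  have hinj : Function.Injective fun k : ℕ => (k : ℤ) - K := by
    intro a b h
    simpa using h
  refine le_trans (ENNReal.tsum_le_tsum fun k => ?_)
    (ENNReal.tsum_comp_le_tsum_of_injective hinj fun i => ENNReal.ofReal (f i))
  refine ENNReal.ofReal_le_ofReal ?_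
  simp only [hf]
  rw [← Real.rpow_add (by norm_num)]
  refine Real.rpow_le_rpow_of_exponent_le (by norm_num) ?_
  have h1 : (K : ℝ) ≤ y / p := Int.floor_le _
  have h2 : y / p < K + 1 := Int.lt_floor_add_one _
  rw [le_div_iff₀ hp] at h1
  rw [div_lt_iff₀ hp] at h2
  have h3 : p * |((k : ℤ) - K : ℤ)| ≤ p + |p * k - y| := by
    push_cast
    have : p * |(k : ℝ) - K| = |p * k - p * K| := by
      rw [← mul_sub, abs_mul, abs_of_pos hp]
    rw [this]
    have e : p * k - p * K = (p * k - y) + (y - p * K) := by ring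
    rw [e]
    refine (abs_add_le _ _).trans ?_
    have : |y - p * K| ≤ p := abs_le.2 ⟨by nlinarith, by nlinarith⟩
    linarith
  push_cast at h3 ⊢
  nlinarith

/-! ### Dyadic shells -/

/-- The dyadic shell of frequencies at most `2^k`. -/
def shell (d : ℕ) : ℕ → Set (Space d) :=
  disjointed fun k => Metric.ball (0 : Space d) (2 ^ k)

theorem measurableSet_shell (k : ℕ) : MeasurableSet (shell d k) :=
  MeasurableSet.disjointed (fun _ => measurableSet_ball) k

theorem norm_lt_of_mem_shell {k : ℕ} {ξ : Space d} (h : ξ ∈ shell d k) : ‖ξ‖ < 2 ^ k := by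
  simpa using disjointed_subset _ _ h

theorem le_norm_of_mem_shell {k : ℕ} {ξ : Space d} (h : ξ ∈ shell d (k + 1)) : 2 ^ k ≤ ‖ξ‖ := by
  have hmono : Monotone fun k : ℕ => Metric.ball (0 : Space d) (2 ^ k) := fun a b hab =>
    Metric.ball_subset_ball (pow_le_pow_right₀ (by norm_num) hab)
  rw [shell, hmono.disjointed_add_one] at h
  simpa using h.2

theorem iUnion_shell : ⋃ k, shell d k = Set.univ := by
  rw [shell, iUnion_disjointed]
  refine Set.eq_univ_of_forall fun ξ => Set.mem_iUnion.2 ?_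
  obtain ⟨n, hn⟩ := pow_unbounded_of_one_lt ‖ξ‖ (by norm_num : (1 : ℝ) < 2)
  exact ⟨n, by simpa using hn⟩

theorem pairwise_disjoint_shell : Pairwise (Function.onFun Disjoint (shell d)) :=
  disjoint_disjointed _

theorem hasSum_osc_shell {α : ℝ} (hα : 0 < α) {g : Space d → ℂ} (hg : Integrable g) (t : ℝ)
    (x : Space d) : HasSum (fun k => osc α ((shell d k).indicator g) t x) (osc α g t x) := by
  have h := hasSum_integral_iUnion (μ := (volume : Measure (Space d))) measurableSet_shell
    pairwise_disjoint_shell (f := fun ξ => phase α t x ξ * g ξ)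
    (integrable_phase_mul hα hg t x).integrableOn
  rw [iUnion_shell, setIntegral_univ] at h
  refine h.congr_fun ?_ |> id
  intro k
  rw [osc, ← integral_indicator (measurableSet_shell k)]
  congr 1
  ext ξ
  by_cases hξ : ξ ∈ shell d k <;> simp [hξ]

theorem tsum_wEnergy_shell {g : Space d → ℂ} (hg : Measurable g) (σ : ℝ) :
    ∑' k, wEnergy σ ((shell d k).indicator g) = wEnergy σ g := by
  have hm : Measurable fun ξ => ENNReal.ofReal ((1 + ‖ξ‖ ^ 2) ^ σ) * ‖g ξ‖ₑ ^ 2 :=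
    (measurable_ofReal_weight σ).mul (hg.enorm.pow_const 2)
  have h : ∀ k, wEnergy σ ((shell d k).indicator g) =
      ∫⁻ ξ in shell d k, ENNReal.ofReal ((1 + ‖ξ‖ ^ 2) ^ σ) * ‖g ξ‖ₑ ^ 2 := by
    intro k
    rw [wEnergy, ← lintegral_indicator (measurableSet_shell k)]
    congr 1
    ext ξ
    by_cases hξ : ξ ∈ shell d k <;> simp [hξ]
  simp only [h]
  rw [← lintegral_iUnion measurableSet_shell pairwise_disjoint_shell, iUnion_shell,
    setLIntegral_univ, wEnergy]

theorem BandLimited.indicator {g : Space d → ℂ} (hg : BandLimited g) {s : Set (Space d)}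
    (hs : MeasurableSet s) : BandLimited (s.indicator g) := by
  refine ⟨hg.measurable.indicator hs, lt_of_le_of_lt (lintegral_mono fun ξ => ?_) hg.energy_lt_top, ?_⟩
  · by_cases h : ξ ∈ s <;> simp [h]
  · obtain ⟨R, hR⟩ := hg.bounded
    refine ⟨R, fun ξ hξ => ?_⟩
    by_cases h : ξ ∈ s <;> simp [h, hR ξ hξ]

/-- On a shell `4^k ≤ 4(1+|ξ|²)`: for `k ≥ 1` because `|ξ| ≥ 2^(k-1)`, and trivially on the unit
ball `k = 0`. The power `σ ≥ 0` preserves this. -/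
theorem lintegral_shell_le (g : Space d → ℂ) {σ : ℝ} (hσ : 0 ≤ σ) (k : ℕ) :
    ENNReal.ofReal (2 ^ (2 * k * σ)) * ∫⁻ ξ, ‖(shell d k).indicator g ξ‖ₑ ^ 2 ≤
      ENNReal.ofReal (4 ^ σ) * wEnergy σ ((shell d k).indicator g) := by
  rw [wEnergy, ← lintegral_const_mul' _ _ ENNReal.ofReal_ne_top,
    ← lintegral_const_mul' _ _ ENNReal.ofReal_ne_top]
  refine lintegral_mono fun ξ => ?_
  by_cases hξ : ξ ∈ shell d k
  · rw [← mul_assoc, ← ENNReal.ofReal_mul (by positivity), ← Real.mul_rpow (by norm_num) (by positivity)]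
    refine mul_le_mul_left (ENNReal.ofReal_le_ofReal ?_) _
    rw [Real.rpow_mul (by norm_num)]
    refine Real.rpow_le_rpow (by positivity) ?_ hσ
    have e : (2 : ℝ) ^ (2 * (k : ℝ)) = (2 ^ k) ^ 2 := by
      rw [mul_comm, Real.rpow_mul (by norm_num), Real.rpow_natCast]
      norm_num
    rw [e]
    rcases k with _ | k
    · nlinarith [sq_nonneg ‖ξ‖]
    · have h1 := le_norm_of_mem_shell hξ
      have h2 : (0 : ℝ) < 2 ^ k := by positivity
      have h3 : (2 : ℝ) ^ (k + 1) = 2 * 2 ^ k := by ring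
      rw [h3]
      nlinarith
  · simp [hξ]

/-! ### Time reversal and fixed time Sobolev bounds -/

/-- The symmetry that reverses time. -/
def reflConj (g : Space d → ℂ) : Space d → ℂ := fun ξ => (starRingEnd ℂ) (g (-ξ))

/-- Conjugation changes the sign of both phases; the reflection `ξ ↦ -ξ` restores that of `x·ξ` and
leaves `|ξ|^α` alone, so only time is reversed. -/
theorem osc_reflConj (α : ℝ) (g : Space d → ℂ) (t : ℝ) (x : Space d) :
    osc α (reflConj g) t x = (starRingEnd ℂ) (osc α g (-t) x) := by
  rw [osc, osc, ← integral_conj, ← integral_neg_eq_self]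
  congr 1
  ext ξ
  rw [map_mul, reflConj, neg_neg, phase, phase, ← Complex.exp_conj]
  congr 2
  rw [map_mul, Complex.conj_I, Complex.conj_ofReal, inner_neg_right, norm_neg]
  push_cast
  ring

theorem enorm_osc_neg (α : ℝ) (g : Space d → ℂ) (t : ℝ) (x : Space d) :
    ‖osc α g (-t) x‖ₑ = ‖osc α (reflConj g) t x‖ₑ := by
  rw [osc_reflConj, RCLike.enorm_conj]

theorem enorm_reflConj (g : Space d → ℂ) (ξ : Space d) : ‖reflConj g ξ‖ₑ = ‖g (-ξ)‖ₑ := by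
  rw [reflConj, RCLike.enorm_conj]

theorem energy_reflConj (g : Space d → ℂ) : ∫⁻ ξ, ‖reflConj g ξ‖ₑ ^ 2 = ∫⁻ ξ, ‖g ξ‖ₑ ^ 2 := by
  simp only [enorm_reflConj]
  exact lintegral_neg_eq_self (fun ξ => ‖g ξ‖ₑ ^ 2)

theorem wEnergy_reflConj (σ : ℝ) (g : Space d → ℂ) : wEnergy σ (reflConj g) = wEnergy σ g := by
  rw [wEnergy, wEnergy, ← lintegral_neg_eq_self]
  simp only [enorm_reflConj, norm_neg, neg_neg]

theorem BandLimited.reflConj {g : Space d → ℂ} (hg : BandLimited g) : BandLimited (reflConj g) := by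
  refine ⟨Complex.continuous_conj.measurable.comp (hg.measurable.comp measurable_neg), ?_, ?_⟩
  · rw [energy_reflConj]
    exact hg.energy_lt_top
  · obtain ⟨R, hR⟩ := hg.bounded
    exact ⟨R, fun ξ hξ => by simp [SeqSchrodinger.reflConj, hR (-ξ) (by simpa using hξ)]⟩

/-- Maximal bounds for positive times imply maximal bounds for times of both signs. -/
theorem lintegral_iSup_symm_le {α : ℝ} (hα : 0 < α) {μ : Measure (Space d)} {g : Space d → ℂ}
    (hg : BandLimited g) {δ : ℝ} {c : ℝ≥0∞}
    (h1 : ∫⁻ x, (⨆ t ∈ Set.Ioo 0 δ, ‖osc α g t x‖ₑ) ^ 2 ∂μ ≤ c)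
    (h2 : ∫⁻ x, (⨆ t ∈ Set.Ioo 0 δ, ‖osc α (reflConj g) t x‖ₑ) ^ 2 ∂μ ≤ c) :
    ∫⁻ x, (⨆ t ∈ {t : ℝ | 0 < |t| ∧ |t| < δ}, ‖osc α g t x‖ₑ) ^ 2 ∂μ ≤ 2 * c := by
  calc _ ≤ ∫⁻ x, ((⨆ t ∈ Set.Ioo 0 δ, ‖osc α g t x‖ₑ) ^ 2 +
          (⨆ t ∈ Set.Ioo 0 δ, ‖osc α (reflConj g) t x‖ₑ) ^ 2) ∂μ := by
        refine lintegral_mono fun x => biSup_sq_le fun t ht => ?_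
        rcases lt_or_ge 0 t with h | h
        · refine le_add_right (pow_le_pow_left' ?_ 2)
          exact le_iSup₂ (f := fun t _ => ‖osc α g t x‖ₑ) t ⟨h, (abs_of_pos h) ▸ ht.2⟩
        · refine le_add_left (pow_le_pow_left' ?_ 2)
          have h3 := enorm_osc_neg α g (-t) x
          rw [neg_neg] at h3
          rw [h3]
          rw [Set.mem_ofPred_eq, abs_of_nonpos h] at ht
          exact le_iSup₂ (f := fun t _ => ‖osc α (reflConj g) t x‖ₑ) (-t) ht
    _ = _ := lintegral_add_left ((measurable_iSup_osc hα hg.integrable _).pow_const 2) _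
    _ ≤ c + c := add_le_add h1 h2
    _ = 2 * c := (two_mul c).symm

theorem two_pow_rpow (k : ℕ) (x : ℝ) : ((2 : ℝ) ^ k) ^ x = 2 ^ (k * x) := by
  rw [← Real.rpow_natCast, ← Real.rpow_mul (by norm_num)]

/-- Fixed time estimate in Sobolev spaces. -/
theorem lintegral_osc_le_wEnergy {α γ s : ℝ} (hα : 0 < α) (hγ : γ ≤ d) (hs : 0 < s) :
    ∃ C : ℝ≥0, ∀ {μ : Measure (Space d)} {A : ℝ≥0}, GrowthBound γ μ A →
    ∀ {g : Space d → ℂ}, BandLimited g → ∀ t : ℝ,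
    ∫⁻ x, ‖osc α g t x‖ₑ ^ 2 ∂μ ≤ C * A * wEnergy (((d : ℝ) - γ) / 2 + s) g := by
  obtain ⟨C₀, hC₀⟩ := lintegral_osc_le (d := d)
  obtain ⟨S, hS⟩ := exists_tsum_two_rpow_le hs one_pos
  set σ := ((d : ℝ) - γ) / 2 + s with hσ
  have hσ0 : 0 ≤ σ := by linarith
  refine ⟨S * C₀ * Real.toNNReal (4 ^ σ), ?_⟩
  intro μ A hμ g hg t
  -- With a single row, Schur's test is Cauchy-Schwarz over the shells with weights `2^(-sk)`,
  -- summable thanks to the surplus smoothness `s`.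
  have hmain := schur_lintegral (Y := Space d) (J := Unit) (ν := μ)
    (b := fun _ k => ENNReal.ofReal (2 ^ (-(1 * |s * (k : ℝ) - 0|))))
    (F := fun _ x => ‖osc α g t x‖ₑ) (f := fun _ k x => ‖osc α ((shell d k).indicator g) t x‖ₑ)
    (e := fun k => C₀ * A * (ENNReal.ofReal (4 ^ σ) * wEnergy σ ((shell d k).indicator g)))
    (S := S) (S' := 1)
    (fun _ k => by
      rw [Ne, ENNReal.ofReal_eq_zero, not_le]
      positivity) (fun _ k => ENNReal.ofReal_ne_top) (fun _ => hS 0)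
    (fun k => by
      rw [tsum_fintype]
      simp only [Finset.univ_unique, Finset.sum_singleton]
      refine ENNReal.ofReal_le_one.2 (Real.rpow_le_one_of_one_le_of_nonpos (by norm_num) ?_)
      rw [one_mul]
      exact neg_nonpos.2 (abs_nonneg _))
    (fun _ k => (continuous_osc_right hα (hg.indicator (measurableSet_shell k)).integrable t).enorm.measurable)
    (fun _ x => by
      rw [← (hasSum_osc_shell hα hg.integrable t x).tsum_eq]
      exact enorm_tsum_le_tsum_enorm)
    (fun _ k => by
      have h1 := hC₀ hα hμ (R := 2 ^ k) (by positivity) (hg.indicator (measurableSet_shell k))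
        (fun ξ hξ => Set.indicator_of_notMem (fun h => (norm_lt_of_mem_shell h).not_gt hξ) g) t
      refine h1.trans ?_
      refine le_trans (le_of_eq ?_) (mul_le_mul_right (mul_le_mul_right
        (lintegral_shell_le g hσ0 k) (C₀ * A : ℝ≥0∞)) _)
      rw [two_pow_rpow, ← ENNReal.ofReal_pow (by positivity)]
      have e : (2 : ℝ) ^ ((k : ℝ) * (d - γ)) = (2 ^ (-(1 * |s * (k : ℝ) - 0|))) ^ 2 * 2 ^ (2 * k * σ) := by
        rw [← Real.rpow_natCast, ← Real.rpow_mul (by norm_num), ← Real.rpow_add (by norm_num), sub_zero,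
          abs_of_nonneg (by positivity), hσ]
        congr 1
        push_cast
        ring
      rw [e, ENNReal.ofReal_mul (by positivity)]
      ring)
  rw [tsum_fintype] at hmain
  simp only [Finset.univ_unique, Finset.sum_singleton] at hmain
  refine hmain.trans (le_of_eq ?_)
  rw [ENNReal.tsum_mul_left, ENNReal.tsum_mul_left, tsum_wEnergy_shell hg.measurable]
  push_cast
  rw [ENNReal.ofReal]
  ring

/-! ### Balance of exponents and counting of times -/

theorem sTilde_pos {α r s : ℝ} (hα : 0 < α) (hr : 0 < r) (hs : 0 < s) : 0 < sTilde α r s := by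
  have : 0 < min α 1 := lt_min hα one_pos
  unfold sTilde
  positivity

/-- The block bounds decay away from the critical frequency. -/
theorem exists_block_decay {α r s : ℝ} (hα : 0 < α) (hr : 0 < r) (hs : 0 < s) :
    ∃ ε : ℝ, 0 < ε ∧ ∀ k j : ℝ, 0 ≤ k → 0 ≤ j →
      (0 ≤ sTilde α r s * k - r / 2 * j →
        r / 2 * j - sTilde α r s * k ≤ -(ε * |sTilde α r s * k - r / 2 * j|)) ∧
      (sTilde α r s * k - r / 2 * j < 0 → 0 ≤ α * k - j →
        (α * k - j) * (s / min α 1) - sTilde α r s * k ≤ -(ε * |sTilde α r s * k - r / 2 * j|)) ∧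
      (sTilde α r s * k - r / 2 * j < 0 → α * k - j ≤ 0 →
        (α * k - j) - sTilde α r s * k ≤ -(ε * |sTilde α r s * k - r / 2 * j|)) := by
  have hp := sTilde_pos hα hr hs
  have hm : 0 < min α 1 := lt_min hα one_pos
  have hpeq : sTilde α r s * (r * min α 1 + 2 * s) = r * α * s := by
    unfold sTilde
    have : r * min α 1 + 2 * s ≠ 0 := by positivity
    field_simp
  set p := sTilde α r s
  set m := min α 1
  -- The three regimes require respectively `ε ≤ 1`, `ε ≤ 2s/(rm)`, and the last two bounds
  -- together.
  refine ⟨min (min 1 (2 * s / (r * m))) (min (2 / r) (2 * p / (α * r))), by positivity, ?_⟩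
  set ε := min (min 1 (2 * s / (r * m))) (min (2 / r) (2 * p / (α * r))) with hε
  have hε0 : 0 < ε := by positivity
  have h1 : ε ≤ 1 := (min_le_left _ _).trans (min_le_left _ _)
  have h2 : ε ≤ 2 * s / (r * m) := (min_le_left _ _).trans (min_le_right _ _)
  have h3 : ε ≤ 2 / r := (min_le_right _ _).trans (min_le_left _ _)
  have h4 : ε ≤ 2 * p / (α * r) := (min_le_right _ _).trans (min_le_right _ _)
  intro k j hk hj
  refine ⟨fun hy => ?_, fun hy hkj => ?_, fun hy hkj => ?_⟩
  · rw [abs_of_nonneg hy]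
    nlinarith
  · rw [abs_of_neg hy]
    -- This identity is the defining equation of `p`: the short time cost meets `2^(pk)` exactly on
    -- the line where the counting cost does.
    have e : (α * k - j) * (s / m) - p * k = 2 * s / (r * m) * (p * k - r / 2 * j) := by
      field_simp
      linear_combination (-k) * hpeq
    rw [e]
    nlinarith
  · rw [abs_of_neg hy]
    rw [le_div_iff₀ hr] at h3
    rw [le_div_iff₀ (by positivity)] at h4
    nlinarith [mul_nonneg (sub_nonneg.2 h3) (sub_nonneg.2 hkj), mul_nonneg hk (sub_nonneg.2 h4),
      mul_nonneg (mul_nonneg hε0.le hp.le) hk]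

/-- The indices of the times of size comparable to `2^{-j}`. -/
def timeBlock (t : ℕ → ℝ) (j : ℕ) : Set ℕ :=
  {n | (2 : ℝ) ^ (-((j : ℝ) + 1)) ≤ |t n| ∧ |t n| < 2 ^ (-(j : ℝ))}

theorem exists_mem_timeBlock {t : ℕ → ℝ} {n : ℕ} (h0 : t n ≠ 0) (h1 : |t n| < 1) :
    ∃ j, n ∈ timeBlock t j := by
  classical
  have hex : ∃ j : ℕ, (2 : ℝ) ^ (-((j : ℝ) + 1)) ≤ |t n| := by
    obtain ⟨j, hj⟩ := exists_pow_lt_of_lt_one (abs_pos.2 h0) (by norm_num : (2⁻¹ : ℝ) < 1)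
    refine ⟨j, le_trans ?_ hj.le⟩
    rw [← Real.rpow_natCast, Real.inv_rpow (by norm_num), ← Real.rpow_neg (by norm_num)]
    exact Real.rpow_le_rpow_of_exponent_le (by norm_num) (by linarith)
  refine ⟨Nat.find hex, Nat.find_spec hex, ?_⟩
  rcases hj : Nat.find hex with _ | j
  · simpa using h1
  · have := Nat.find_min hex (m := j) (by omega)
    rw [not_le] at this
    push_cast
    exact this

theorem MemWeakEll.encard_le {r : ℝ} {t : ℕ → ℝ} (ht : MemWeakEll r t) :
    ∃ D : ℝ≥0, ∀ δ : ℝ, 0 < δ →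
      ENNReal.ofReal (δ ^ r) * (({n : ℕ | δ ≤ |t n|}.encard : ℕ∞) : ℝ≥0∞) ≤ D := by
  refine ⟨(⨆ δ : ℝ, ⨆ _ : 0 < δ,
    ENNReal.ofReal (δ ^ r) * (({n : ℕ | δ ≤ |t n|}.encard : ℕ∞) : ℝ≥0∞)).toNNReal, fun δ hδ => ?_⟩
  rw [ENNReal.coe_toNNReal (ne_of_lt ht)]
  exact le_iSup₂ (f := fun (δ : ℝ) (_ : 0 < δ) => ENNReal.ofReal (δ ^ r) *
    (({n : ℕ | δ ≤ |t n|}.encard : ℕ∞) : ℝ≥0∞)) δ hδ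

/-- The weak `ℓ^r` bound at `δ = 2^(-(j+1))`, which costs a factor `2^r`. The exponent `rj` is
displayed as twice `r/2 * j` to match the squared norms. -/
theorem MemWeakEll.encard_timeBlock_le {r : ℝ} {t : ℕ → ℝ} (ht : MemWeakEll r t) :
    ∃ D : ℝ≥0, ∀ j : ℕ, (((timeBlock t j).encard : ℕ∞) : ℝ≥0∞) ≤
      D * ENNReal.ofReal (2 ^ (2 * (r / 2 * j))) := by
  obtain ⟨D, hD⟩ := ht.encard_le
  refine ⟨D * Real.toNNReal (2 ^ r), fun j => ?_⟩
  set δ : ℝ := 2 ^ (-((j : ℝ) + 1)) with hδ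
  have hδ0 : 0 < δ := by positivity
  have hsub : timeBlock t j ⊆ {n : ℕ | δ ≤ |t n|} := fun n hn => hn.1
  have hinv : ENNReal.ofReal (2 ^ (r * ((j : ℝ) + 1))) * ENNReal.ofReal (δ ^ r) = 1 := by
    rw [← ENNReal.ofReal_mul (by positivity), hδ, ← Real.rpow_mul (by norm_num),
      ← Real.rpow_add (by norm_num)]
    have : r * ((j : ℝ) + 1) + -((j : ℝ) + 1) * r = 0 := by ring
    rw [this]
    simp
  calc (((timeBlock t j).encard : ℕ∞) : ℝ≥0∞) ≤ (({n : ℕ | δ ≤ |t n|}.encard : ℕ∞) : ℝ≥0∞) :=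
        ENat.toENNReal_le.2 (Set.encard_le_encard hsub)
    _ = ENNReal.ofReal (2 ^ (r * ((j : ℝ) + 1))) * (ENNReal.ofReal (δ ^ r) *
          (({n : ℕ | δ ≤ |t n|}.encard : ℕ∞) : ℝ≥0∞)) := by
        rw [← mul_assoc, hinv, one_mul]
    _ ≤ ENNReal.ofReal (2 ^ (r * ((j : ℝ) + 1))) * D := by
        gcongr
        exact hD δ hδ0
    _ = _ := by
        have e : r * ((j : ℝ) + 1) = r + 2 * (r / 2 * j) := by ring
        rw [e, Real.rpow_add (by norm_num), ENNReal.ofReal_mul (by positivity)]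
        push_cast
        rw [ENNReal.ofReal]
        ring

theorem MemWeakEll.encard_large_lt_top {r : ℝ} {t : ℕ → ℝ} (ht : MemWeakEll r t) :
    (({n : ℕ | 1 ≤ |t n|}.encard : ℕ∞) : ℝ≥0∞) < ∞ := by
  obtain ⟨D, hD⟩ := ht.encard_le
  have := hD 1 one_pos
  rw [Real.one_rpow, ENNReal.ofReal_one, one_mul] at this
  exact this.trans_lt ENNReal.coe_lt_top

theorem enorm_sub_sq_le (a b : ℂ) : ‖a - b‖ₑ ^ 2 ≤ 2 * ‖a‖ₑ ^ 2 + 2 * ‖b‖ₑ ^ 2 :=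
  (pow_le_pow_left' enorm_sub_le 2).trans (add_sq_le_two _ _)

theorem lintegral_two_mul_add_le {Y : Type*} [MeasurableSpace Y] {ν : Measure Y} {F G : Y → ℝ≥0∞}
    (hF : Measurable F) {a b : ℝ≥0∞} (h1 : ∫⁻ y, F y ∂ν ≤ a) (h2 : ∫⁻ y, G y ∂ν ≤ b) :
    ∫⁻ y, (2 * F y + 2 * G y) ∂ν ≤ 2 * a + 2 * b := by
  rw [lintegral_add_left (hF.const_mul 2), lintegral_const_mul _ hF,
    lintegral_const_mul' _ _ (by norm_num)]
  gcongr

/-! ### Estimates for one frequency shell and one block of times -/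

/-- The short time estimate, for the difference with the initial value and times of both signs. -/
theorem MaximalFamily.short_time_sub {α γ s : ℝ} (hα : 0 < α) (hγ : γ ≤ d) (hs : 0 < s) (L : ℝ≥0) :
    ∃ C : ℝ≥0, ∀ {A K : ℝ≥0} {𝓜 : Set (Measure (Space d))},
    MaximalFamily α γ (((d : ℝ) - γ) / 2 + s) A K 𝓜 → K ^ 2 ≤ L * A →
    ∀ {μ : Measure (Space d)}, μ ∈ 𝓜 → ∀ {R δ : ℝ}, 0 < R → 0 < δ → 1 ≤ R ^ α * δ →
    ∀ {g : Space d → ℂ}, BandLimited g → (∀ ξ, ‖ξ‖ < R / 2 → g ξ = 0) → (∀ ξ, R < ‖ξ‖ → g ξ = 0) →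
    ∫⁻ x, (⨆ t ∈ {t : ℝ | 0 < |t| ∧ |t| < δ}, ‖osc α g t x - osc α g 0 x‖ₑ) ^ 2 ∂μ ≤
      C * A * ENNReal.ofReal (R ^ ((d : ℝ) - γ) * (R ^ α * δ) ^ (2 * (s / min α 1))) *
        ∫⁻ ξ, ‖g ξ‖ₑ ^ 2 := by
  obtain ⟨C₁, hC₁⟩ := MaximalFamily.short_time (d := d) hα
  obtain ⟨C₂, hC₂⟩ := lintegral_osc_le (d := d)
  set σ := ((d : ℝ) - γ) / 2 + s with hσ
  set m := min α 1 with hm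
  have hm0 : 0 < m := lt_min hα one_pos
  refine ⟨4 * C₁ * Real.toNNReal ((2 * Real.pi) ^ d) ^ 2 * L * Real.toNNReal (5 ^ σ) + 2 * C₂, ?_⟩
  intro A K 𝓜 h𝓜 hK μ hμ R δ hR hδ hΛ g hg hlow hhigh
  set Λ := R ^ α * δ with hΛd
  -- The smallest admissible radius: `δ ≤ ρ^α` means `ρR ≥ Λ^(1/α)`, `δ R^(α-1) ≤ ρ` means `ρR ≥ Λ`,
  -- and for `Λ ≥ 1` the larger of the two is `Λ^(1/m)`.
  set ρ := Λ ^ (1 / m) * R⁻¹ with hρd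
  have hΛ0 : 0 < Λ := one_pos.trans_le hΛ
  have hρ : 0 < ρ := by positivity
  have hρR : ρ * R = Λ ^ (1 / m) := by
    rw [hρd, mul_assoc, inv_mul_cancel₀ hR.ne', mul_one]
  have h1m : 1 ≤ 1 / m := (one_le_div hm0).2 (min_le_right _ _)
  have hΛm : Λ ≤ Λ ^ (1 / m) := by
    calc Λ = Λ ^ (1 : ℝ) := (Real.rpow_one _).symm
      _ ≤ _ := Real.rpow_le_rpow_of_exponent_le hΛ h1m
  have hRα : 0 < R ^ α := Real.rpow_pos_of_pos hR α
  have hδ1 : δ ≤ ρ ^ α := by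
    rw [hρd, Real.mul_rpow (by positivity) (by positivity), ← Real.rpow_mul hΛ0.le,
      Real.inv_rpow hR.le, ← div_eq_mul_inv, le_div_iff₀ hRα, mul_comm]
    calc Λ = Λ ^ (1 : ℝ) := (Real.rpow_one _).symm
      _ ≤ _ := Real.rpow_le_rpow_of_exponent_le hΛ (by
        rw [one_div_mul_eq_div]
        exact (one_le_div hm0).2 (min_le_left _ _))
  have hδ2 : δ * R ^ (α - 1) ≤ ρ := by
    rw [Real.rpow_sub_one hR.ne', hρd, ← div_eq_mul_inv, ← mul_div_assoc, mul_comm]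
    gcongr
  have hone : 1 ≤ ρ * R := hρR ▸ hΛ.trans hΛm
  have hrefl : ∀ ξ, reflConj g ξ ≠ 0 → g (-ξ) ≠ 0 := fun ξ h h' => h (by simp [reflConj, h'])
  have a1 := hC₁ h𝓜 hγ hs hμ hR hρ hδ hone hδ1 hδ2 hg hlow hhigh
  have a2 := hC₁ h𝓜 hγ hs hμ hR hρ hδ hone hδ1 hδ2 hg.reflConj
    (fun ξ h => by simp [reflConj, hlow (-ξ) (by simpa using h)])
    (fun ξ h => by simp [reflConj, hhigh (-ξ) (by simpa using h)])
  rw [energy_reflConj] at a2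
  have a3 := lintegral_iSup_symm_le hα hg a1 a2
  have a4 := hC₂ hα (h𝓜.growth μ hμ) hR hg hhigh 0
  set E := ∫⁻ ξ, ‖g ξ‖ₑ ^ 2
  have hm1 : Measurable fun x => (⨆ t ∈ {t : ℝ | 0 < |t| ∧ |t| < δ}, ‖osc α g t x‖ₑ) ^ 2 :=
    (measurable_iSup_osc hα hg.integrable _).pow_const 2
  have hexp : (ρ * R) ^ (2 * s) = Λ ^ (2 * (s / m)) := by
    rw [hρR, ← Real.rpow_mul hΛ0.le]
    congr 1
    ring
  rw [hexp] at a3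
  have hΛone : 1 ≤ Λ ^ (2 * (s / m)) := Real.one_le_rpow hΛ (by positivity)
  set Q := ENNReal.ofReal (R ^ ((d : ℝ) - γ) * Λ ^ (2 * (s / m))) with hQ
  have hQ1 : ENNReal.ofReal (R ^ ((d : ℝ) - γ)) ≤ Q :=
    ENNReal.ofReal_le_ofReal (le_mul_of_one_le_right (by positivity) hΛone)
  have hKe : (K : ℝ≥0∞) ^ 2 ≤ L * A := by exact_mod_cast hK
  calc ∫⁻ x, (⨆ t ∈ {t : ℝ | 0 < |t| ∧ |t| < δ}, ‖osc α g t x - osc α g 0 x‖ₑ) ^ 2 ∂μ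
      ≤ ∫⁻ x, (2 * (⨆ t ∈ {t : ℝ | 0 < |t| ∧ |t| < δ}, ‖osc α g t x‖ₑ) ^ 2 +
          2 * ‖osc α g 0 x‖ₑ ^ 2) ∂μ := by
        refine lintegral_mono fun x => biSup_sq_le fun t ht => (enorm_sub_sq_le _ _).trans ?_
        gcongr
        exact le_iSup₂ (f := fun t _ => ‖osc α g t x‖ₑ) t ht
    _ ≤ _ := lintegral_two_mul_add_le hm1 a3 a4
    _ ≤ 2 * (2 * (C₁ * ((ENNReal.ofReal ((2 * Real.pi) ^ d)) ^ 2 * (L * A) *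
          ENNReal.ofReal (5 ^ σ) * (Q * E)))) + 2 * (C₂ * A * Q * E) := by
        rw [mul_pow]
        gcongr
    _ = _ := by
        push_cast
        simp only [ENNReal.ofReal]
        ring

theorem ofReal_block_le {a b e p : ℝ} {k : ℕ} (h : e - p * k ≤ b) :
    ENNReal.ofReal ((2 ^ k) ^ a * 2 ^ (2 * e)) ≤
      ENNReal.ofReal (2 ^ b) ^ 2 * ENNReal.ofReal (2 ^ (2 * k * (a / 2 + p))) := by
  rw [← ENNReal.ofReal_pow (by positivity), ← ENNReal.ofReal_mul (by positivity), two_pow_rpow,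
    ← Real.rpow_add two_pos, ← Real.rpow_mul_natCast two_pos.le, ← Real.rpow_add two_pos]
  refine ENNReal.ofReal_le_ofReal (Real.rpow_le_rpow_of_exponent_le one_le_two ?_)
  push_cast
  linarith

/-- A supremum over a set of times is controlled by the number of times. -/
theorem lintegral_biSup_sq_le_encard {Y : Type*} [MeasurableSpace Y] {ν : Measure Y} (T : Set ℕ)
    {F : ℕ → Y → ℝ≥0∞} (hF : ∀ n, Measurable (F n)) {c : ℝ≥0∞}
    (h : ∀ n ∈ T, ∫⁻ y, F n y ^ 2 ∂ν ≤ c) :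
    ∫⁻ y, (⨆ n ∈ T, F n y) ^ 2 ∂ν ≤ ((T.encard : ℕ∞) : ℝ≥0∞) * c := by
  calc ∫⁻ y, (⨆ n ∈ T, F n y) ^ 2 ∂ν ≤ ∫⁻ y, ∑' n : T, F n y ^ 2 ∂ν := by
        refine lintegral_mono fun y => biSup_sq_le fun n hn => ?_
        exact ENNReal.le_tsum (f := fun n : T => F n y ^ 2) ⟨n, hn⟩
    _ = ∑' n : T, ∫⁻ y, F n y ^ 2 ∂ν :=
        lintegral_tsum fun n => ((hF n).pow_const 2).aemeasurable
    _ ≤ ∑' _ : T, c := ENNReal.tsum_le_tsum fun n => h n n.2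
    _ = _ := by rw [ENNReal.tsum_set_const]

theorem measurable_osc {α : ℝ} (hα : 0 < α) {g : Space d → ℂ} (hg : Integrable g) (t : ℝ) :
    Measurable (osc α g t) :=
  (continuous_osc_right hα hg t).measurable

theorem abs_lt_of_mem_timeBlock {t : ℕ → ℝ} {j n : ℕ} (h : n ∈ timeBlock t j) :
    0 < |t n| ∧ |t n| < 2 ^ (-(j : ℝ)) :=
  ⟨lt_of_lt_of_le (by positivity) h.1, h.2⟩

/-- The estimate for frequencies of size `2 ^ k` and times of size `2 ^ (-j)`. -/
theorem MaximalFamily.timeBlock_shell_le {α γ r s : ℝ} (hα : 0 < α) (hγ : γ ≤ d) (hr : 0 < r)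
    (hs : 0 < s) (L : ℝ≥0) {t : ℕ → ℝ} (ht : MemWeakEll r t) :
    ∃ ε : ℝ, 0 < ε ∧ ∃ C : ℝ≥0, ∀ {A K : ℝ≥0} {𝓜 : Set (Measure (Space d))},
    MaximalFamily α γ (((d : ℝ) - γ) / 2 + s) A K 𝓜 → K ^ 2 ≤ L * A →
    ∀ {μ : Measure (Space d)}, μ ∈ 𝓜 → ∀ {g : Space d → ℂ}, BandLimited g → ∀ j k : ℕ,
    ∫⁻ x, (⨆ n ∈ timeBlock t j, ‖osc α ((shell d k).indicator g) (t n) x -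
        osc α ((shell d k).indicator g) 0 x‖ₑ) ^ 2 ∂μ ≤
      ENNReal.ofReal (2 ^ (-(ε * |sTilde α r s * k - r / 2 * j|))) ^ 2 *
        (C * A * (ENNReal.ofReal (2 ^ (2 * k * (((d : ℝ) - γ) / 2 + sTilde α r s))) *
          ∫⁻ ξ, ‖(shell d k).indicator g ξ‖ₑ ^ 2)) := by
  obtain ⟨ε, hε, hdec⟩ := exists_block_decay hα hr hs
  obtain ⟨D, hD⟩ := ht.encard_timeBlock_le
  obtain ⟨C₁, hC₁⟩ := lintegral_osc_le (d := d)
  obtain ⟨C₂, hC₂⟩ := MaximalFamily.short_time_sub (d := d) hα hγ hs L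
  obtain ⟨C₃, hC₃⟩ := lintegral_iSup_osc_sub_le (d := d)
  refine ⟨ε, hε, max (4 * D * C₁) (max C₂ C₃), ?_⟩
  intro A K 𝓜 h𝓜 hK μ hμ g hg j k
  have hgk := hg.indicator (measurableSet_shell (d := d) k)
  obtain ⟨d1, d2, d3⟩ := hdec k j (Nat.cast_nonneg _) (Nat.cast_nonneg _)
  set p := sTilde α r s
  set f := (shell d k).indicator g with hf
  set E := ∫⁻ ξ, ‖f ξ‖ₑ ^ 2
  set W := ENNReal.ofReal (2 ^ (2 * k * (((d : ℝ) - γ) / 2 + p)))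
  set B := ENNReal.ofReal (2 ^ (-(ε * |p * k - r / 2 * j|))) with hB
  have hR : (0 : ℝ) < 2 ^ k := by positivity
  have hδ : (0 : ℝ) < 2 ^ (-(j : ℝ)) := by positivity
  have hhigh : ∀ ξ, 2 ^ k < ‖ξ‖ → f ξ = 0 := fun ξ h =>
    Set.indicator_of_notMem (fun hm => (norm_lt_of_mem_shell hm).not_gt h) g
  have hΛ : ((2 : ℝ) ^ k) ^ α * 2 ^ (-(j : ℝ)) = 2 ^ (α * k - j) := by
    rw [two_pow_rpow, ← Real.rpow_add two_pos]
    congr 1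
    ring
  have main : ∀ {c : ℝ≥0} {e : ℝ}, c ≤ max (4 * D * C₁) (max C₂ C₃) →
      e - p * k ≤ -(ε * |p * k - r / 2 * j|) →
      (c : ℝ≥0∞) * A * ENNReal.ofReal ((2 ^ k) ^ ((d : ℝ) - γ) * 2 ^ (2 * e)) * E ≤
        B ^ 2 * ((max (4 * D * C₁) (max C₂ C₃) : ℝ≥0) * A * (W * E)) := by
    intro c e hc he
    calc _ ≤ ((max (4 * D * C₁) (max C₂ C₃) : ℝ≥0) : ℝ≥0∞) * A * (B ^ 2 * W) * E := by
          gcongr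
          exact ofReal_block_le he
      _ = _ := by ring
  -- On this side of the critical line the block has few times for its frequency, and a square sum
  -- of fixed time bounds suffices.
  rcases le_or_gt 0 (p * k - r / 2 * j) with hy | hy
  · refine le_trans ?_ (main (le_max_left _ _) (d1 hy))
    have hfix : ∀ n ∈ timeBlock t j, ∫⁻ x, ‖osc α f (t n) x - osc α f 0 x‖ₑ ^ 2 ∂μ ≤
        4 * (C₁ * A * ENNReal.ofReal ((2 ^ k) ^ ((d : ℝ) - γ)) * E) := by
      intro n _
      calc _ ≤ ∫⁻ x, (2 * ‖osc α f (t n) x‖ₑ ^ 2 + 2 * ‖osc α f 0 x‖ₑ ^ 2) ∂μ :=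
            lintegral_mono fun x => enorm_sub_sq_le _ _
        _ ≤ _ := lintegral_two_mul_add_le ((measurable_osc hα hgk.integrable _).enorm.pow_const 2)
            (hC₁ hα (h𝓜.growth μ hμ) hR hgk hhigh (t n)) (hC₁ hα (h𝓜.growth μ hμ) hR hgk hhigh 0)
        _ = _ := by ring
    refine (lintegral_biSup_sq_le_encard _ (fun n => ((measurable_osc hα hgk.integrable (t n)).sub
      (measurable_osc hα hgk.integrable 0)).enorm) hfix).trans ?_
    calc _ ≤ (D * ENNReal.ofReal (2 ^ (2 * (r / 2 * j)))) * _ := mul_le_mul_left (hD j) _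
      _ = _ := by
        rw [ENNReal.ofReal_mul (by positivity)]
        push_cast
        ring
  -- With many times the count is useless and all `|t| < 2^(-j)` are treated at once: immobility if
  -- `δ R^α ≤ 1`, the short time estimate otherwise.
  rcases le_or_gt (α * k - j) 0 with hkj | hkj
  · have h := hC₃ hα (h𝓜.growth μ hμ) hR hδ (by
      rw [mul_comm, hΛ]
      exact Real.rpow_le_one_of_one_le_of_nonpos one_le_two hkj) hgk hhigh
    have e : ((2 : ℝ) ^ (-(j : ℝ)) * ((2 : ℝ) ^ k) ^ α) ^ 2 = 2 ^ (2 * (α * k - j)) := by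
      rw [mul_comm ((2 : ℝ) ^ (-(j : ℝ))), hΛ, ← Real.rpow_mul_natCast two_pos.le]
      congr 1
      push_cast
      ring
    rw [e] at h
    refine le_trans (lintegral_mono fun x => ?_)
      (h.trans (main ((le_max_right _ _).trans (le_max_right _ _)) (d3 hy hkj)))
    gcongr
    refine iSup₂_le fun n hn => ?_
    exact le_iSup₂ (f := fun t _ => ‖osc α f t x - osc α f 0 x‖ₑ) (t n)
      (abs_le.1 (abs_lt_of_mem_timeBlock hn).2.le)
  -- The short time estimate needs frequencies bounded below, which fails on shell 0; `α k > j ≥ 0`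
  -- excludes it.
  · obtain ⟨k, rfl⟩ : ∃ k', k = k' + 1 := by
      refine Nat.exists_eq_succ_of_ne_zero fun h0 => ?_
      subst h0
      simp only [Nat.cast_zero, mul_zero, zero_sub, Left.neg_pos_iff] at hkj
      exact absurd hkj (Nat.cast_nonneg j).not_gt
    have hlow : ∀ ξ, ‖ξ‖ < 2 ^ (k + 1) / 2 → f ξ = 0 := fun ξ h =>
      Set.indicator_of_notMem (fun hm => (le_norm_of_mem_shell hm).not_gt (by
        rwa [pow_succ, mul_div_cancel_right₀ _ two_ne_zero] at h)) g
    have h := hC₂ h𝓜 hK hμ hR hδ (by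
      rw [hΛ]
      exact Real.one_le_rpow one_le_two hkj.le) hgk hlow hhigh
    have e : ((2 : ℝ) ^ (α * (k + 1 : ℕ) - j)) ^ (2 * (s / min α 1)) =
        2 ^ (2 * ((α * (k + 1 : ℕ) - j) * (s / min α 1))) := by
      rw [← Real.rpow_mul two_pos.le]
      congr 1
      ring
    rw [hΛ, e] at h
    refine le_trans (lintegral_mono fun x => ?_)
      (h.trans (main ((le_max_left _ _).trans (le_max_right _ _)) (d2 hy hkj.le)))
    gcongr
    refine iSup₂_le fun n hn => ?_
    exact le_iSup₂ (f := fun t _ => ‖osc α f t x - osc α f 0 x‖ₑ) (t n) (abs_lt_of_mem_timeBlock hn)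

/-! ### Summation over blocks -/

/-- The supremum over all times, up to the initial value, finitely many large times and a sum over
blocks. -/
theorem iSup_osc_sq_le (α : ℝ) (t : ℕ → ℝ) (g : Space d → ℂ) (x : Space d) :
    (⨆ n, ‖osc α g (t n) x‖ₑ) ^ 2 ≤
      (⨆ n ∈ {n | 1 ≤ |t n|}, ‖osc α g (t n) x‖ₑ) ^ 2 + (2 * ‖osc α g 0 x‖ₑ ^ 2 +
        2 * ∑' j, (⨆ n ∈ timeBlock t j, ‖osc α g (t n) x - osc α g 0 x‖ₑ) ^ 2) := by
  refine iSup_sq_le fun n => ?_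
  rcases le_or_gt 1 |t n| with h1 | h1
  · refine le_add_right ?_
    gcongr
    exact le_iSup₂ (f := fun n (_ : n ∈ {n | 1 ≤ |t n|}) => ‖osc α g (t n) x‖ₑ) n h1
  refine le_add_left ?_
  rcases eq_or_ne (t n) 0 with h0 | h0
  · rw [h0, two_mul]
    exact le_add_right (le_add_right le_rfl)
  obtain ⟨j, hj⟩ := exists_mem_timeBlock h0 h1
  calc ‖osc α g (t n) x‖ₑ ^ 2 = ‖osc α g 0 x + (osc α g (t n) x - osc α g 0 x)‖ₑ ^ 2 := by
        rw [add_sub_cancel]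
    _ ≤ (‖osc α g 0 x‖ₑ + ‖osc α g (t n) x - osc α g 0 x‖ₑ) ^ 2 := by
        gcongr
        exact enorm_add_le _ _
    _ ≤ _ := add_sq_le_two _ _
    _ ≤ _ := by
        gcongr
        refine le_trans ?_ (ENNReal.le_tsum j)
        gcongr
        exact le_iSup₂ (f := fun n _ => ‖osc α g (t n) x - osc α g 0 x‖ₑ) n hj

/-- The maximal estimate along the sequence, with the exponent `sTilde`. -/
theorem MaximalFamily.lintegral_iSup_seq_le {α γ r s : ℝ} (hα : 0 < α) (hγ : γ ≤ d) (hr : 0 < r)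
    (hs : 0 < s) (L : ℝ≥0) {t : ℕ → ℝ} (ht : MemWeakEll r t) :
    ∃ C : ℝ≥0, ∀ {A K : ℝ≥0} {𝓜 : Set (Measure (Space d))},
    MaximalFamily α γ (((d : ℝ) - γ) / 2 + s) A K 𝓜 → K ^ 2 ≤ L * A →
    ∀ {μ : Measure (Space d)}, μ ∈ 𝓜 → ∀ {g : Space d → ℂ}, BandLimited g →
    ∫⁻ x, (⨆ n, ‖osc α g (t n) x‖ₑ) ^ 2 ∂μ ≤
      C * A * wEnergy (((d : ℝ) - γ) / 2 + sTilde α r s) g := by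
  obtain ⟨ε, hε, C₁, hC₁⟩ := MaximalFamily.timeBlock_shell_le (d := d) hα hγ hr hs L ht
  have hp := sTilde_pos hα hr hs
  obtain ⟨C₂, hC₂⟩ := lintegral_osc_le_wEnergy (d := d) hα hγ hp
  obtain ⟨S, hS⟩ := exists_tsum_two_rpow_le hp hε
  obtain ⟨S', hS'⟩ := exists_tsum_two_rpow_le (half_pos hr) hε
  set p := sTilde α r s
  set σ := ((d : ℝ) - γ) / 2 + p with hσ
  have hσ0 : 0 ≤ σ := by linarith
  obtain ⟨D, hD⟩ : ∃ D : ℝ≥0, (D : ℝ≥0∞) = (({n : ℕ | 1 ≤ |t n|}.encard : ℕ∞) : ℝ≥0∞) :=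
    ⟨_, ENNReal.coe_toNNReal ht.encard_large_lt_top.ne⟩
  refine ⟨D * C₂ + (2 * C₂ + 2 * (S * S' * (C₁ * Real.toNNReal (4 ^ σ)))), ?_⟩
  intro A K 𝓜 h𝓜 hK μ hμ g hg
  set W := wEnergy σ g
  have hosc : ∀ τ, Measurable (osc α g τ) := fun τ => measurable_osc hα hg.integrable τ
  have hsub : ∀ {h : Space d → ℂ}, BandLimited h → ∀ j, Measurable fun x =>
      ⨆ n ∈ timeBlock t j, ‖osc α h (t n) x - osc α h 0 x‖ₑ := fun {h} hh j =>
    Measurable.iSup fun n => Measurable.iSup fun _ =>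
      ((measurable_osc hα hh.integrable _).sub (measurable_osc hα hh.integrable _)).enorm
  have hfixed := fun τ => hC₂ (h𝓜.growth μ hμ) hg τ
  have hlarge := lintegral_biSup_sq_le_encard (ν := μ) {n : ℕ | 1 ≤ |t n|}
    (fun n => (hosc (t n)).enorm) (fun n _ => hC₂ (h𝓜.growth μ hμ) hg (t n))
  -- The matrix `2^(-ε|pk - rj/2|)` has uniformly bounded rows and columns, each being a geometric
  -- sum along an arithmetic progression.
  have hblocks := schur_lintegral (ν := μ)
    (b := fun j k : ℕ => ENNReal.ofReal (2 ^ (-(ε * |p * k - r / 2 * j|))))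
    (F := fun j x => ⨆ n ∈ timeBlock t j, ‖osc α g (t n) x - osc α g 0 x‖ₑ)
    (f := fun j k x => ⨆ n ∈ timeBlock t j, ‖osc α ((shell d k).indicator g) (t n) x -
        osc α ((shell d k).indicator g) 0 x‖ₑ)
    (e := fun k : ℕ => C₁ * A * (ENNReal.ofReal (2 ^ (2 * k * σ)) *
          ∫⁻ ξ, ‖(shell d k).indicator g ξ‖ₑ ^ 2))
    (fun j k => by simpa using Real.rpow_pos_of_pos two_pos _) (fun j k => ENNReal.ofReal_ne_top)
    (fun j => hS _) (fun k => by
      refine le_trans (le_of_eq ?_) (hS' (p * k))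
      simp only [abs_sub_comm])
    (fun j k => hsub (hg.indicator (measurableSet_shell k)) j)
    (fun j x => by
      refine iSup₂_le fun n hn => ?_
      have hsum := (hasSum_osc_shell hα hg.integrable (t n) x).sub
        (hasSum_osc_shell hα hg.integrable 0 x)
      rw [← hsum.tsum_eq]
      refine enorm_tsum_le_tsum_enorm.trans (ENNReal.tsum_le_tsum fun k => ?_)
      exact le_iSup₂ (f := fun n _ => ‖osc α ((shell d k).indicator g) (t n) x -
        osc α ((shell d k).indicator g) 0 x‖ₑ) n hn)
    (fun j k => hC₁ h𝓜 hK hμ hg j k)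
  have henergy : ∑' k : ℕ, C₁ * A * (ENNReal.ofReal (2 ^ (2 * k * σ)) *
          ∫⁻ ξ, ‖(shell d k).indicator g ξ‖ₑ ^ 2) ≤ C₁ * A * (ENNReal.ofReal (4 ^ σ) * W) := by
    rw [ENNReal.tsum_mul_left]
    gcongr
    calc _ ≤ ∑' k, ENNReal.ofReal (4 ^ σ) * wEnergy σ ((shell d k).indicator g) :=
          ENNReal.tsum_le_tsum fun k => lintegral_shell_le g hσ0 k
      _ = _ := by rw [ENNReal.tsum_mul_left, tsum_wEnergy_shell hg.measurable]
  have hm1 : Measurable fun x => (⨆ n ∈ {n | 1 ≤ |t n|}, ‖osc α g (t n) x‖ₑ) ^ 2 :=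
    (Measurable.iSup fun n => Measurable.iSup fun _ => (hosc _).enorm).pow_const 2
  calc ∫⁻ x, (⨆ n, ‖osc α g (t n) x‖ₑ) ^ 2 ∂μ
      ≤ ∫⁻ x, ((⨆ n ∈ {n | 1 ≤ |t n|}, ‖osc α g (t n) x‖ₑ) ^ 2 + (2 * ‖osc α g 0 x‖ₑ ^ 2 +
        2 * ∑' j, (⨆ n ∈ timeBlock t j, ‖osc α g (t n) x - osc α g 0 x‖ₑ) ^ 2)) ∂μ :=
        lintegral_mono fun x => iSup_osc_sq_le α t g x
    _ ≤ D * (C₂ * A * W) + (2 * (C₂ * A * W) +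
          2 * (S * S' * (C₁ * A * (ENNReal.ofReal (4 ^ σ) * W)))) := by
        rw [lintegral_add_left hm1]
        gcongr
        · rw [hD]
          exact hlarge
        · refine lintegral_two_mul_add_le ((hosc 0).enorm.pow_const 2) (hC₂ (h𝓜.growth μ hμ) hg 0) ?_
          rw [lintegral_tsum fun j => ((hsub hg j).pow_const 2).aemeasurable]
          exact hblocks.trans (by gcongr)
    _ = _ := by
        push_cast
        simp only [ENNReal.ofReal]
        ring

/-- The maximal estimate along the sequence, with the exponent of the continuous maximal estimate. -/
theorem MaximalEstimate.lintegral_iSup_seq_le {α γ r s : ℝ} (hα : 0 < α) (hγ : γ ≤ d)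
    (hs : 0 < s) (L : ℝ≥0) {t : ℕ → ℝ} (ht : MemWeakEll r t) :
    ∃ C : ℝ≥0, ∀ {A K : ℝ≥0} {μ : Measure (Space d)}, GrowthBound γ μ A →
    MaximalEstimate α (Set.Ioo 0 1) (((d : ℝ) - γ) / 2 + s) μ K → K ^ 2 ≤ L * A →
    ∀ {g : Space d → ℂ}, BandLimited g →
    ∫⁻ x in Metric.ball 0 1, (⨆ n, ‖osc α g (t n) x‖ₑ) ^ 2 ∂μ ≤
      C * A * wEnergy (((d : ℝ) - γ) / 2 + s) g := by
  obtain ⟨C₂, hC₂⟩ := lintegral_osc_le_wEnergy (d := d) hα hγ hs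
  set σ := ((d : ℝ) - γ) / 2 + s with hσ
  obtain ⟨D, hD⟩ : ∃ D : ℝ≥0, (D : ℝ≥0∞) = (({n : ℕ | 1 ≤ |t n|}.encard : ℕ∞) : ℝ≥0∞) :=
    ⟨_, ENNReal.coe_toNNReal ht.encard_large_lt_top.ne⟩
  refine ⟨D * C₂ + (C₂ + 2 * (Real.toNNReal ((2 * Real.pi) ^ d) ^ 2 * L)), ?_⟩
  intro A K μ hμ H hK g hg
  have hfin : μ (Metric.ball 0 1) < ∞ := (hμ 0 1 one_pos).trans_lt (by finiteness)
  have hosc : ∀ τ, Measurable (osc α g τ) := fun τ => measurable_osc hα hg.integrable τ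
  have hrestr : ∀ τ, ∫⁻ x in Metric.ball 0 1, ‖osc α g τ x‖ₑ ^ 2 ∂μ ≤ C₂ * A * wEnergy σ g :=
    fun τ => (setLIntegral_le_lintegral _ _).trans (hC₂ hμ hg τ)
  have hlarge := lintegral_biSup_sq_le_encard (ν := μ.restrict (Metric.ball 0 1))
    {n : ℕ | 1 ≤ |t n|} (fun n => (hosc (t n)).enorm) (fun n _ => hrestr (t n))
  have b1 := MaximalEstimate.bandLimited hα H hfin hg
  have b2 := MaximalEstimate.bandLimited hα H hfin hg.reflConj
  rw [wEnergy_reflConj] at b2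
  have hsmall := lintegral_iSup_symm_le hα hg b1 b2
  have hKe : (K : ℝ≥0∞) ^ 2 ≤ L * A := by exact_mod_cast hK
  calc _ ≤ ∫⁻ x in Metric.ball 0 1, ((⨆ n ∈ {n | 1 ≤ |t n|}, ‖osc α g (t n) x‖ₑ) ^ 2 +
        (‖osc α g 0 x‖ₑ ^ 2 + (⨆ τ ∈ {τ : ℝ | 0 < |τ| ∧ |τ| < 1}, ‖osc α g τ x‖ₑ) ^ 2)) ∂μ := by
        refine lintegral_mono fun x => iSup_sq_le fun n => ?_
        rcases le_or_gt 1 |t n| with h1 | h1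
        · refine le_add_right ?_
          gcongr
          exact le_iSup₂ (f := fun n (_ : n ∈ {n | 1 ≤ |t n|}) => ‖osc α g (t n) x‖ₑ) n h1
        refine le_add_left ?_
        rcases eq_or_ne (t n) 0 with h0 | h0
        · rw [h0]
          exact le_add_right le_rfl
        refine le_add_left ?_
        gcongr
        exact le_iSup₂ (f := fun τ (_ : τ ∈ {τ : ℝ | 0 < |τ| ∧ |τ| < 1}) => ‖osc α g τ x‖ₑ) (t n)
          ⟨abs_pos.2 h0, h1⟩
    _ ≤ D * (C₂ * A * wEnergy σ g) + (C₂ * A * wEnergy σ g +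
          2 * (ENNReal.ofReal ((2 * Real.pi) ^ d) ^ 2 * (L * A) * wEnergy σ g)) := by
        rw [lintegral_add_left ((Measurable.iSup fun n => Measurable.iSup fun _ =>
          (hosc _).enorm).pow_const 2), lintegral_add_left ((hosc 0).enorm.pow_const 2)]
        gcongr
        · rw [hD]
          exact hlarge
        · exact hrestr 0
        · refine hsmall.trans ?_
          rw [mul_pow]
          gcongr
    _ = _ := by
        push_cast
        simp only [ENNReal.ofReal]
        ring

/-! ### From band limited to Sobolev data -/

theorem measurable_fourierHat (f : Lp ℂ 2 (volume : Measure (Space d))) : Measurable (fourierHat f) :=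
  (Lp.stronglyMeasurable _).measurable.comp (measurable_const_smul _)

theorem exists_tendsto_eLpNorm_sub {Y : Type*} [MeasurableSpace Y] {ν : Measure Y}
    {f : ℕ → Y → ℂ} (hf : ∀ n, MemLp (f n) 2 ν) {b : ℕ → ℝ≥0∞} (hb : Tendsto b atTop (𝓝 0))
    (h : ∀ n m N, N ≤ n → N ≤ m → eLpNorm (f n - f m) 2 ν ≤ b N) :
    ∃ u : Y → ℂ, StronglyMeasurable u ∧ MemLp u 2 ν ∧
      Tendsto (fun N => eLpNorm (f N - u) 2 ν) atTop (𝓝 0) := by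
  have hc : CauchySeq fun n => (hf n).toLp (f n) :=
    EMetric.cauchySeq_iff_le_tendsto_0.2
      ⟨b, fun n m N hn hm => (Lp.edist_toLp_toLp _ _ (hf n) (hf m)).le.trans (h n m N hn hm), hb⟩
  obtain ⟨U, hU⟩ := cauchySeq_tendsto_of_complete hc
  refine ⟨U, Lp.stronglyMeasurable U, Lp.memLp U, ?_⟩
  rw [← Lp.tendsto_Lp_iff_tendsto_eLpNorm'' f hf U (Lp.memLp U), Lp.toLp_coeFn]
  exact hU

theorem tendsto_wEnergy_tail {σ : ℝ} {g : Space d → ℂ} (hg : Measurable g) (h : wEnergy σ g < ∞) :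
    Tendsto (fun N : ℕ => wEnergy σ ((Metric.ball (0 : Space d) N)ᶜ.indicator g)) atTop (𝓝 0) := by
  have h0 : (0 : ℝ≥0∞) = ∫⁻ _ : Space d, 0 := by simp
  rw [h0]
  refine tendsto_lintegral_of_dominated_convergence
    (fun ξ => ENNReal.ofReal ((1 + ‖ξ‖ ^ 2) ^ σ) * ‖g ξ‖ₑ ^ 2) (fun N => ?_) (fun N => ?_) h.ne ?_
  · exact (measurable_ofReal_weight σ).mul
      ((hg.indicator measurableSet_ball.compl).enorm.pow_const 2)
  · refine .of_forall fun ξ => ?_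
    by_cases hξ : ξ ∈ (Metric.ball (0 : Space d) N)ᶜ
    · simp [hξ]
    · simp only [Set.indicator_of_notMem hξ]
      simp
  · refine .of_forall fun ξ => tendsto_const_nhds.congr' ?_
    obtain ⟨n, hn⟩ := exists_nat_gt ‖ξ‖
    filter_upwards [eventually_ge_atTop n] with N hN
    have : (n : ℝ) ≤ N := by exact_mod_cast hN
    rw [Set.indicator_of_notMem (by simp; linarith)]
    simp

/-- The supremum of limits in `L²`. -/
theorem eLpNorm_iSup_le_of_tendsto {Y : Type*} [MeasurableSpace Y] {ν : Measure Y}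
    {v : ℕ → ℕ → Y → ℂ} {u : ℕ → Y → ℂ} (hv : ∀ N n, Measurable (v N n)) (hu : ∀ n, Measurable (u n))
    (hlim : ∀ n, Tendsto (fun N => eLpNorm (v N n - u n) 2 ν) atTop (𝓝 0)) {c : ℝ≥0∞}
    (h : ∀ N, eLpNorm (fun y => ⨆ n, ‖v N n y‖ₑ) 2 ν ≤ c) :
    eLpNorm (fun y => ⨆ n, ‖u n y‖ₑ) 2 ν ≤ c := by
  -- The convergence is not uniform in `n`, so only finitely many errors are summed at a time;
  -- monotone convergence in `m` finishes.
  have hfin : ∀ m, eLpNorm (fun y => ⨆ n, ⨆ (_ : n < m), ‖u n y‖ₑ) 2 ν ≤ c := by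
    intro m
    have hlim' : Tendsto (fun N => c + ∑ n ∈ Finset.range m, eLpNorm (v N n - u n) 2 ν) atTop (𝓝 c) := by
      have := tendsto_const_nhds (x := c).add (tendsto_finsetSum (Finset.range m) fun n _ => hlim n)
      simpa using this
    refine ge_of_tendsto' hlim' fun N => ?_
    calc _ ≤ eLpNorm ((fun y => ⨆ n, ‖v N n y‖ₑ) +
          ∑ n ∈ Finset.range m, fun y => ‖(v N n - u n) y‖ₑ) 2 ν := by
          refine eLpNorm_mono_enorm fun y => ?_
          simp only [enorm_eq_self, Pi.add_apply, Finset.sum_apply]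
          refine iSup₂_le fun n hn => ?_
          calc ‖u n y‖ₑ = ‖v N n y - (v N n - u n) y‖ₑ := by simp
            _ ≤ ‖v N n y‖ₑ + ‖(v N n - u n) y‖ₑ := enorm_sub_le
            _ ≤ _ := add_le_add (le_iSup (fun n => ‖v N n y‖ₑ) n)
              (Finset.single_le_sum (f := fun n => ‖(v N n - u n) y‖ₑ) (fun _ _ => zero_le)
                (Finset.mem_range.2 hn))
      _ ≤ eLpNorm (fun y => ⨆ n, ‖v N n y‖ₑ) 2 ν +
          eLpNorm (∑ n ∈ Finset.range m, fun y => ‖(v N n - u n) y‖ₑ) 2 ν := by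
          refine eLpNorm_add_le (Measurable.iSup fun n => (hv N n).enorm).aestronglyMeasurable
            ?_ (by norm_num)
          exact Finset.aestronglyMeasurable_sum _ fun n _ =>
            ((hv N n).sub (hu n)).enorm.aestronglyMeasurable
      _ ≤ _ := by
          gcongr
          · exact h N
          · refine (eLpNorm_sum_le (fun n _ => ((hv N n).sub (hu n)).enorm.aestronglyMeasurable)
              (by norm_num)).trans_eq ?_
            simp only [eLpNorm_enorm]
  rw [eLpNorm_two_le_iff]
  simp only [enorm_eq_self]
  have heq : ∀ y, (⨆ n, ‖u n y‖ₑ) ^ 2 = ⨆ m, (⨆ n, ⨆ (_ : n < m), ‖u n y‖ₑ) ^ 2 := by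
    intro y
    rw [← ENNReal.iSup_pow]
    congr 1
    exact le_antisymm
      (iSup_le fun n => le_iSup_of_le (n + 1) (le_iSup₂_of_le n n.lt_succ_self le_rfl))
      (iSup_le fun m => iSup₂_le fun n _ => le_iSup (fun n => ‖u n y‖ₑ) n)
  simp only [heq]
  rw [lintegral_iSup]
  · refine iSup_le fun m => ?_
    have := (eLpNorm_two_le_iff _ _ _).1 (hfin m)
    simpa only [enorm_eq_self] using this
  · exact fun m => (Measurable.iSup fun n => Measurable.iSup fun _ => (hu n).enorm).pow_const 2
  · intro a b hab y
    exact pow_le_pow_left' (biSup_mono fun n hn => hn.trans_le hab) 2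

/-- A bound for band limited data implies the existence of the limits and the maximal estimate. -/
theorem SeqMaximalEstimate.of_bandLimited {α σ : ℝ} (hα : 0 < α) (hσ : 0 ≤ σ) {t : ℕ → ℝ}
    {μ : Measure (Space d)} {c : ℝ≥0} (h : ∀ {g : Space d → ℂ}, BandLimited g →
      ∫⁻ x in Metric.ball 0 1, (⨆ n, ‖osc α g (t n) x‖ₑ) ^ 2 ∂μ ≤ c ^ 2 * wEnergy σ g) :
    SeqMaximalEstimate α t σ μ c := by
  intro f hf
  set g := fourierHat f with hgdef
  have hgm : Measurable g := measurable_fourierHat f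
  have hW : wEnergy σ g < ∞ := by
    rw [← sobolevNorm_sq]
    finiteness
  have hE : ∫⁻ ξ, ‖g ξ‖ₑ ^ 2 < ∞ := by
    rw [← wEnergy_zero]
    exact (wEnergy_mono hσ g).trans_lt hW
  set G : ℕ → Space d → ℂ := fun N => (Metric.ball (0 : Space d) N).indicator g with hG
  have hGB : ∀ N, BandLimited (G N) := fun N => by
    refine ⟨hgm.indicator measurableSet_ball, (lintegral_mono fun ξ => ?_).trans_lt hE, N, fun ξ hξ =>
      Set.indicator_of_notMem (by simpa using hξ.le) g⟩
    by_cases hm : ξ ∈ Metric.ball (0 : Space d) N <;> simp [hG, hm]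
  have hGle : ∀ N, wEnergy σ (G N) ≤ wEnergy σ g := fun N => by
    refine lintegral_mono fun ξ => ?_
    by_cases hm : ξ ∈ Metric.ball (0 : Space d) N
    · simp [hG, hm]
    · simp only [hG]
      rw [Set.indicator_of_notMem hm]
      simp
  set ν := μ.restrict (Metric.ball (0 : Space d) 1) with hν
  set v : ℕ → ℕ → Space d → ℂ := fun N n x => propagatorOn α (Metric.ball 0 (N : ℝ)) f (t n) x with hv
  have hveq : ∀ N n x, v N n x = (((2 * Real.pi) ^ d)⁻¹ : ℝ) * osc α (G N) (t n) x := fun N n x =>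
    propagatorOn_eq α measurableSet_ball f (t n) x
  -- The normalizing factor is at most 1 and is simply dropped.
  have hone : ‖((((2 * Real.pi) ^ d)⁻¹ : ℝ) : ℂ)‖ₑ ≤ 1 := by
    rw [← ofReal_norm, Complex.norm_real, Real.norm_eq_abs, abs_of_pos (by positivity)]
    refine ENNReal.ofReal_le_one.2 (inv_le_one_of_one_le₀ (one_le_pow₀ ?_))
    linarith [Real.pi_gt_three]
  have hvm : ∀ N n, Measurable (v N n) := fun N n => by
    have : v N n = fun x => (((2 * Real.pi) ^ d)⁻¹ : ℝ) * osc α (G N) (t n) x := funext (hveq N n)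
    rw [this]
    exact (measurable_osc hα (hGB N).integrable (t n)).const_mul _
  have hbound : ∀ {F : Space d → ℂ}, BandLimited F → ∀ {w : ℕ → Space d → ℂ},
      (∀ n x, w n x = (((2 * Real.pi) ^ d)⁻¹ : ℝ) * osc α F (t n) x) →
      ∫⁻ x, (⨆ n, ‖w n x‖ₑ) ^ 2 ∂ν ≤ c ^ 2 * wEnergy σ F := by
    intro F hF w hw
    refine le_trans (lintegral_mono fun x => ?_) (h hF)
    gcongr with n
    rw [hw, enorm_mul]
    exact mul_le_of_le_one_left (zero_le) hone
  have hsup : ∀ N, eLpNorm (fun x => ⨆ n, ‖v N n x‖ₑ) 2 ν ≤ c * sobolevNorm σ f := by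
    intro N
    rw [eLpNorm_two_le_iff, mul_pow, sobolevNorm_sq]
    simp only [enorm_eq_self]
    exact (hbound (hGB N) (hveq N)).trans (mul_le_mul_right (hGle N) _)
  have hmem : ∀ N n, MemLp (v N n) 2 ν := fun N n => by
    refine ⟨(hvm N n).aestronglyMeasurable, lt_of_le_of_lt ?_ ((hsup N).trans_lt (by finiteness))⟩
    refine eLpNorm_mono_enorm fun x => ?_
    rw [enorm_eq_self]
    exact le_iSup (fun n => ‖v N n x‖ₑ) n
  set τ : ℕ → ℝ≥0∞ := fun N => wEnergy σ ((Metric.ball (0 : Space d) N)ᶜ.indicator g)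
  have hτ : Tendsto (fun N => (c : ℝ≥0∞) * τ N ^ (1 / 2 : ℝ)) atTop (𝓝 0) := by
    have h1 := ((ENNReal.continuous_rpow_const (y := 1 / 2)).tendsto 0).comp
      (tendsto_wEnergy_tail hgm hW)
    have h2 := ENNReal.Tendsto.const_mul h1 (Or.inr (ENNReal.coe_ne_top (r := c)))
    simpa using h2
  -- The difference of two truncations is band limited with energy at most that of the tail, so the
  -- maximal bound itself makes the truncations Cauchy in `L²(ν)`.
  have hcau : ∀ k n m N, N ≤ n → N ≤ m →
      eLpNorm (v n k - v m k) 2 ν ≤ c * τ N ^ (1 / 2 : ℝ) := by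
    intro k n m N hn hm
    have hsq : (τ N ^ (1 / 2 : ℝ)) ^ 2 = τ N := by
      rw [← ENNReal.rpow_mul_natCast]
      norm_num
    rw [eLpNorm_two_le_iff, mul_pow, hsq]
    have hF : BandLimited (fun ξ => G n ξ - G m ξ) := by
      refine ⟨(hGB n).measurable.sub (hGB m).measurable, ?_, max n m, fun ξ hξ => ?_⟩
      · refine (lintegral_mono fun ξ => enorm_sub_sq_le (G n ξ) (G m ξ)).trans_lt ?_
        exact (lintegral_two_mul_add_le ((hGB n).measurable.enorm.pow_const 2) le_rfl le_rfl).trans_lt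
          (by have := (hGB n).energy_lt_top; have := (hGB m).energy_lt_top; finiteness)
      · have h1 : (n : ℝ) < ‖ξ‖ := (le_max_left _ _).trans_lt hξ
        have h2 : (m : ℝ) < ‖ξ‖ := (le_max_right _ _).trans_lt hξ
        simp only [hG]
        rw [Set.indicator_of_notMem (by simpa using h1.le), Set.indicator_of_notMem (by simpa using h2.le),
          sub_zero]
    have hFle : wEnergy σ (fun ξ => G n ξ - G m ξ) ≤ τ N := by
      refine lintegral_mono fun ξ => ?_
      gcongr
      have hn' : (N : ℝ) ≤ n := by exact_mod_cast hn
      have hm' : (N : ℝ) ≤ m := by exact_mod_cast hm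
      by_cases hξ : ξ ∈ Metric.ball (0 : Space d) N
      · have h1 : ξ ∈ Metric.ball (0 : Space d) n := Metric.ball_subset_ball hn' hξ
        have h2 : ξ ∈ Metric.ball (0 : Space d) m := Metric.ball_subset_ball hm' hξ
        simp [hG, h1, h2]
      · rw [Set.indicator_of_mem (Set.mem_compl hξ)]
        simp only [hG]
        by_cases h1 : ξ ∈ Metric.ball (0 : Space d) n <;>
        by_cases h2 : ξ ∈ Metric.ball (0 : Space d) m <;> simp [h1, h2]
    refine le_trans (lintegral_mono fun x => ?_) ((hbound hF (w := fun j => v n j - v m j) ?_).trans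
      (mul_le_mul_right hFle _))
    · gcongr
      exact le_iSup (fun j => ‖(v n j - v m j) x‖ₑ) k
    · intro j x
      rw [Pi.sub_apply, hveq, hveq, ← mul_sub, osc_sub hα (hGB n).integrable (hGB m).integrable]
  choose u hum hu2 hulim using fun k =>
    exists_tendsto_eLpNorm_sub (fun N => hmem N k) hτ (hcau k)
  exact ⟨u, fun n => ⟨hu2 n, hulim n⟩,
    eLpNorm_iSup_le_of_tendsto hvm (fun n => (hum n).measurable) hulim hsup⟩

/-- An exponent above the minimum lies above `s` or above `sTilde α r s`, and the energies increase
with the exponent. The relation `K ^ 2 ≤ L * A` makes every bound linear in `A`, so the constant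
depends on `L` but not on `A` or `K`. -/
theorem MaximalFamily.exists_seqMaximalEstimate {α γ r s : ℝ} (hα : 0 < α) (hγ : γ ≤ d)
    (hr : 0 < r) (hs : 0 < s) (L : ℝ≥0) {t : ℕ → ℝ} (ht : MemWeakEll r t) :
    ∃ C : ℝ≥0, 0 < C ∧ ∀ {A K : ℝ≥0} {𝓜 : Set (Measure (Space d))},
    MaximalFamily α γ (((d : ℝ) - γ) / 2 + s) A K 𝓜 → K ^ 2 ≤ L * A →
    ∀ {μ : Measure (Space d)}, μ ∈ 𝓜 → ∀ {s' : ℝ}, min s (sTilde α r s) ≤ s' →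
    SeqMaximalEstimate α t (((d : ℝ) - γ) / 2 + s') μ (C * NNReal.sqrt A) := by
  obtain ⟨C₁, hC₁⟩ := MaximalFamily.lintegral_iSup_seq_le (d := d) hα hγ hr hs L ht
  obtain ⟨C₂, hC₂⟩ := MaximalEstimate.lintegral_iSup_seq_le (d := d) hα hγ hs L ht
  have hp := sTilde_pos hα hr hs
  refine ⟨NNReal.sqrt (max C₁ C₂) + 1, by positivity, ?_⟩
  intro A K 𝓜 h𝓜 hK μ hμ s' hs'
  have hs0 : 0 ≤ s' := (lt_min hs hp).le.trans hs'
  refine SeqMaximalEstimate.of_bandLimited hα (by linarith) fun {g} hg => ?_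
  have hconst : ∀ {c : ℝ≥0} {s₀ : ℝ}, c ≤ max C₁ C₂ → s₀ ≤ s' →
      (c : ℝ≥0∞) * A * wEnergy (((d : ℝ) - γ) / 2 + s₀) g ≤
      (((NNReal.sqrt (max C₁ C₂) + 1) * NNReal.sqrt A : ℝ≥0) : ℝ≥0∞) ^ 2 *
        wEnergy (((d : ℝ) - γ) / 2 + s') g := by
    intro c s₀ hc h0
    refine mul_le_mul' ?_ (wEnergy_mono (by linarith) g)
    have : c * A ≤ ((NNReal.sqrt (max C₁ C₂) + 1) * NNReal.sqrt A) ^ 2 := by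
      rw [mul_pow, NNReal.sq_sqrt]
      refine mul_le_mul_left (hc.trans ?_) A
      calc max C₁ C₂ = NNReal.sqrt (max C₁ C₂) ^ 2 := (NNReal.sq_sqrt _).symm
        _ ≤ _ := pow_le_pow_left' le_self_add 2
    exact_mod_cast this
  rcases min_le_iff.1 hs' with h | h
  · exact (hC₂ (h𝓜.growth μ hμ) (h𝓜.maximal μ hμ) hK hg).trans (hconst (le_max_right _ _) h)
  · exact (setLIntegral_le_lintegral _ _).trans
      ((hC₁ h𝓜 hK hμ hg).trans (hconst (le_max_left _ _) h))

/-! ### The two dilation stable classes and the theorem -/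

/-- The infimum is attained, because the admissible constants form a nonempty closed set. -/
theorem IsDimensional.growthBound {γ : ℝ} {μ : Measure (Space d)} (h : IsDimensional γ μ) :
    GrowthBound γ μ (growthConst γ μ) := by
  have hcl : IsClosed {C : ℝ≥0 | GrowthBound γ μ C} := by
    simp only [GrowthBound, Set.ofPred_forall]
    refine isClosed_iInter fun x => isClosed_iInter fun ρ => isClosed_iInter fun _ => ?_
    exact isClosed_le continuous_const
      ((ENNReal.continuous_mul_const ENNReal.ofReal_ne_top).comp ENNReal.continuous_coe)
  exact hcl.csInf_mem h (OrderBot.bddBelow _)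

theorem preimage_dilate_ball {ρ R : ℝ} (hρ : 0 < ρ) (x₀ y : Space d) :
    (fun x => ρ⁻¹ • (x - x₀)) ⁻¹' Metric.ball y R = Metric.ball (x₀ + ρ • y) (ρ * R) := by
  ext x
  simp only [Set.mem_preimage, Metric.mem_ball, dist_eq_norm]
  have e : x - (x₀ + ρ • y) = ρ • (ρ⁻¹ • (x - x₀) - y) := by
    rw [smul_sub, smul_inv_smul₀ hρ.ne']
    abel
  rw [e, norm_smul, Real.norm_eq_abs, abs_of_pos hρ, mul_lt_mul_iff_right₀ hρ]

theorem GrowthBound.dilate {γ : ℝ} {μ : Measure (Space d)} {A : ℝ≥0} (h : GrowthBound γ μ A)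
    (x₀ : Space d) {ρ : ℝ} (hρ : 0 < ρ) :
    GrowthBound γ (ENNReal.ofReal (ρ ^ (-γ)) • μ.map (fun x => ρ⁻¹ • (x - x₀))) A := by
  intro y R hR
  rw [Measure.smul_apply, Measure.map_apply (by fun_prop) measurableSet_ball,
    preimage_dilate_ball hρ, smul_eq_mul]
  refine (mul_le_mul_right (h _ _ (by positivity)) _).trans_eq ?_
  rw [Real.mul_rpow hρ.le hR.le, ENNReal.ofReal_mul (by positivity)]
  have : ENNReal.ofReal (ρ ^ (-γ)) * ENNReal.ofReal (ρ ^ γ) = 1 := by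
    rw [← ENNReal.ofReal_mul (by positivity), ← Real.rpow_add hρ]
    simp
  calc _ = (ENNReal.ofReal (ρ ^ (-γ)) * ENNReal.ofReal (ρ ^ γ)) * (A * ENNReal.ofReal (R ^ γ)) := by ring
    _ = _ := by rw [this, one_mul]

theorem MaximalEstimate.mono {α σ : ℝ} {T T' : Set ℝ} {μ : Measure (Space d)} {K K' : ℝ≥0}
    (h : MaximalEstimate α T σ μ K) (hT : T' ⊆ T) (hK : K ≤ K') : MaximalEstimate α T' σ μ K' := by
  intro f
  refine (eLpNorm_mono_enorm fun x => ?_).trans ((h f).trans (by gcongr))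
  simp only [enorm_eq_self]
  exact biSup_mono hT

/-- Fixing the bound `A` gives a dilation stable class, and `growthConst γ μ ≤ A` makes the
hypothesis uniform on it. -/
theorem maximalFamily_growthBound {α γ σ : ℝ} {C : ℝ≥0} (h : ∀ μ : Measure (Space d),
    IsDimensional γ μ → MaximalEstimate α (Set.Ioo 0 1) σ μ (C * NNReal.sqrt (growthConst γ μ)))
    (A : ℝ≥0) : MaximalFamily (d := d) α γ σ A (C * NNReal.sqrt A) {μ | GrowthBound γ μ A} where
  growth _ hμ := hμ
  dilate _ hμ x₀ _ hρ := hμ.dilate x₀ hρ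
  maximal μ hμ := (h μ ⟨A, hμ⟩).mono subset_rfl (by
    have : growthConst γ μ ≤ A := csInf_le (OrderBot.bddBelow _) hμ
    gcongr)

/-- For `γ = d` the normalized dilations fix Lebesgue measure, so it is a stable class by itself. -/
theorem maximalFamily_volume {α σ : ℝ} {C : ℝ≥0}
    (h : MaximalEstimate (d := d) α (Set.Ioc 0 1) σ volume C) :
    MaximalFamily (d := d) α d σ (volume (Metric.ball (0 : Space d) 1)).toNNReal C {volume} where
  growth := by
    rintro _ rfl x ρ hρ
    rw [Measure.addHaar_ball_of_pos _ _ hρ, finrank_euclideanSpace_fin,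
      ENNReal.coe_toNNReal measure_ball_lt_top.ne, mul_comm, Real.rpow_natCast]
  dilate := by
    rintro _ rfl x₀ ρ hρ
    have e : (fun x : Space d => ρ⁻¹ • (x - x₀)) = (fun x => ρ⁻¹ • x) ∘ fun x => x - x₀ := rfl
    have hpos : 0 < ρ ^ d := by positivity
    rw [Set.mem_singleton_iff, e, ← Measure.map_map (by fun_prop) (by fun_prop),
      (measurePreserving_sub_right volume x₀).map_eq, Measure.map_addHaar_smul _ (inv_ne_zero hρ.ne'),
      finrank_euclideanSpace_fin, smul_smul, ← ENNReal.ofReal_mul (by positivity), inv_pow, inv_inv,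
      abs_of_pos hpos, Real.rpow_neg hρ.le, Real.rpow_natCast, inv_mul_cancel₀ hpos.ne',
      ENNReal.ofReal_one, one_smul]
  maximal := by
    rintro _ rfl
    exact h.mono Set.Ioo_subset_Ioc_self le_rfl

end SeqSchrodinger

end

theorem corollary3p2 (d : ℕ) (hd : 1 ≤ d) (α r sStar : ℝ) (hα : 0 < α) (hr : 0 < r)
    (hs : 0 < sStar) :
    -- the fractal estimate
    (∀ γ : ℝ, 0 < γ → γ ≤ (d : ℝ) →
      (∃ C : ℝ≥0, ∀ μ : Measure (EuclideanSpace ℝ (Fin d)), SeqSchrodinger.IsDimensional γ μ →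
        SeqSchrodinger.MaximalEstimate α (Set.Ioo 0 1) (((d : ℝ) - γ) / 2 + sStar) μ
          (C * NNReal.sqrt (SeqSchrodinger.growthConst γ μ))) →
      ∀ t : ℕ → ℝ, SeqSchrodinger.MemWeakEll r t →
        ∃ C' : ℝ≥0, 0 < C' ∧
          ∀ s : ℝ, min sStar (SeqSchrodinger.sTilde α r sStar) ≤ s →
            ∀ μ : Measure (EuclideanSpace ℝ (Fin d)), SeqSchrodinger.IsDimensional γ μ →
              SeqSchrodinger.SeqMaximalEstimate α t (((d : ℝ) - γ) / 2 + s) μ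
                (C' * NNReal.sqrt (SeqSchrodinger.growthConst γ μ)))
    ∧
    -- the consequence for Lebesgue measure
    ((∃ C : ℝ≥0, SeqSchrodinger.MaximalEstimate (d := d) α (Set.Ioc 0 1) sStar volume C) →
      ∀ t : ℕ → ℝ, SeqSchrodinger.MemWeakEll r t →
        ∃ C' : ℝ≥0, 0 < C' ∧
          ∀ s : ℝ, min sStar (SeqSchrodinger.sTilde α r sStar) ≤ s →
            SeqSchrodinger.SeqMaximalEstimate (d := d) α t s volume C') := by
  refine ⟨fun γ _ hγ ⟨C, hC⟩ t ht => ?_, fun ⟨C, hC⟩ t ht => ?_⟩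
  · obtain ⟨C', hC', H⟩ :=
      SeqSchrodinger.MaximalFamily.exists_seqMaximalEstimate (d := d) hα hγ hr hs (C ^ 2) ht
    refine ⟨C', hC', fun s hs' μ hμ => ?_⟩
    exact H (SeqSchrodinger.maximalFamily_growthBound hC (SeqSchrodinger.growthConst γ μ))
      (by rw [mul_pow, NNReal.sq_sqrt]) hμ.growthBound hs'
  · set A := (volume (Metric.ball (0 : EuclideanSpace ℝ (Fin d)) 1)).toNNReal
    have hA : 0 < A := ENNReal.toNNReal_pos (Metric.measure_ball_pos _ _ one_pos).ne'
      measure_ball_lt_top.ne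
    -- Here `K = C` and `A` is the volume of the unit ball, so `L = C ^ 2 / A` gives `K ^ 2 = L *
    -- A`.
    obtain ⟨C', hC', H⟩ := SeqSchrodinger.MaximalFamily.exists_seqMaximalEstimate (d := d) hα le_rfl
      hr hs (C ^ 2 / A) ht
    refine ⟨C' * NNReal.sqrt A, mul_pos hC' (NNReal.sqrt_pos.2 hA), fun s hs' => ?_⟩
    have h0 : ∀ x : ℝ, ((d : ℝ) - d) / 2 + x = x := fun x => by ring
    have h1 := SeqSchrodinger.maximalFamily_volume hC
    rw [← h0 sStar] at h1
    have h2 := H h1 (div_mul_cancel₀ _ hA.ne').ge rfl hs'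
    rwa [h0] at h2
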